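/- **Setting.** Let $\Omega$ be a real or complex Banach space, $0<\alpha\le 1$, $0\le\beta\le 1$, $\gamma=\alpha+\beta(1-\alpha)$, $t_0\ge 0$, $a>0$, $J=[t_0,t_0+a]$, $t_0<t_1<\dots<t_p\le t_0+a$, let $C_1,\dots,C_p$ be nonzero scalars, $u_0\in\Omega$, $f:J\times\Omega^{r+1}\to\Omega$ and $b_1,\dots,b_r:J\to J$ (with $p,r\in\mathbb N$). For $\delta>0$ write $I^{\delta}_{c+}w(t)=\frac1{\Gamma(\delta)}\int_c^t(t-s)^{\delta-1}w(s)\,ds$, and $I^0_{c+}w=w$; the Hilfer derivative is ${}^H\mathbb D^{\alpha,\beta}_{t_0^+}u=I^{\beta(1-\alpha)}_{t_0+}\frac{d}{dt}I^{(1-\beta)(1-\alpha)}_{t_0+}u$. Let $\mathcal A$ be a closed densely defined linear operator in $\Omega$ for which there are $\widetilde M>0$ and $\omega\in\mathbb R$ with $(\omega,\infty)\subset\rho(-\mathcal A)$ and $\|(\mathcal A+\xi)^{-k}\|\le\widetilde M(\xi-\omega)^{-k}$ for all $\xi>\omega$, $k=1,2,\dots$. Let $(T(t))_{t\ge0}$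 be the strongly continuous semigroup generated by $-\mathcal A$, let $$M_\alpha(\theta)=\sum_{n\ge0}\frac{(-\theta)^n}{n!\,\Gamma(1-\alpha(n+1))}\qquad(0<\alpha<1)$$ with $1/\Gamma=0$ at the poles of $\Gamma$, and put, for $t>0$, $$G_\alpha(t)=\int_0^\infty\alpha\theta M_\alpha(\theta)\,T(t^\alpha\theta)\,d\theta\ \ (0<\alpha<1),\qquad G_1(t)=T(t),$$ $$K_\alpha(t)=t^{\alpha-1}G_\alpha(t),\qquad \mathbb S_{\alpha,\beta}(t)=I^{\beta(1-\alpha)}_{0+}K_\alpha(t),$$ where operator integrals are understood strongly. Assume that the operator $$\mathrm I+\sum_{k=1}^pC_k\,\bigl(I^{1-\gamma}_{0+}\mathbb S_{\alpha,\beta}\bigr)(t_k-t_0)$$ on $\Omega$ has an everywhere defined inverse $B$. Consider the nonlocal problem $$ {}^H\mathbb D^{\alpha,\beta}_{t_0^+}u(t)+\mathcal Au(t)=f\bigl(t,u(t),u(b_1(t)),\dots,u(b_r(t))\bigr),\quad t\in J\setminus\{t_0\},\tag{1}$$ $$ I^{1-\gamma}_{t_0+}u(t_0^+)+\sum_{k=1}^pC_k\,I^{1-\gamma}_{t_0+}u(t_k)=u_0.\tag{2}$$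 A function $u:J\to\Omega$ is a *classical solution* of (1)–(2) if it is continuous on $J$ and continuously differentiable on $J\setminus\{t_0\}$, if for every $t\in J\setminus\{t_0\}$ the Hilfer derivative exists (its integrals converge absolutely), $u(t)\in D(\mathcal A)$ and (1) holds, and if (2) holds, $I^{1-\gamma}_{t_0+}u(t_0^+)$ being the right limit of $I^{1-\gamma}_{t_0+}u$ at $t_0$. A function $u$ is a *mild solution* of (1)–(2) if $u\in C_{1-\gamma}(J,\Omega)$, that is, $u$ is continuous on $J\setminus\{t_0\}$ and $(t-t_0)^{1-\gamma}u(t)$ extends continuously to $J$ (for $\gamma=1$: $u\in C(J,\Omega)$), and, with all integrals convergent, for all $t\in J\setminus\{t_0\}$, $$u(t)=\mathbb S_{\alpha,\beta}(t-t_0)Bu_0+w(t)-\mathbb S_{\alpha,\beta}(t-t_0)B\sum_{k=1}^pC_k\,I^{1-\gamma}_{t_0+}w(t_k),\tag{3}$$ $$w(t)=\int_{t_0}^tK_\alpha(t-s)f\bigl(s,u(s),u(b_1(s)),\dots,u(b_r(s))\bigr)\,ds.$$ **Theorem.** Suppose that $f$ is Lipschitz continuous on $J\times\Omega^{r+1}$.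 Then every classical solution $u$ of (1)–(2) is a mild solution of (1)–(2). -/

import Mathlib

open Set Filter Topology MeasureTheory
open scoped NNReal

noncomputable section

namespace HilferEvolution

/-- The order parameter `γ = α + β (1 - α)`. -/
def gam (α β : ℝ) : ℝ := α + β * (1 - α)

section Calculus

variable {E : Type*} [NormedAddCommGroup E] [NormedSpace ℝ E]

/-- The left-sided Riemann-Liouville fractional integral of order `δ ≥ 0` with base point `c`,
`I_{c+}^δ w (t) = Γ(δ)⁻¹ ∫_c^t (t - s)^(δ - 1) w(s) ds` for `δ > 0`; `I^0` is the identity. -/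
def fracInt (δ c : ℝ) (w : ℝ → E) (t : ℝ) : E :=
  if δ = 0 then w t
  else (Real.Gamma δ)⁻¹ • ∫ s in c..t, (t - s) ^ (δ - 1) • w s

/-- The integral defining `fracInt δ c w t` converges absolutely. -/
def FracIntExists (δ c : ℝ) (w : ℝ → E) (t : ℝ) : Prop :=
  δ ≠ 0 → IntervalIntegrable (fun s => (t - s) ^ (δ - 1) • w s) volume c t

/-- `HasHilferDerivOn α β c d u D`: the function `u` has on `(c, d]` the Hilfer fractional
derivative `D` of order `α ∈ (0, 1]` and type `β ∈ [0, 1]` with base point `c`, that is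
`D(t) = I_{c+}^{β(1-α)} (d/dt) I_{c+}^{(1-β)(1-α)} u (t)`, all operations being meaningful.
(At the right end point `d` the derivative is the left one.) -/
def HasHilferDerivOn (α β c d : ℝ) (u D : ℝ → E) : Prop :=
  ∃ v' : ℝ → E,
    ∀ t ∈ Ioc c d,
      FracIntExists ((1 - β) * (1 - α)) c u t ∧
      HasDerivWithinAt (fracInt ((1 - β) * (1 - α)) c u) (v' t) (Icc c d) t ∧
      FracIntExists (β * (1 - α)) c v' t ∧
      fracInt (β * (1 - α)) c v' t = D t

/-- Membership in the weighted space `C_{1-γ}([c, d], E)`: `u` is continuous on `(c, d]` and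
`(t - c)^(1-γ) u(t)` extends continuously to `[c, d]`; for `γ = 1` this is `u ∈ C([c, d], E)`. -/
def MemWeightedC (γ c d : ℝ) (u : ℝ → E) : Prop :=
  ContinuousOn u (Ioc c d) ∧
  ∃ l : E, Tendsto (fun t => (t - c) ^ (1 - γ) • u t) (𝓝[>] c) (𝓝 l) ∧ (γ = 1 → l = u c)

end Calculus

/-- The Wright (Mainardi) function
`M_α(θ) = ∑_{n ≥ 0} (-θ)^n / (n! Γ(1 - α (n + 1)))`, `0 < α < 1`, where `1 / Γ` vanishes at the
poles of `Γ`. -/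
def wrightM (α θ : ℝ) : ℝ :=
  ∑' n : ℕ, (-θ) ^ n / ((n.factorial : ℝ) * Real.Gamma (1 - α * ((n : ℝ) + 1)))

section Operators

variable {𝕜 : Type*} [RCLike 𝕜] {E : Type*} [NormedAddCommGroup E] [NormedSpace ℝ E]
  [NormedSpace 𝕜 E]

/-- The class `G(M, ω)`: `A` is closed and densely defined, `(ω, ∞)` lies in the resolvent set of
`-A`, and `‖(A + ξ)⁻ᵏ‖ ≤ M (ξ - ω)⁻ᵏ` for all `ξ > ω` and `k = 1, 2, …`. -/
structure IsClassG (A : E →ₗ.[𝕜] E) (M ω : ℝ) : Prop where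
  pos : 0 < M
  closed : A.IsClosed
  dense : Dense (A.domain : Set E)
  resolvent : ∀ ξ : ℝ, ω < ξ → ∃ R : E →L[𝕜] E,
    (∀ x : E, ∃ h : R x ∈ A.domain, A ⟨R x, h⟩ + ξ • R x = x) ∧
    (∀ x : A.domain, R (A x + ξ • (x : E)) = x) ∧
    ∀ k : ℕ, 1 ≤ k → ‖R ^ k‖ ≤ M / (ξ - ω) ^ k

/-- `T` is a strongly continuous semigroup on `[0, ∞)` with infinitesimal generator `-A`:
`x ∈ D(A)` and `A x = y` if and only if `(x - T(h) x) / h → y` as `h → 0+`. -/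
structure IsSemigroupGeneratedByNeg (A : E →ₗ.[𝕜] E) (T : ℝ → E →L[𝕜] E) : Prop where
  zero : T 0 = 1
  add : ∀ s t : ℝ, 0 ≤ s → 0 ≤ t → T (s + t) = T s * T t
  cont : ∀ x : E, ContinuousOn (fun t => T t x) (Ici 0)
  generator : ∀ x y : E,
    (x, y) ∈ A.graph ↔ Tendsto (fun h : ℝ => h⁻¹ • (x - T h x)) (𝓝[>] 0) (𝓝 y)

open Classical in
/-- The strongly continuous semigroup generated by `-A` (it is unique on `[0, ∞)`). -/
def semigroup (A : E →ₗ.[𝕜] E) : ℝ → E →L[𝕜] E :=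
  if h : ∃ T : ℝ → E →L[𝕜] E, IsSemigroupGeneratedByNeg A T then h.choose else 0

/-- `G_α(t) x = ∫_0^∞ α θ M_α(θ) T(t^α θ) x dθ`, `T` the semigroup generated by `-A`. For `α = 1`
the measure `M_α(θ) dθ` is the unit mass at `θ = 1`, so that `G_1(t) = T(t)`. -/
def opG (A : E →ₗ.[𝕜] E) (α t : ℝ) (x : E) : E :=
  if α = 1 then semigroup A t x
  else ∫ θ in Ioi (0 : ℝ), (α * θ * wrightM α θ) • semigroup A (t ^ α * θ) x

/-- `K_α(t) x = t^(α-1) G_α(t) x`. -/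
def opK (A : E →ₗ.[𝕜] E) (α t : ℝ) (x : E) : E := t ^ (α - 1) • opG A α t x

/-- `S_{α,β}(t) x = I_{0+}^{β(1-α)} K_α(t) x`, `t > 0`. -/
def opS (A : E →ₗ.[𝕜] E) (α β t : ℝ) (x : E) : E :=
  fracInt (β * (1 - α)) 0 (fun s => opK A α s x) t

/-- The operator `I + ∑ₖ Cₖ I_{0+}^{1-γ} S_{α,β}(tₖ - t₀)`. -/
def opQ (A : E →ₗ.[𝕜] E) (α β t₀ : ℝ) {p : ℕ} (τ : Fin p → ℝ) (C : Fin p → 𝕜) (x : E) : E :=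
  x + ∑ k, C k • fracInt (1 - gam α β) 0 (fun s => opS A α β s x) (τ k - t₀)

/-- `B` is the everywhere defined inverse of `I + ∑ₖ Cₖ I_{0+}^{1-γ} S_{α,β}(tₖ - t₀)`. -/
def IsOpB (A : E →ₗ.[𝕜] E) (α β t₀ : ℝ) {p : ℕ} (τ : Fin p → ℝ) (C : Fin p → 𝕜)
    (B : E →ₗ[𝕜] E) : Prop :=
  (∀ x, B (opQ A α β t₀ τ C x) = x) ∧ ∀ x, opQ A α β t₀ τ C (B x) = x

/-- The right-hand side `s ↦ f(s, u(s), u(b₁(s)), …, u(b_r(s)))` along `u`. -/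
def rhs {E : Type*} {r : ℕ} (f : ℝ → (Fin (r + 1) → E) → E) (b : Fin r → ℝ → ℝ) (u : ℝ → E)
    (s : ℝ) : E :=
  f s (Fin.cons (u s) fun i => u (b i s))

/-- `u` is a classical solution on `J = [t₀, t₀ + a]` of the nonlocal problem
`D^{α,β} u + A u = f(t, u(t), u(b₁(t)), …, u(b_r(t)))` on `J ∖ {t₀}`,
`I^{1-γ} u(t₀+) + ∑ₖ Cₖ I^{1-γ} u(tₖ) = u₀`. -/
structure IsClassicalSolution (A : E →ₗ.[𝕜] E) (α β t₀ a : ℝ) {r p : ℕ}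
    (f : ℝ → (Fin (r + 1) → E) → E) (b : Fin r → ℝ → ℝ) (τ : Fin p → ℝ) (C : Fin p → 𝕜)
    (u₀ : E) (u : ℝ → E) : Prop where
  continuousOn : ContinuousOn u (Icc t₀ (t₀ + a))
  contDiffOn : ContDiffOn ℝ 1 u (Ioc t₀ (t₀ + a))
  equation : ∃ D : ℝ → E, HasHilferDerivOn α β t₀ (t₀ + a) u D ∧
    ∀ t ∈ Ioc t₀ (t₀ + a), ∃ h : u t ∈ A.domain, D t + A ⟨u t, h⟩ = rhs f b u t
  nonlocal_condition : ∃ x : E,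
    Tendsto (fracInt (1 - gam α β) t₀ u) (𝓝[>] t₀) (𝓝 x) ∧
    x + ∑ k, C k • fracInt (1 - gam α β) t₀ u (τ k) = u₀

/-- The convolution `t ↦ ∫_{t₀}^t K_α(t - s) f(s, u(s), u(b₁(s)), …, u(b_r(s))) ds`. -/
def conv (A : E →ₗ.[𝕜] E) (α t₀ : ℝ) {r : ℕ}
    (f : ℝ → (Fin (r + 1) → E) → E) (b : Fin r → ℝ → ℝ) (u : ℝ → E) (t : ℝ) : E :=
  ∫ s in t₀..t, opK A α (t - s) (rhs f b u s)

/-- `u` is a mild solution on `J = [t₀, t₀ + a]` of the nonlocal problem: `u ∈ C_{1-γ}(J, E)`, the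
integrals below converge, and `u` satisfies the integral equation. The equation is imposed for
`t > t₀`, since `S_{α,β}` is singular at `0` if `γ < 1`; if `γ = 1`, its limit at `t₀` fixes `u(t₀)`
by continuity. -/
structure IsMildSolution (A : E →ₗ.[𝕜] E) (α β t₀ a : ℝ) {r p : ℕ}
    (f : ℝ → (Fin (r + 1) → E) → E) (b : Fin r → ℝ → ℝ) (τ : Fin p → ℝ) (C : Fin p → 𝕜)
    (B : E →ₗ[𝕜] E) (u₀ : E) (u : ℝ → E) : Prop where
  mem : MemWeightedC (gam α β) t₀ (t₀ + a) u
  integrable : ∀ t ∈ Ioc t₀ (t₀ + a),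
    IntervalIntegrable (fun s => opK A α (t - s) (rhs f b u s)) volume t₀ t
  integrable_nonlocal : ∀ k, FracIntExists (1 - gam α β) t₀ (conv A α t₀ f b u) (τ k)
  equation : ∀ t ∈ Ioc t₀ (t₀ + a),
    u t = opS A α β (t - t₀) (B u₀) + conv A α t₀ f b u t
      - opS A α β (t - t₀)
          (B (∑ k, C k • fracInt (1 - gam α β) t₀ (conv A α t₀ f b u) (τ k)))

end Operators

end HilferEvolution

end

/-! A classical solution is continuous up to t₀, and this decides the role of the initial datum x =
I^{1-γ}u(t₀+). If γ < 1, a fractional integral of positive order of a continuous function tends to 0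
at t₀ (`tendsto_fracInt_zero`), so x = 0. If γ = 1, then I^{1-γ} is the identity and S_{α,β} = E_α,
where E_α = I^{1-α}K_α is the operator `opE`. In both cases everything follows from the variation of
constants formula u(t) = E_α(t - t₀)x + (K_α * g)(t), with g the right-hand side along u. For γ < 1
the nonlocal condition then says that u₀ equals the sum over k, and the two terms with B cancel; for
γ = 1 it says that u₀ is the invertible operator applied to x plus that sum, and B solves for x.

For the formula, the unbounded A is tamed by a resolvent R = (A + ξ)⁻¹: the Hilfer derivative D
satisfies RD = Rg - (u - ξRu), which is bounded although no bound on D is at hand. Integrating the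
Hilfer derivative gives I^{1-α}(Ru - Rx) = ∫ RD (`HasHilferDerivOn.fracInt_clm_eq`). This is
convolved with K_α. By K_α * I^{1-α}w = E_α * w and ∫_0^t K_α(s)Ay ds = y - E_α(t)y, the terms E_α *
Ru cancel, and what remains says that the primitive of R(u - E_α x - K_α * g) vanishes.
Differentiation and injectivity of R finish (`eq_opE_add_integral_opK`).

The two kernel identities (`fracInt_opK`, `integral_opK_graph`) are statements about the Wright
function M_α. The first reduces to the scalar identity `integral_wright_average`, proved by
comparing Mellin transforms; the second uses ∫ M_α = 1. The Mellin transform Γ(z)/Γ(1 - α + αz) of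
M_α comes from a Hankel type contour integral, which also yields decay faster than every
exponential, so that subordination integrals converge for an exponentially growing semigroup. Since
`semigroup A` is obtained by choice, the Hille-Yosida-Phillips theorem is needed to know that it is
a semigroup at all. -/

noncomputable section

namespace HilferEvolution

set_option linter.unusedSectionVars false

/-! ### Growth of exponentials in a Banach algebra. -/

section BanachAlgebra

variable {𝔸 : Type*} [NormedRing 𝔸] [NormedAlgebra ℝ 𝔸] [CompleteSpace 𝔸]

/-- Termwise comparison of power series. Bounding all powers with one constant `M` keeps `M` outside
the exponential; submultiplicativity alone would put it into the growth rate. -/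
theorem norm_exp_smul_le {R : 𝔸} {M ρ s : ℝ} (hs : 0 ≤ s) (h : ∀ k : ℕ, ‖R ^ k‖ ≤ M * ρ ^ k) :
    ‖NormedSpace.exp (s • R)‖ ≤ M * Real.exp (s * ρ) := by
  have h1 := NormedSpace.exp_series_hasSum_exp' (𝕂 := ℝ) (s • R)
  have h2 : HasSum (fun k : ℕ => M * ((s * ρ) ^ k / (k.factorial : ℝ)))
      (M * Real.exp (s * ρ)) := by
    have := NormedSpace.expSeries_div_hasSum_exp (s * ρ)
    rw [← Real.exp_eq_exp_ℝ] at this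
    exact this.mul_left M
  refine h1.norm_le_of_bounded h2 fun k => ?_
  rw [smul_pow, norm_smul, norm_smul, Real.norm_of_nonneg (by positivity),
    Real.norm_of_nonneg (by positivity)]
  calc (k.factorial : ℝ)⁻¹ * (s ^ k * ‖R ^ k‖) ≤ (k.factorial : ℝ)⁻¹ * (s ^ k * (M * ρ ^ k)) := by
        gcongr; exact h k
    _ = M * ((s * ρ) ^ k / (k.factorial : ℝ)) := by rw [mul_pow]; ring

/-- The scalar part commutes and factors out as exp(-tn). It compensates the growth exp(tn²/(n - ω))
of the other factor up to -n + n²/(n - ω) = nω/(n - ω), which stays bounded as n grows. -/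
theorem norm_exp_yosida_le {R : 𝔸} {M ω n t : ℝ} (ht : 0 ≤ t) (hn : ω < n)
    (h : ∀ k : ℕ, ‖R ^ k‖ ≤ M * ((n - ω)⁻¹) ^ k) :
    ‖NormedSpace.exp (t • (n ^ 2 • R - n • (1 : 𝔸)))‖ ≤ M * Real.exp (t * (n * ω / (n - ω))) := by
  let _ : NormedAlgebra ℚ 𝔸 := NormedAlgebra.restrictScalars ℚ ℝ 𝔸
  have e : t • (n ^ 2 • R - n • (1 : 𝔸)) = algebraMap ℝ 𝔸 (-(t * n)) + (t * n ^ 2) • R := by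
    rw [Algebra.algebraMap_eq_smul_one]
    module
  rw [e, NormedSpace.exp_add_of_commute (Algebra.commutes _ _), ← NormedSpace.algebraMap_exp_comm,
    ← Real.exp_eq_exp_ℝ, ← Algebra.smul_def, norm_smul, Real.norm_of_nonneg (Real.exp_pos _).le]
  have h0 : n - ω ≠ 0 := by linarith
  calc Real.exp (-(t * n)) * ‖NormedSpace.exp ((t * n ^ 2) • R)‖
      ≤ Real.exp (-(t * n)) * (M * Real.exp ((t * n ^ 2) * (n - ω)⁻¹)) := by
        gcongr; exact norm_exp_smul_le (by positivity) h
    _ = M * Real.exp (t * (n * ω / (n - ω))) := by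
        rw [mul_left_comm, ← Real.exp_add]; congr 2; field_simp; ring

theorem exp_commute_apply {a b : 𝔸} (h : Commute a b) (s : ℝ) :
    Commute (NormedSpace.exp (s • a)) b :=
  (Commute.smul_left h s).exp_left

end BanachAlgebra

/-! ### Resolvents expressed through the graph of `A`. -/

section Resolvent

variable {𝕜 : Type*} [RCLike 𝕜] {E : Type*} [NormedAddCommGroup E] [NormedSpace ℝ E]
  [NormedSpace 𝕜 E] [IsScalarTower ℝ 𝕜 E]

/-- `R = (A + ξ)⁻¹`, expressed through the graph of `A`. -/
structure IsResolventAt (A : E →ₗ.[𝕜] E) (ξ : ℝ) (R : E →L[𝕜] E) : Prop where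
  mem_graph : ∀ x : E, (R x, x - ξ • R x) ∈ A.graph
  apply_graph : ∀ x y : E, (x, y) ∈ A.graph → R (y + ξ • x) = x

variable {A : E →ₗ.[𝕜] E}

/-- The constant is enlarged to `max M 1` so that the bound also covers k = 0, which the exponential
series needs. -/
theorem IsClassG.exists_resolvent {M ω : ℝ} (hA : IsClassG A M ω) {ξ : ℝ} (h : ω < ξ) :
    ∃ R : E →L[𝕜] E, IsResolventAt A ξ R ∧ ∀ k : ℕ, ‖R ^ k‖ ≤ max M 1 * ((ξ - ω)⁻¹) ^ k := by
  obtain ⟨R, h1, h2, h3⟩ := hA.resolvent ξ h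
  refine ⟨R, ⟨fun x => ?_, fun x y hxy => ?_⟩, fun k => ?_⟩
  · obtain ⟨hx, e⟩ := h1 x
    rw [LinearPMap.mem_graph_iff]
    exact ⟨⟨R x, hx⟩, rfl, by rw [eq_sub_iff_add_eq]; exact e⟩
  · rw [LinearPMap.mem_graph_iff] at hxy
    obtain ⟨z, hz, e⟩ := hxy
    simp only at hz e
    rw [← e, ← hz]; exact h2 z
  · rcases Nat.eq_zero_or_pos k with rfl | hk
    · simp only [pow_zero, mul_one]
      exact le_trans ContinuousLinearMap.norm_id_le (le_max_right _ _)
    · refine (h3 k hk).trans ?_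
      rw [div_eq_mul_inv, inv_pow]
      have : 0 < ξ - ω := by linarith
      gcongr
      exact le_max_left _ _

namespace IsResolventAt

variable {ξ η : ℝ} {R S : E →L[𝕜] E}

/-- This is what allows the regularising resolvent to be cancelled at the end of the variation of
constants argument. -/
theorem injective (hR : IsResolventAt A ξ R) {x : E} (h : R x = 0) : x = 0 := by
  have := hR.mem_graph x
  rw [h, smul_zero, sub_zero, LinearPMap.mem_graph_iff] at this
  obtain ⟨y, hy, e⟩ := this
  simp only at hy e
  rw [← e]
  have : y = 0 := Subtype.ext hy
  rw [this]; exact map_zero A.toFun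

theorem resolvent_identity (hR : IsResolventAt A ξ R) (hS : IsResolventAt A η S) (x : E) :
    R x + (ξ - η) • R (S x) = S x := by
  have := hR.apply_graph _ _ (hS.mem_graph x)
  rw [map_add, map_sub, R.map_smul_of_tower, R.map_smul_of_tower] at this
  refine Eq.trans ?_ this
  module

theorem commute (hR : IsResolventAt A ξ R) (hS : IsResolventAt A η S) : Commute R S := by
  ext x
  change R (S x) = S (R x)
  have h1 := hR.resolvent_identity hS x
  have h2 := hS.resolvent_identity hR x
  -- For ξ = η the resolvent identity collapses to R = S; otherwise both identities are divided by ξ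
  -- - η.
  by_cases h : ξ = η
  · subst h
    simp only [sub_self, zero_smul, add_zero] at h1
    have h3 := hR.resolvent_identity hS (R x)
    have h4 := hS.resolvent_identity hR (S x)
    simp only [sub_self, zero_smul, add_zero] at h3
    have h5 := hR.resolvent_identity hS (S x)
    simp only [sub_self, zero_smul, add_zero] at h5
    rw [h5, h1]
  · have h0 : ξ - η ≠ 0 := sub_ne_zero.2 h
    have : (ξ - η) • (R (S x) - S (R x)) = 0 := by
      have e1 : (ξ - η) • R (S x) = S x - R x := by rw [eq_sub_iff_add_eq, add_comm, h1]
      have e2 : (η - ξ) • S (R x) = R x - S x := by rw [eq_sub_iff_add_eq, add_comm, h2]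
      have : (ξ - η) • S (R x) = S x - R x := by
        rw [← neg_sub η ξ, neg_smul, e2, neg_sub]
      rw [smul_sub, e1, this, sub_self]
    exact sub_eq_zero.1 ((smul_eq_zero.1 this).resolve_left h0)

end IsResolventAt

end Resolvent

/-! ### Strong limits of exponentials and Yosida approximations. -/

section Generation

variable {𝕜 : Type*} [RCLike 𝕜] {E : Type*} [NormedAddCommGroup E] [NormedSpace ℝ E]
  [NormedSpace 𝕜 E] [IsScalarTower ℝ 𝕜 E]

/-- The bounded operators form a real Banach algebra, for the given real scalar multiplication. -/
abbrev opRealAlgebra : NormedAlgebra ℝ (E →L[𝕜] E) :=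
  { Algebra.ofModule (fun r x y => by ext; simp)
      (fun r x y => by ext; simp) with
    norm_smul_le := fun r x => norm_smul_le r x }

attribute [local instance] opRealAlgebra

variable [CompleteSpace E]

/-- The uniformly continuous group generated by a bounded operator. -/
def expOp (B : E →L[𝕜] E) (t : ℝ) : E →L[𝕜] E := NormedSpace.exp (t • B)

theorem hasDerivAt_expOp (B : E →L[𝕜] E) (t : ℝ) :
    HasDerivAt (expOp B) (expOp B t * B) t := hasDerivAt_exp_smul_const B t

theorem hasDerivAt_expOp_apply (B : E →L[𝕜] E) (x : E) (t : ℝ) :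
    HasDerivAt (fun s => expOp B s x) (expOp B t (B x)) t :=
  ((ContinuousLinearMap.apply 𝕜 E x).restrictScalars ℝ).hasFDerivAt.comp_hasDerivAt t
    (hasDerivAt_expOp B t)

theorem expOp_add (B : E →L[𝕜] E) (s t : ℝ) : expOp B (s + t) = expOp B s * expOp B t := by
  let _ : NormedAlgebra ℚ (E →L[𝕜] E) := NormedAlgebra.restrictScalars ℚ ℝ _
  rw [expOp, add_smul, NormedSpace.exp_add_of_commute]
  · rfl
  · exact ((Commute.refl B).smul_left s).smul_right t

theorem expOp_zero (B : E →L[𝕜] E) : expOp B 0 = 1 := by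
  rw [expOp, zero_smul, NormedSpace.exp_zero]

theorem commute_expOp {B S : E →L[𝕜] E} (h : Commute B S) (t : ℝ) : Commute (expOp B t) S :=
  exp_commute_apply h t

/-- Interpolate by s ↦ exp((t - s)S) exp(sB)x. Because B and S commute, its derivative is exp((t -
s)S) exp(sB)(Bx - Sx), and the mean value inequality applies. -/
theorem norm_expOp_sub_le {B S : E →L[𝕜] E} (h : Commute B S) {M w : ℝ} (hM : 0 ≤ M)
    (hB : ∀ t, 0 ≤ t → ‖expOp B t‖ ≤ M * Real.exp (w * t))
    (hS : ∀ t, 0 ≤ t → ‖expOp S t‖ ≤ M * Real.exp (w * t)) {t : ℝ} (ht : 0 ≤ t) (x : E) :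
    ‖expOp B t x - expOp S t x‖ ≤ M ^ 2 * Real.exp (w * t) * ‖B x - S x‖ * t := by
  have hd : ∀ s, HasDerivAt (fun s => (expOp S (t - s) * expOp B s) x)
      ((expOp S (t - s) * expOp B s) (B x - S x)) s := by
    intro s
    have h1 : HasDerivAt (fun s => expOp S (t - s)) (-(expOp S (t - s) * S)) s := by
      have := (hasDerivAt_expOp S (t - s)).scomp s ((hasDerivAt_id s).const_sub t)
      simpa using! this
    have h2 := h1.mul (hasDerivAt_expOp B s)
    have h3 := ((ContinuousLinearMap.apply 𝕜 E x).restrictScalars ℝ).hasFDerivAt.comp_hasDerivAt s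
      h2
    convert! h3 using 1
    have h4 : S * expOp B s = expOp B s * S := (commute_expOp h s).symm
    have : -(expOp S (t - s) * S) * expOp B s + expOp S (t - s) * (expOp B s * B)
        = (expOp S (t - s) * expOp B s) * (B - S) := by
      rw [neg_mul, mul_assoc, h4, mul_sub, mul_assoc, mul_assoc]; abel
    rw [this]; rfl
  have key := norm_image_sub_le_of_norm_deriv_le_segment' (a := 0) (b := t)
    (C := M ^ 2 * Real.exp (w * t) * ‖B x - S x‖)
    (fun s _ => (hd s).hasDerivWithinAt) (fun s hs => ?_) t ⟨ht, le_rfl⟩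
  · simpa [expOp_zero] using key
  · refine (ContinuousLinearMap.le_opNorm _ _).trans ?_
    gcongr
    refine (norm_mul_le _ _).trans ?_
    calc _ ≤ (M * Real.exp (w * (t - s))) * (M * Real.exp (w * s)) :=
          mul_le_mul (hS _ (by linarith [hs.2])) (hB _ hs.1) (norm_nonneg _) (by positivity)
      _ = M ^ 2 * Real.exp (w * t) := by
          have : w * t = w * (t - s) + w * s := by ring
          rw [this, Real.exp_add]; ring

variable {B : ℕ → E →L[𝕜] E} {M w : ℝ} {D : Set E}

/-- On `D` the difference of two exponentials is controlled by the difference of the generators; the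
uniform bound extends the Cauchy property from a dense set to every vector. -/
theorem cauchySeq_expOp (hcomm : ∀ m n, Commute (B m) (B n)) (hM : 0 ≤ M)
    (hB : ∀ n t, 0 ≤ t → ‖expOp (B n) t‖ ≤ M * Real.exp (w * t)) (hD : Dense D)
    (hlim : ∀ x ∈ D, ∃ y, Tendsto (fun n => B n x) atTop (𝓝 y)) {t : ℝ} (ht : 0 ≤ t) (x : E) :
    CauchySeq fun n => expOp (B n) t x := by
  rw [Metric.cauchySeq_iff]
  intro ε hε
  set K := M * Real.exp (w * t) + 1 with hK
  have hK0 : 0 < K := by positivity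
  obtain ⟨y, hy, hxy⟩ := hD.exists_dist_lt x (show 0 < ε / (3 * K) by positivity)
  obtain ⟨z, hz⟩ := hlim y hy
  set L := M ^ 2 * Real.exp (w * t) * t + 1 with hL
  have hL0 : 0 < L := by positivity
  obtain ⟨N, hN⟩ := Metric.cauchySeq_iff.1 hz.cauchySeq (ε / (3 * L)) (by positivity)
  refine ⟨N, fun m hm n hn => ?_⟩
  have h1 := hN m hm n hn
  rw [dist_eq_norm] at h1 hxy ⊢
  have h2 := norm_expOp_sub_le (hcomm m n) hM (hB m) (hB n) ht y
  have h3 : M ^ 2 * Real.exp (w * t) * ‖B m y - B n y‖ * t ≤ ε / 3 := by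
    calc _ = (M ^ 2 * Real.exp (w * t) * t) * ‖B m y - B n y‖ := by ring
      _ ≤ L * (ε / (3 * L)) := mul_le_mul (by linarith) h1.le (norm_nonneg _) hL0.le
      _ = ε / 3 := by field_simp
  have h4 : ∀ k, ‖expOp (B k) t (x - y)‖ < ε / 3 := by
    intro k
    calc _ ≤ ‖expOp (B k) t‖ * ‖x - y‖ := ContinuousLinearMap.le_opNorm _ _
      _ ≤ K * ‖x - y‖ := by gcongr; linarith [hB k t ht]
      _ < K * (ε / (3 * K)) := by gcongr
      _ = ε / 3 := by field_simp
  calc ‖expOp (B m) t x - expOp (B n) t x‖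
      = ‖expOp (B m) t (x - y) + (expOp (B m) t y - expOp (B n) t y)
          - expOp (B n) t (x - y)‖ := by congr 1; simp only [map_sub]; abel
    _ ≤ ‖expOp (B m) t (x - y)‖ + ‖expOp (B m) t y - expOp (B n) t y‖
          + ‖expOp (B n) t (x - y)‖ := by
        refine (norm_sub_le _ _).trans ?_; gcongr; exact norm_add_le _ _
    _ < ε := by linarith [h4 m, h4 n, h2.trans h3]

/-- The limit of the exponentials of commuting, uniformly stable bounded operators which converge
on a dense set. -/
theorem exists_limit_semigroup (hcomm : ∀ m n, Commute (B m) (B n)) (hM : 0 ≤ M) (hw : 0 ≤ w)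
    (hB : ∀ n t, 0 ≤ t → ‖expOp (B n) t‖ ≤ M * Real.exp (w * t)) (hD : Dense D)
    (hlim : ∀ x ∈ D, ∃ y, Tendsto (fun n => B n x) atTop (𝓝 y)) :
    ∃ T : ℝ → E →L[𝕜] E, T 0 = 1 ∧ (∀ s t, 0 ≤ s → 0 ≤ t → T (s + t) = T s * T t) ∧
      (∀ t, 0 ≤ t → ‖T t‖ ≤ M * Real.exp (w * t)) ∧
      (∀ x, ContinuousOn (fun t => T t x) (Ici 0)) ∧
      (∀ x y, Tendsto (fun n => B n x) atTop (𝓝 y) → ∀ t, 0 ≤ t →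
        T t x = x + ∫ s in (0 : ℝ)..t, T s y) := by
  -- Guarding the convergence by `0 ≤ t` lets `T` be chosen on all of ℝ, with the value 0 at
  -- negative times.
  have hex : ∀ t : ℝ, ∃ S : E →L[𝕜] E, 0 ≤ t →
      ∀ x, Tendsto (fun n => expOp (B n) t x) atTop (𝓝 (S x)) := by
    intro t
    by_cases ht : 0 ≤ t
    · choose f hf using fun x =>
        cauchySeq_tendsto_of_complete (cauchySeq_expOp hcomm hM hB hD hlim ht x)
      exact ⟨continuousLinearMapOfTendsto (fun n => expOp (B n) t) (tendsto_pi_nhds.2 hf),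
        fun _ => hf⟩
    · exact ⟨0, fun h => absurd h ht⟩
  choose T hT using hex
  have hbound : ∀ t, 0 ≤ t → ‖T t‖ ≤ M * Real.exp (w * t) := by
    intro t ht
    refine ContinuousLinearMap.opNorm_le_bound _ (by positivity) fun x => ?_
    refine le_of_tendsto (hT t ht x).norm (Eventually.of_forall fun n => ?_)
    exact ((expOp (B n) t).le_opNorm x).trans (by gcongr; exact hB n t ht)
  have hadd : ∀ s t, 0 ≤ s → 0 ≤ t → T (s + t) = T s * T t := by
    intro s t hs ht
    ext x
    have h1 := hT (s + t) (by positivity) x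
    have h2 : Tendsto (fun n => expOp (B n) (s + t) x) atTop (𝓝 (T s (T t x))) := by
      have h3 := hT s hs (T t x)
      -- The uniform bound permits replacing the inner vector by its limit, so strong limits can be
      -- multiplied.
      have h4 : Tendsto (fun n => expOp (B n) s (expOp (B n) t x - T t x)) atTop (𝓝 0) := by
        refine squeeze_zero_norm (a := fun n => M * Real.exp (w * s) * ‖expOp (B n) t x - T t x‖)
          (fun n => ?_) ?_
        · exact ((expOp (B n) s).le_opNorm _).trans (by gcongr; exact hB n s hs)
        · have := (tendsto_iff_norm_sub_tendsto_zero.1 (hT t ht x)).const_mul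
            (M * Real.exp (w * s))
          simpa using this
      have h5 := h3.add h4
      simp only [map_sub, add_zero] at h5
      refine h5.congr fun n => ?_
      rw [expOp_add]; simp
    exact tendsto_nhds_unique h1 h2
  -- Lipschitz continuity on vectors for which `B n x` converges
  have hlip : ∀ x y, Tendsto (fun n => B n x) atTop (𝓝 y) → ∀ a s t, 0 ≤ s → s ≤ t → t ≤ a →
      ‖T t x - T s x‖ ≤ M * Real.exp (w * a) * ‖y‖ * (t - s) := by
    intro x y hxy a s t hs hst hta
    have h1 : Tendsto (fun n => ‖expOp (B n) t x - expOp (B n) s x‖) atTop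
        (𝓝 ‖T t x - T s x‖) := ((hT t (hs.trans hst) x).sub (hT s hs x)).norm
    have h2 : Tendsto (fun n => M * Real.exp (w * a) * ‖B n x‖ * (t - s)) atTop
        (𝓝 (M * Real.exp (w * a) * ‖y‖ * (t - s))) := (hxy.norm.const_mul _).mul_const _
    refine le_of_tendsto_of_tendsto' h1 h2 fun n => ?_
    refine norm_image_sub_le_of_norm_deriv_le_segment' (a := s) (b := t)
      (f := fun r => expOp (B n) r x)
      (fun r _ => (hasDerivAt_expOp_apply (B n) x r).hasDerivWithinAt) (fun r hr => ?_) t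
      ⟨hst, le_rfl⟩
    refine ((expOp (B n) r).le_opNorm _).trans ?_
    gcongr
    refine (hB n r (hs.trans hr.1)).trans ?_
    gcongr
    exact hr.2.le.trans hta
  have hcont : ∀ x, ContinuousOn (fun t => T t x) (Ici 0) := by
    intro x t ht
    rw [mem_Ici] at ht
    set a := t + 1 with ha
    set K := M * Real.exp (w * a) + 1 with hK
    have hK0 : 0 < K := by positivity
    have hTK : ∀ s, 0 ≤ s → s ≤ a → ‖T s‖ ≤ K := by
      intro s hs hsa
      refine (hbound s hs).trans ?_
      have : M * Real.exp (w * s) ≤ M * Real.exp (w * a) := by gcongr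
      linarith
    rw [Metric.continuousWithinAt_iff]
    intro ε hε
    obtain ⟨x', hx', hxx'⟩ := hD.exists_dist_lt x (show 0 < ε / (3 * K) by positivity)
    rw [dist_eq_norm] at hxx'
    obtain ⟨y, hy⟩ := hlim x' hx'
    set L := M * Real.exp (w * a) * ‖y‖ + 1 with hL
    have hL0 : 0 < L := by positivity
    refine ⟨min 1 (ε / (3 * L)), by positivity, fun s hs hst => ?_⟩
    rw [mem_Ici] at hs
    rw [Real.dist_eq, lt_min_iff] at hst
    have hsa : s ≤ a := by linarith [(abs_lt.1 hst.1).2]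
    have h1 : ‖T s x' - T t x'‖ ≤ L * |s - t| := by
      rcases le_total s t with h | h
      · rw [← norm_neg, neg_sub, abs_of_nonpos (by linarith), neg_sub]
        refine (hlip x' y hy a s t hs h (by linarith)).trans ?_
        have : 0 ≤ t - s := by linarith
        gcongr; linarith
      · rw [abs_of_nonneg (by linarith)]
        refine (hlip x' y hy a t s ht h hsa).trans ?_
        have : 0 ≤ s - t := by linarith
        gcongr; linarith
    have h2 : L * |s - t| < ε / 3 := by
      calc _ < L * (ε / (3 * L)) := by gcongr; exact hst.2
        _ = ε / 3 := by field_simp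
    have h3 : ∀ r, 0 ≤ r → r ≤ a → ‖T r (x - x')‖ < ε / 3 := by
      intro r hr hra
      calc _ ≤ ‖T r‖ * ‖x - x'‖ := ContinuousLinearMap.le_opNorm _ _
        _ ≤ K * ‖x - x'‖ := by gcongr; exact hTK r hr hra
        _ < K * (ε / (3 * K)) := by gcongr
        _ = ε / 3 := by field_simp
    rw [dist_eq_norm]
    calc ‖T s x - T t x‖ = ‖T s (x - x') + (T s x' - T t x') - T t (x - x')‖ := by
          congr 1; simp only [map_sub]; abel
      _ ≤ ‖T s (x - x')‖ + ‖T s x' - T t x'‖ + ‖T t (x - x')‖ := by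
          refine (norm_sub_le _ _).trans ?_; gcongr; exact norm_add_le _ _
      _ < ε := by linarith [h3 s hs hsa, h3 t ht (by linarith)]
  refine ⟨T, ?_, hadd, hbound, hcont, ?_⟩
  · ext x
    refine tendsto_nhds_unique (hT 0 le_rfl x) ?_
    simp [expOp_zero]
  · intro x y hxy t ht
    obtain ⟨K, hK⟩ : ∃ K, ∀ n, ‖B n x‖ ≤ K := by
      obtain ⟨K, hK⟩ := (Metric.isBounded_range_of_tendsto _ hxy).exists_norm_le
      exact ⟨K, fun n => hK _ (mem_range_self n)⟩
    have hK0 : 0 ≤ K := (norm_nonneg _).trans (hK 0)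
    have hcts : ∀ n z, Continuous fun s => expOp (B n) s z := fun n z =>
      continuous_iff_continuousAt.2 fun s => (hasDerivAt_expOp_apply (B n) z s).continuousAt
    have h1 : Tendsto (fun n => ∫ s in (0 : ℝ)..t, expOp (B n) s (B n x)) atTop
        (𝓝 (∫ s in (0 : ℝ)..t, T s y)) := by
      refine intervalIntegral.tendsto_integral_filter_of_dominated_convergence
        (fun _ => M * Real.exp (w * t) * K) ?_ ?_ (by simp) ?_
      · exact Eventually.of_forall fun n => (hcts n _).aestronglyMeasurable
      · refine Eventually.of_forall fun n => Eventually.of_forall fun s hs => ?_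
        rw [uIoc_of_le ht] at hs
        refine ((expOp (B n) s).le_opNorm _).trans ?_
        have h2 := (hB n s hs.1.le).trans
          (show M * Real.exp (w * s) ≤ M * Real.exp (w * t) by gcongr; exact hs.2)
        exact mul_le_mul h2 (hK n) (norm_nonneg _) (by positivity)
      · refine Eventually.of_forall fun s hs => ?_
        rw [uIoc_of_le ht] at hs
        have h3 : Tendsto (fun n => expOp (B n) s (B n x - y)) atTop (𝓝 0) := by
          refine squeeze_zero_norm (a := fun n => M * Real.exp (w * s) * ‖B n x - y‖)
            (fun n => ?_) ?_
          · exact ((expOp (B n) s).le_opNorm _).trans (by gcongr; exact hB n s hs.1.le)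
          · have := (tendsto_iff_norm_sub_tendsto_zero.1 hxy).const_mul (M * Real.exp (w * s))
            simpa using this
        have h4 := (hT s hs.1.le y).add h3
        simp only [map_sub, add_zero] at h4
        exact h4.congr fun n => by abel
    have h2 : ∀ n, expOp (B n) t x = x + ∫ s in (0 : ℝ)..t, expOp (B n) s (B n x) := by
      intro n
      rw [intervalIntegral.integral_eq_sub_of_hasDerivAt
        (fun s _ => hasDerivAt_expOp_apply (B n) x s) ((hcts n _).intervalIntegrable _ _),
        expOp_zero]
      simp
    exact tendsto_nhds_unique (hT t ht x) ((h1.const_add x).congr fun n => (h2 n).symm)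

end Generation

section Generation

variable {𝕜 : Type*} [RCLike 𝕜] {E : Type*} [NormedAddCommGroup E] [NormedSpace ℝ E]
  [NormedSpace 𝕜 E] [IsScalarTower ℝ 𝕜 E]

/-- On the domain ξRz = z - RAz and ‖R‖ tends to 0. The condition ξ ≥ 2|ω| + 1 gives ξ - ω ≥ ξ/2,
hence ‖ξR‖ ≤ 2M, and density does the rest. -/
theorem tendsto_smul_resolvent {A : E →ₗ.[𝕜] E} (hA : Dense (A.domain : Set E)) {M ω : ℝ}
    (hM : 0 ≤ M) {ξ : ℕ → ℝ}
    (hξ : Tendsto ξ atTop atTop) (hξω : ∀ n, 2 * |ω| + 1 ≤ ξ n) {R : ℕ → E →L[𝕜] E}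
    (hR : ∀ n, IsResolventAt A (ξ n) (R n)) (hn : ∀ n, ‖R n‖ ≤ M * (ξ n - ω)⁻¹) (x : E) :
    Tendsto (fun n => ξ n • R n x) atTop (𝓝 x) := by
  have hpos : ∀ n, 0 < ξ n ∧ ξ n / 2 ≤ ξ n - ω := fun n => by
    have := hξω n; have := le_abs_self ω; have := abs_nonneg ω
    constructor <;> linarith
  have hn' : ∀ n, ‖R n‖ ≤ 2 * M * (ξ n)⁻¹ := fun n => by
    refine (hn n).trans ?_
    have := inv_anti₀ (by linarith [(hpos n).1]) (hpos n).2
    calc M * (ξ n - ω)⁻¹ ≤ M * (ξ n / 2)⁻¹ := by gcongr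
      _ = 2 * M * (ξ n)⁻¹ := by rw [inv_div]; ring
  have h0 : Tendsto (fun n => (ξ n)⁻¹) atTop (𝓝 0) := tendsto_inv_atTop_zero.comp hξ
  have hdom : ∀ z y, (z, y) ∈ A.graph → Tendsto (fun n => ξ n • R n z) atTop (𝓝 z) := by
    intro z y hzy
    have e : ∀ n, ξ n • R n z = z - R n y := fun n => by
      rw [eq_sub_iff_add_eq, add_comm, ← (R n).map_smul_of_tower, ← map_add,
        (hR n).apply_graph z y hzy]
    simp only [e]
    have : Tendsto (fun n => R n y) atTop (𝓝 0) := by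
      refine squeeze_zero_norm (a := fun n => 2 * M * (ξ n)⁻¹ * ‖y‖) (fun n => ?_) ?_
      · exact ((R n).le_opNorm y).trans (by gcongr; exact hn' n)
      · simpa using (h0.const_mul (2 * M)).mul_const ‖y‖
    simpa using this.const_sub z
  rw [Metric.tendsto_atTop]
  intro ε hε
  set K := 2 * M + 1 with hK
  obtain ⟨z, hz, hxz⟩ := hA.exists_dist_lt x (show 0 < ε / (3 * K) by positivity)
  rw [dist_eq_norm] at hxz
  obtain ⟨N, hN⟩ := (Metric.tendsto_atTop.1 (hdom z (A ⟨z, hz⟩) (A.mem_graph ⟨z, hz⟩)))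
    (ε / 3) (by positivity)
  refine ⟨N, fun n hnN => ?_⟩
  have h1 := hN n hnN
  rw [dist_eq_norm] at h1 ⊢
  have h2 : ‖ξ n • R n (x - z)‖ ≤ K * ‖x - z‖ := by
    rw [norm_smul, Real.norm_of_nonneg (hpos n).1.le]
    calc ξ n * ‖R n (x - z)‖ ≤ ξ n * (2 * M * (ξ n)⁻¹ * ‖x - z‖) := by
          have := (hpos n).1
          gcongr
          exact ((R n).le_opNorm _).trans (by gcongr; exact hn' n)
      _ = 2 * M * ‖x - z‖ := by have := (hpos n).1.ne'; field_simp
      _ ≤ K * ‖x - z‖ := by gcongr; linarith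
  have h3 : K * ‖x - z‖ < ε / 3 := by
    calc _ < K * (ε / (3 * K)) := by gcongr
      _ = ε / 3 := by have : K ≠ 0 := by positivity
                      field_simp
  have h4 : ‖x - z‖ ≤ K * ‖x - z‖ := le_mul_of_one_le_left (norm_nonneg _) (by linarith)
  calc ‖ξ n • R n x - x‖ = ‖ξ n • R n (x - z) + (ξ n • R n z - z) - (x - z)‖ := by
        congr 1; simp only [map_sub, smul_sub]; abel
    _ ≤ ‖ξ n • R n (x - z)‖ + ‖ξ n • R n z - z‖ + ‖x - z‖ := by
        refine (norm_sub_le _ _).trans ?_; gcongr; exact norm_add_le _ _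
    _ < ε := by linarith

variable [CompleteSpace E] {A : E →ₗ.[𝕜] E} {M ω : ℝ}

attribute [local instance] opRealAlgebra

/-- The Yosida approximations of `-A`. -/
theorem IsClassG.exists_yosida (hA : IsClassG A M ω) : ∃ B : ℕ → E →L[𝕜] E,
    (∀ m n, Commute (B m) (B n)) ∧
    (∀ n t, 0 ≤ t → ‖expOp (B n) t‖ ≤ max M 1 * Real.exp (2 * |ω| * t)) ∧
    ∀ x y, (x, y) ∈ A.graph → Tendsto (fun n => B n x) atTop (𝓝 (-y)) := by
  -- With this shift ξω/(ξ - ω) ≤ 2|ω|, so all Yosida approximations share one growth rate. On the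
  -- domain they act as x ↦ -ξR(Ax).
  set ξ : ℕ → ℝ := fun n => n + (2 * |ω| + 1) with hξ
  have hξω : ∀ n, 2 * |ω| + 1 ≤ ξ n := fun n => by simp [hξ]
  have hω : ∀ n, ω < ξ n := fun n => by
    have := hξω n; have := le_abs_self ω; have := abs_nonneg ω; linarith
  choose R hR hRn using fun n => hA.exists_resolvent (hω n)
  have hξt : Tendsto ξ atTop atTop := tendsto_atTop_add_const_right _ _ tendsto_natCast_atTop_atTop
  refine ⟨fun n => (ξ n) ^ 2 • R n - ξ n • 1, fun m n => ?_, fun n t ht => ?_, fun x y hxy => ?_⟩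
  · have h := (hR m).commute (hR n)
    have h1 : Commute ((ξ m) ^ 2 • R m - ξ m • (1 : E →L[𝕜] E)) (R n) :=
      (h.smul_left _).sub_left ((Commute.one_left _).smul_left _)
    exact (h1.smul_right _).sub_right ((Commute.one_right _).smul_right _)
  · refine (norm_exp_yosida_le ht (hω n) (hRn n)).trans ?_
    refine mul_le_mul_of_nonneg_left (Real.exp_le_exp.2 ?_) (by positivity)
    rw [mul_comm (2 * |ω|)]
    refine mul_le_mul_of_nonneg_left ?_ ht
    have h1 := hξω n; have h2 := le_abs_self ω; have h3 := abs_nonneg ω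
    rw [div_le_iff₀ (by linarith)]
    nlinarith
  · have := tendsto_smul_resolvent hA.dense (le_trans zero_le_one (le_max_right M 1)) hξt hξω hR
      (fun n => by simpa using hRn n 1) y
    refine this.neg.congr fun n => ?_
    have e := (hR n).apply_graph x y hxy
    rw [map_add, (R n).map_smul_of_tower] at e
    have e2 : R n y = x - ξ n • R n x := by rw [eq_sub_iff_add_eq, e]
    simp only [e2, FunLike.coe_sub, FunLike.coe_smul, Pi.sub_apply, Pi.smul_apply,
      one_apply_eq_self]
    module

end Generation

/-! ### The Hille-Yosida-Phillips theorem and properties of the semigroup. -/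

section Semigroup

variable {𝕜 : Type*} [RCLike 𝕜] {E : Type*} [NormedAddCommGroup E] [NormedSpace ℝ E]
  [NormedSpace 𝕜 E] [IsScalarTower ℝ 𝕜 E]

/-- The generator is a limit from the right, so only right derivatives are available directly; they
suffice for the fundamental theorem and for constancy arguments. -/
theorem hasDerivWithinAt_right_of_semigroup {T : ℝ → E →L[𝕜] E}
    (hadd : ∀ s t : ℝ, 0 ≤ s → 0 ≤ t → T (s + t) = T s * T t) {x y : E}
    (h : Tendsto (fun h : ℝ => h⁻¹ • (x - T h x)) (𝓝[>] 0) (𝓝 y)) {t : ℝ} (ht : 0 ≤ t) :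
    HasDerivWithinAt (fun s => T s x) (-T t y) (Ici t) t := by
  rw [← hasDerivWithinAt_Ioi_iff_Ici, hasDerivWithinAt_iff_tendsto_slope' self_notMem_Ioi]
  have h1 : Tendsto (fun s : ℝ => s - t) (𝓝[>] t) (𝓝[>] 0) := by
    refine tendsto_nhdsWithin_of_tendsto_nhds_of_eventually_within _ ?_ ?_
    · have : Tendsto (fun s : ℝ => s - t) (𝓝 t) (𝓝 (t - t)) := tendsto_id.sub_const t
      rw [sub_self] at this
      exact this.mono_left nhdsWithin_le_nhds
    · filter_upwards [self_mem_nhdsWithin] with s hs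
      exact sub_pos.2 (mem_Ioi.1 hs)
  have h2 := (((T t).continuous.tendsto y).comp (h.comp h1)).neg
  refine h2.congr' ?_
  filter_upwards [self_mem_nhdsWithin] with s hs
  have hs' : 0 ≤ s - t := sub_nonneg.2 (le_of_lt (mem_Ioi.1 hs))
  have e : T s x = T t (T (s - t) x) := by
    conv_lhs => rw [show s = t + (s - t) by ring, hadd _ _ ht hs']
    rfl
  simp only [Function.comp_apply, slope, vsub_eq_sub, e]
  rw [(T t).map_smul_of_tower, map_sub, ← smul_neg, neg_sub]

variable [CompleteSpace E] {A : E →ₗ.[𝕜] E} {M ω : ℝ}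

theorem tendsto_average_of_continuousOn {f : ℝ → E} (hf : ContinuousOn f (Ici 0)) :
    Tendsto (fun h : ℝ => h⁻¹ • ∫ s in (0 : ℝ)..h, f s) (𝓝[>] 0) (𝓝 (f 0)) := by
  have hc : Continuous fun s => f (max s 0) :=
    hf.comp_continuous (by fun_prop) fun s => mem_Ici.2 (le_max_right s 0)
  have h1 := (intervalIntegral.integral_hasDerivAt_right (hc.intervalIntegrable 0 0)
    (hc.stronglyMeasurableAtFilter _ _) hc.continuousAt)
  have h2 := (hasDerivWithinAt_iff_tendsto_slope' self_notMem_Ioi).1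
    (h1.hasDerivWithinAt (s := Ioi 0))
  simp only [max_self] at h2
  refine h2.congr' ?_
  filter_upwards [self_mem_nhdsWithin] with h hh
  simp only [slope, vsub_eq_sub, sub_zero, intervalIntegral.integral_same]
  congr 1
  refine intervalIntegral.integral_congr fun s hs => ?_
  rw [uIcc_of_le (le_of_lt hh)] at hs
  simp only [max_eq_left hs.1]

/-- **Hille-Yosida-Phillips**: an operator of class `G(M, ω)` is, up to sign, the generator of a
strongly continuous semigroup. -/
theorem IsClassG.exists_semigroup (hA : IsClassG A M ω) :
    ∃ T : ℝ → E →L[𝕜] E, IsSemigroupGeneratedByNeg A T := by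
  obtain ⟨B, hcomm, hB, hlim⟩ := hA.exists_yosida
  have hM : 0 ≤ max M 1 := le_trans zero_le_one (le_max_right M 1)
  obtain ⟨T, h0, hadd, hbound, hcont, hint⟩ := exists_limit_semigroup hcomm hM (by positivity) hB
    hA.dense (fun x hx => ⟨_, hlim x (A ⟨x, hx⟩) (A.mem_graph ⟨x, hx⟩)⟩)
  have hgen : ∀ x y, (x, y) ∈ A.graph →
      Tendsto (fun h : ℝ => h⁻¹ • (x - T h x)) (𝓝[>] 0) (𝓝 y) := by
    intro x y hxy
    have h1 := tendsto_average_of_continuousOn (hcont y)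
    rw [h0] at h1
    refine h1.congr' ?_
    filter_upwards [self_mem_nhdsWithin] with h hh
    have := hint x _ (hlim x y hxy) h (le_of_lt hh)
    simp only [map_neg, intervalIntegral.integral_neg] at this
    rw [this]; congr 1; abel
  refine ⟨T, h0, hadd, hcont, fun x y => ⟨hgen x y, fun hxy => ?_⟩⟩
  -- The generator cannot be larger than -A. With z = R(y + ξx) in the domain of A, the vector x - z
  -- satisfies T(t)(x - z) = exp(ξt)(x - z). Since ξ exceeds the growth rate 2|ω| by 1, this forces
  -- x = z.
  have hω : ω < 2 * |ω| + 1 := by have := le_abs_self ω; have := abs_nonneg ω; linarith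
  obtain ⟨R, hR, -⟩ := hA.exists_resolvent hω
  set ξ := 2 * |ω| + 1 with hξ
  have hz := hR.mem_graph (y + ξ • x)
  set z := R (y + ξ • x) with hz'
  have hw : Tendsto (fun h : ℝ => h⁻¹ • ((x - z) - T h (x - z))) (𝓝[>] 0)
      (𝓝 (-(ξ • (x - z)))) := by
    have := hxy.sub (hgen _ _ hz)
    convert! this using 1
    · ext h; rw [← smul_sub, map_sub]; congr 1; abel
    · congr 1; module
  have hconst : ∀ t, 0 ≤ t → Real.exp (-(ξ * t)) • T t (x - z) = x - z := by
    intro t ht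
    have := constant_of_has_deriv_right_zero (a := 0) (b := t)
      (f := fun t => Real.exp (-(ξ * t)) • T t (x - z)) ?_ ?_ t ⟨ht, le_rfl⟩
    · simpa [h0] using this
    · exact ContinuousOn.smul (by fun_prop) ((hcont _).mono Icc_subset_Ici_self)
    · intro s hs
      have h1 := hasDerivWithinAt_right_of_semigroup hadd hw hs.1
      have h2 : HasDerivAt (fun t => Real.exp (-(ξ * t))) (Real.exp (-(ξ * s)) * (-(ξ * 1))) s :=
        (((hasDerivAt_id s).const_mul ξ).neg).exp
      convert! (h2.hasDerivWithinAt (s := Ici s)).smul h1 using 1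
      rw [map_neg, (T s).map_smul_of_tower]
      module
  have hzero : x - z = 0 := by
    rw [← norm_le_zero_iff]
    have h1 : Tendsto (fun t : ℝ => max M 1 * ‖x - z‖ * Real.exp (-t)) atTop
        (𝓝 (max M 1 * ‖x - z‖ * 0)) :=
      (Real.tendsto_exp_atBot.comp tendsto_neg_atTop_atBot).const_mul _
    rw [mul_zero] at h1
    refine ge_of_tendsto h1 ?_
    filter_upwards [eventually_ge_atTop 0] with t ht
    have h2 := hconst t ht
    calc ‖x - z‖ = ‖Real.exp (-(ξ * t)) • T t (x - z)‖ := by rw [h2]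
      _ ≤ Real.exp (-(ξ * t)) * (max M 1 * Real.exp (2 * |ω| * t) * ‖x - z‖) := by
          rw [norm_smul, Real.norm_of_nonneg (Real.exp_pos _).le]
          gcongr
          exact ((T t).le_opNorm _).trans (by gcongr; exact hbound t ht)
      _ = max M 1 * ‖x - z‖ * Real.exp (-t) := by
          have : -t = -(ξ * t) + 2 * |ω| * t := by rw [hξ]; ring
          rw [this, Real.exp_add]; ring
  have hxz : x = z := sub_eq_zero.1 hzero
  rw [← hxz] at hz
  simpa using hz

theorem IsClassG.isSemigroup (hA : IsClassG A M ω) :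
    IsSemigroupGeneratedByNeg A (semigroup A) := by
  rw [semigroup, dif_pos hA.exists_semigroup]
  exact hA.exists_semigroup.choose_spec

namespace IsSemigroupGeneratedByNeg

variable {T : ℝ → E →L[𝕜] E}

/-- The definition of the semigroup contains no bound. Uniform boundedness on [0, 1] and splitting t
into integer and fractional parts recover exponential growth. -/
theorem exists_norm_le (hT : IsSemigroupGeneratedByNeg A T) :
    ∃ K w : ℝ, 0 < K ∧ 0 ≤ w ∧ ∀ t, 0 ≤ t → ‖T t‖ ≤ K * Real.exp (w * t) := by
  obtain ⟨C, hC⟩ : ∃ C, ∀ i : Icc (0 : ℝ) 1, ‖T i‖ ≤ C := by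
    refine banach_steinhaus fun x => ?_
    obtain ⟨C, hC⟩ := isCompact_Icc.exists_bound_of_continuousOn
      ((hT.cont x).mono (fun t (ht : t ∈ Icc (0 : ℝ) 1) => ht.1))
    exact ⟨C, fun i => hC i i.2⟩
  set K := max C 1 with hK
  have hK1 : 1 ≤ K := le_max_right _ _
  have hC' : ∀ t, 0 ≤ t → t ≤ 1 → ‖T t‖ ≤ K := fun t h0 h1 =>
    (hC ⟨t, h0, h1⟩).trans (le_max_left _ _)
  have hn : ∀ n : ℕ, ∀ t : ℝ, 0 ≤ t → t ≤ 1 → ‖T (n + t)‖ ≤ K ^ (n + 1) := by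
    intro n
    induction n with
    | zero => intro t h0 h1; simpa using hC' t h0 h1
    | succ n ih =>
      intro t h0 h1
      have : ((n + 1 : ℕ) : ℝ) + t = 1 + (n + t) := by push_cast; ring
      rw [this, hT.add _ _ zero_le_one (by positivity), pow_succ']
      exact (norm_mul_le _ _).trans (mul_le_mul (hC' 1 zero_le_one le_rfl) (ih t h0 h1)
        (norm_nonneg _) (by linarith))
  refine ⟨K, Real.log K, by linarith, Real.log_nonneg hK1, fun t ht => ?_⟩
  have h1 := hn ⌊t⌋₊ (t - ⌊t⌋₊) (sub_nonneg.2 (Nat.floor_le ht))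
    (by linarith [Nat.lt_floor_add_one t])
  rw [add_sub_cancel] at h1
  refine h1.trans ?_
  rw [pow_succ', ← Real.rpow_def_of_pos (by linarith : 0 < K), ← Real.rpow_natCast]
  gcongr
  exact Nat.floor_le ht

theorem apply_mem_graph (hT : IsSemigroupGeneratedByNeg A T) {x y : E} (h : (x, y) ∈ A.graph)
    {t : ℝ} (ht : 0 ≤ t) : (T t x, T t y) ∈ A.graph := by
  rw [hT.generator] at h ⊢
  refine (((T t).continuous.tendsto y).comp h).congr' ?_
  filter_upwards [self_mem_nhdsWithin] with s hs
  have e : T t (T s x) = T s (T t x) := by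
    have h1 := hT.add t s ht (le_of_lt hs)
    rw [add_comm, hT.add s t (le_of_lt hs) ht] at h1
    exact (congrArg (fun S => S x) h1).symm
  simp only [Function.comp_apply, (T t).map_smul_of_tower, map_sub, e]

theorem integral_graph (hT : IsSemigroupGeneratedByNeg A T) {x y : E} (h : (x, y) ∈ A.graph)
    {t : ℝ} (ht : 0 ≤ t) : ∫ s in (0 : ℝ)..t, T s y = x - T t x := by
  rw [hT.generator] at h
  have h1 := intervalIntegral.integral_eq_sub_of_hasDeriv_right (a := 0) (b := t)
    (f := fun s => -T s x) (f' := fun s => T s y) ?_ ?_ ?_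
  · rw [h1, hT.zero]; simp only [one_apply_eq_self]; abel
  · rw [uIcc_of_le ht]; exact ((hT.cont x).mono Icc_subset_Ici_self).neg
  · intro s hs
    rw [min_eq_left ht] at hs
    have := (hasDerivWithinAt_right_of_semigroup hT.add h hs.1.le).neg
    rw [neg_neg] at this
    exact this.mono Ioi_subset_Ici_self
  · exact ((hT.cont y).mono (by rw [uIcc_of_le ht]; exact Icc_subset_Ici_self)).intervalIntegrable

theorem resolvent_apply (hT : IsSemigroupGeneratedByNeg A T) {ξ : ℝ} {R : E →L[𝕜] E}
    (hR : IsResolventAt A ξ R) {t : ℝ} (ht : 0 ≤ t) (x : E) : R (T t x) = T t (R x) := by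
  have := hR.apply_graph _ _ (hT.apply_mem_graph (hR.mem_graph x) ht)
  rwa [map_sub, (T t).map_smul_of_tower, sub_add_cancel] at this

end IsSemigroupGeneratedByNeg

end Semigroup

/-! ### Contour integrals in logarithmic coordinates and the Gamma function. -/

section ExponentialCoordinates

theorem integrable_exp_smul_comp_exp {F : Type*} [NormedAddCommGroup F] [NormedSpace ℝ F]
    (g : ℝ → F) : Integrable (fun x => Real.exp x • g (Real.exp x)) ↔ IntegrableOn g (Ioi 0) := by
  have h := integrableOn_image_iff_integrableOn_abs_deriv_smul (s := univ) (f := Real.exp)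
    (f' := Real.exp) MeasurableSet.univ (fun x _ => (Real.hasDerivAt_exp x).hasDerivWithinAt)
    Real.exp_injective.injOn g
  simp only [image_univ, Real.range_exp, Real.abs_exp, integrableOn_univ] at h
  exact h.symm

theorem integral_exp_smul_comp_exp {F : Type*} [NormedAddCommGroup F] [NormedSpace ℝ F]
    (g : ℝ → F) : ∫ x, Real.exp x • g (Real.exp x) = ∫ x in Ioi 0, g x := by
  have h := integral_image_eq_integral_abs_deriv_smul (s := univ) (f := Real.exp)
    (f' := Real.exp) MeasurableSet.univ (fun x _ => (Real.hasDerivAt_exp x).hasDerivWithinAt)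
    Real.exp_injective.injOn g
  simp only [image_univ, Real.range_exp, Real.abs_exp, Measure.restrict_univ] at h
  exact h.symm

theorem integrable_exp_mul_sub_exp {p κ : ℝ} (hp : 0 < p) (hκ : 0 < κ) :
    Integrable fun x => Real.exp (p * x - κ * Real.exp x) := by
  have h := (integrable_exp_smul_comp_exp _).2
    (integrableOn_rpow_mul_exp_neg_mul_rpow (p := 1) (s := p - 1) (b := κ) (by linarith)
      one_pos hκ)
  refine h.congr (Eventually.of_forall fun x => ?_)
  simp only [smul_eq_mul, Real.rpow_one]
  rw [← Real.exp_mul, ← Real.exp_add, ← Real.exp_add]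
  congr 1; ring

theorem tendsto_exp_mul_sub_exp_atBot {p κ : ℝ} (hp : 0 < p) (hκ : 0 < κ) :
    Tendsto (fun x => Real.exp (p * x - κ * Real.exp x)) atBot (𝓝 0) := by
  refine squeeze_zero (fun x => (Real.exp_pos _).le) (g := fun x => Real.exp (p * x))
    (fun x => Real.exp_le_exp.2 (by nlinarith [Real.exp_pos x])) ?_
  exact Real.tendsto_exp_atBot.comp (tendsto_id.const_mul_atBot hp)

theorem tendsto_exp_mul_sub_exp_atTop {p κ : ℝ} (hκ : 0 < κ) :
    Tendsto (fun x => Real.exp (p * x - κ * Real.exp x)) atTop (𝓝 0) := by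
  have h := (tendsto_rpow_mul_exp_neg_mul_atTop_nhds_zero p κ hκ).comp Real.tendsto_exp_atTop
  refine h.congr fun x => ?_
  simp only [Function.comp_apply]
  rw [← Real.exp_mul, ← Real.exp_add]
  congr 1; ring

/-- Cauchy's theorem in a horizontal strip. -/
theorem integral_horizontal_eq {f : ℂ → ℂ} (hf : Differentiable ℂ f) {a b : ℝ} (hab : a ≤ b)
    {g : ℝ → ℝ} (hg : Integrable g) (hbot : Tendsto g atBot (𝓝 0)) (htop : Tendsto g atTop (𝓝 0))
    (hfg : ∀ x y : ℝ, y ∈ Icc a b → ‖f (x + y * Complex.I)‖ ≤ g x) :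
    ∫ x : ℝ, f (x + a * Complex.I) = ∫ x : ℝ, f (x + b * Complex.I) := by
  have hfc := hf.continuous
  have hint : ∀ y ∈ Icc a b, Integrable fun x : ℝ => f (x + y * Complex.I) := fun y hy =>
    hg.mono' (by fun_prop : Continuous fun x : ℝ => f (x + y * Complex.I)).aestronglyMeasurable
      (Eventually.of_forall fun x => hfg x y hy)
  have hvert : ∀ x : ℝ, ‖Complex.I • ∫ y in a..b, f (x + y * Complex.I)‖ ≤ g x * |b - a| := by
    intro x
    rw [norm_smul, Complex.norm_I, one_mul]
    refine intervalIntegral.norm_integral_le_of_norm_le_const fun y hy => ?_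
    rw [uIoc_of_le hab] at hy
    exact hfg x y ⟨hy.1.le, hy.2⟩
  have hrect : ∀ N : ℝ, ((∫ x in -N..N, f (x + a * Complex.I))
      - ∫ x in -N..N, f (x + b * Complex.I))
      = (Complex.I • ∫ y in a..b, f ((-N : ℝ) + y * Complex.I))
        - Complex.I • ∫ y in a..b, f ((N : ℝ) + y * Complex.I) := by
    intro N
    have := Complex.integral_boundary_rect_eq_zero_of_differentiableOn f ⟨-N, a⟩ ⟨N, b⟩
      hf.differentiableOn
    simp only at this
    rw [add_sub_assoc, add_eq_zero_iff_eq_neg, neg_sub] at this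
    exact this
  have h1 : Tendsto (fun N : ℝ => (∫ x in -N..N, f (x + a * Complex.I))
      - ∫ x in -N..N, f (x + b * Complex.I)) atTop
      (𝓝 ((∫ x : ℝ, f (x + a * Complex.I)) - ∫ x : ℝ, f (x + b * Complex.I))) :=
    (intervalIntegral_tendsto_integral (hint a ⟨le_rfl, hab⟩) tendsto_neg_atTop_atBot
      tendsto_id).sub
    (intervalIntegral_tendsto_integral (hint b ⟨hab, le_rfl⟩) tendsto_neg_atTop_atBot tendsto_id)
  have h2 : Tendsto (fun N : ℝ => (Complex.I • ∫ y in a..b, f ((-N : ℝ) + y * Complex.I))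
        - Complex.I • ∫ y in a..b, f ((N : ℝ) + y * Complex.I)) atTop (𝓝 (0 - 0)) := by
    refine Tendsto.sub ?_ ?_
    · refine squeeze_zero_norm (fun N => hvert (-N)) ?_
      simpa using (hbot.comp tendsto_neg_atTop_atBot).mul_const |b - a|
    · refine squeeze_zero_norm (fun N => hvert N) ?_
      simpa using htop.mul_const |b - a|
  simp only [hrect] at h1
  have := tendsto_nhds_unique h1 h2
  rw [sub_zero] at this
  exact sub_eq_zero.1 this

/-- In the variable λ = exp x this reads θλ^α ≤ C + κλ. Since α < 1, the fractional power can be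
absorbed into an arbitrarily small part of the exponential decay in λ. -/
theorem exists_mul_rpow_le {α : ℝ} (h0 : 0 < α) (h1 : α < 1) {θ κ : ℝ} (hθ : 0 ≤ θ) (hκ : 0 < κ) :
    ∃ C, ∀ x : ℝ, θ * Real.exp (α * x) ≤ C + κ * Real.exp x := by
  obtain ⟨L, hL⟩ : ∃ L : ℝ, θ ≤ κ * Real.exp ((1 - α) * L) := by
    have : Tendsto (fun L : ℝ => κ * Real.exp ((1 - α) * L)) atTop atTop :=
      (Real.tendsto_exp_atTop.comp (tendsto_id.const_mul_atTop (by linarith))).const_mul_atTop hκ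
    exact (this.eventually_ge_atTop θ).exists
  refine ⟨θ * Real.exp (α * L), fun x => ?_⟩
  rcases le_total x L with h | h
  · have : θ * Real.exp (α * x) ≤ θ * Real.exp (α * L) := by gcongr
    have := mul_pos hκ (Real.exp_pos x)
    linarith
  · have : θ * Real.exp (α * x) ≤ κ * Real.exp x := by
      calc θ * Real.exp (α * x) ≤ κ * Real.exp ((1 - α) * x) * Real.exp (α * x) := by
            gcongr
            refine hL.trans ?_
            have : 0 ≤ 1 - α := by linarith
            gcongr
        _ = κ * Real.exp x := by rw [mul_assoc, ← Real.exp_add]; congr 2; ring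
    have : 0 ≤ θ * Real.exp (α * L) := by positivity
    linarith

/-- `Γ(a) = ∫ exp(a z - exp z) dz` along any horizontal line with `|Im z| < π / 2`. -/
theorem integral_exp_mul_sub_exp {a : ℂ} (ha : 0 < a.re) {ψ : ℝ} (hψ : |ψ| < Real.pi / 2) :
    Integrable (fun x : ℝ => Complex.exp (a * (x + ψ * Complex.I)
      - Complex.exp (x + ψ * Complex.I))) ∧
    ∫ x : ℝ, Complex.exp (a * (x + ψ * Complex.I) - Complex.exp (x + ψ * Complex.I))
      = Complex.Gamma a := by
  have hcos : 0 < Real.cos ψ := Real.cos_pos_of_mem_Ioo (abs_lt.1 hψ)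
  set f : ℂ → ℂ := fun z => Complex.exp (a * z - Complex.exp z) with hf
  have hfd : Differentiable ℂ f := by fun_prop
  set g : ℝ → ℝ := fun x => Real.exp (|a.im| * |ψ|) *
    Real.exp (a.re * x - Real.cos ψ * Real.exp x) with hg
  have hgi : Integrable g := (integrable_exp_mul_sub_exp ha hcos).const_mul _
  have hbot : Tendsto g atBot (𝓝 0) := by
    simpa using (tendsto_exp_mul_sub_exp_atBot ha hcos).const_mul (Real.exp (|a.im| * |ψ|))
  have htop : Tendsto g atTop (𝓝 0) := by
    simpa using (tendsto_exp_mul_sub_exp_atTop (p := a.re) hcos).const_mul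
      (Real.exp (|a.im| * |ψ|))
  -- Between the real axis and Im z = ψ the real part of exp z is at least cos ψ · exp x, so the
  -- single function `g` dominates the integrand on the whole strip.
  have hbound : ∀ x y : ℝ, |y| ≤ |ψ| → ‖f (x + y * Complex.I)‖ ≤ g x := by
    intro x y hy
    rw [hf, hg]
    beta_reduce
    rw [Complex.norm_exp, ← Real.exp_add]
    refine Real.exp_le_exp.2 ?_
    have e1 : (a * (x + y * Complex.I)).re = a.re * x - a.im * y := by simp
    have e2 : (Complex.exp (x + y * Complex.I)).re = Real.exp x * Real.cos y := by
      simp [Complex.exp_re]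
    rw [Complex.sub_re, e1, e2]
    have h1 : Real.cos ψ ≤ Real.cos y := by
      rw [← Real.cos_abs ψ, ← Real.cos_abs y]
      exact Real.cos_le_cos_of_nonneg_of_le_pi (abs_nonneg _) (by linarith [Real.pi_pos]) hy
    have h2 : -(a.im * y) ≤ |a.im| * |ψ| := by
      calc -(a.im * y) ≤ |a.im * y| := neg_le_abs _
        _ = |a.im| * |y| := abs_mul _ _
        _ ≤ _ := by gcongr
    have h3 : Real.cos ψ * Real.exp x ≤ Real.exp x * Real.cos y := by
      rw [mul_comm]; gcongr
    linarith
  -- On the real axis this is Euler's integral under s = exp x; the other lines follow by Cauchy's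
  -- theorem.
  have hzero : ∫ x : ℝ, f (x + (0 : ℝ) * Complex.I) = Complex.Gamma a := by
    rw [Complex.Gamma_eq_integral ha, Complex.GammaIntegral, ← integral_exp_smul_comp_exp]
    congr 1; ext x
    simp only [hf, Complex.ofReal_zero, zero_mul, add_zero, Complex.real_smul]
    rw [Complex.ofReal_exp, Complex.cpow_def_of_ne_zero (Complex.exp_ne_zero _),
      Complex.ofReal_exp, ← Complex.ofReal_exp, ← Complex.ofReal_log (Real.exp_pos x).le,
      Real.log_exp, Complex.ofReal_neg, ← Complex.exp_add, Complex.ofReal_exp, ← Complex.exp_add]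
    congr 1; ring
  refine ⟨hgi.mono' (by fun_prop) (Eventually.of_forall fun x => hbound x ψ le_rfl), ?_⟩
  rw [← hzero]
  rcases le_total 0 ψ with h | h
  · refine (integral_horizontal_eq hfd h hgi hbot htop fun x y hy => hbound x y ?_).symm
    rw [abs_of_nonneg hy.1, abs_of_nonneg h]; exact hy.2
  · refine integral_horizontal_eq hfd h hgi hbot htop fun x y hy => hbound x y ?_
    rw [abs_of_nonpos hy.2, abs_of_nonpos h]; exact neg_le_neg hy.1

end ExponentialCoordinates

/-! ### Contour representation, decay and continuity of the Wright function. -/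

section WrightFunction

/-- The integrand `exp (λ - θ λ ^ α) λ ^ (α - 1) dλ` of the Hankel type representation of the
Wright function, in the logarithmic coordinate `z = log λ`. -/
def wrightKernel (α θ : ℝ) (z : ℂ) : ℂ :=
  Complex.exp (Complex.exp z - θ * Complex.exp (α * z) + α * z)

theorem differentiable_wrightKernel (α θ : ℝ) : Differentiable ℂ (wrightKernel α θ) := by
  unfold wrightKernel; fun_prop

theorem norm_wrightKernel (α θ x y : ℝ) : ‖wrightKernel α θ (x + y * Complex.I)‖ =
    Real.exp (Real.exp x * Real.cos y - θ * (Real.exp (α * x) * Real.cos (α * y)) + α * x) := by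
  rw [wrightKernel, Complex.norm_exp]
  congr 1
  have e : (α : ℂ) * (x + y * Complex.I) = ((α * x : ℝ) : ℂ) + ((α * y : ℝ) : ℂ) * Complex.I := by
    push_cast; ring
  rw [e]
  simp [Complex.exp_re]

theorem wrightKernel_conj (α θ : ℝ) (z : ℂ) :
    wrightKernel α θ (starRingEnd ℂ z) = starRingEnd ℂ (wrightKernel α θ z) := by
  simp only [wrightKernel, ← Complex.exp_conj, map_add, map_sub, map_mul, Complex.conj_ofReal]

/-- The reflection formula. It persists at the poles: there `Real.Gamma` has the value 0, whose
inverse is 0, while the sine vanishes. This matches the convention 1/Γ = 0 in the series. -/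
theorem inv_Gamma_one_sub {s : ℝ} (hs : 0 < s) :
    (Real.Gamma (1 - s))⁻¹ = Real.pi⁻¹ * (Real.sin (Real.pi * s) * Real.Gamma s) := by
  have h := (Real.Gamma_pos_of_pos hs).ne'
  have h2 : Real.Gamma (1 - s) = Real.pi / Real.sin (Real.pi * s) / Real.Gamma s := by
    rw [← Real.Gamma_mul_Gamma_one_sub s, mul_div_cancel_left₀ _ h]
  rw [h2, inv_div, div_div_eq_mul_div]
  ring

/-- On the line Im z = π one has exp z = -exp x, and exp(-θλ^α) is expanded in powers of θ. The n-th
term integrates to exp(iπα(n + 1)) Γ(α(n + 1)) up to the coefficient; its imaginary part contains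
sin(πα(n + 1)), and reflection turns this into 1/Γ(1 - α(n + 1)). -/
theorem hasSum_wrightM {α : ℝ} (h0 : 0 < α) (h1 : α < 1) (θ : ℝ) :
    HasSum (fun n : ℕ => (-θ) ^ n / ((n.factorial : ℝ) * Real.Gamma (1 - α * ((n : ℝ) + 1))))
      (Real.pi⁻¹ * (∫ x : ℝ, wrightKernel α θ (x + Real.pi * Complex.I)).im) := by
  set F : ℕ → ℝ → ℂ := fun n x =>
    (-θ * Complex.exp (α * (x + Real.pi * Complex.I))) ^ n / (n.factorial : ℂ)
      * Complex.exp (α * (x + Real.pi * Complex.I) - Complex.exp x) with hF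
  set bound : ℕ → ℝ → ℝ := fun n x => (|θ| * Real.exp (α * x)) ^ n / (n.factorial : ℝ)
      * Real.exp (α * x - Real.exp x) with hbound
  have hnorm : ∀ x : ℝ, ‖Complex.exp (α * (x + Real.pi * Complex.I))‖ = Real.exp (α * x) := by
    intro x; rw [Complex.norm_exp]; simp
  have hb : ∀ x, HasSum (fun n => bound n x)
      (Real.exp (|θ| * Real.exp (α * x)) * Real.exp (α * x - Real.exp x)) := by
    intro x
    have := NormedSpace.expSeries_div_hasSum_exp (|θ| * Real.exp (α * x))
    rw [← Real.exp_eq_exp_ℝ] at this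
    exact this.mul_right _
  have hsum : HasSum (fun n => ∫ x, F n x)
      (∫ x : ℝ, wrightKernel α θ (x + Real.pi * Complex.I)) := by
    refine hasSum_integral_of_dominated_convergence bound (fun n => ?_) (fun n => ?_) ?_ ?_ ?_
    · exact (by fun_prop : Continuous (F n)).aestronglyMeasurable
    · refine Eventually.of_forall fun x => le_of_eq ?_
      simp only [hF, hbound, norm_mul, norm_div, norm_pow, hnorm, norm_neg, Complex.norm_real,
        Real.norm_eq_abs, Complex.norm_natCast]
      congr 1
      rw [Complex.norm_exp, ← Complex.ofReal_exp, Complex.sub_re, Complex.ofReal_re]; simp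
    · exact Eventually.of_forall fun x => (hb x).summable
    · simp only [fun x => (hb x).tsum_eq]
      obtain ⟨C, hC⟩ := exists_mul_rpow_le h0 h1 (abs_nonneg θ) (show (0 : ℝ) < 1 / 2 by norm_num)
      refine ((integrable_exp_mul_sub_exp h0 (show (0 : ℝ) < 1 / 2 by norm_num)).const_mul
        (Real.exp C)).mono' (by fun_prop) (Eventually.of_forall fun x => ?_)
      rw [Real.norm_of_nonneg (by positivity), ← Real.exp_add, ← Real.exp_add]
      exact Real.exp_le_exp.2 (by linarith [hC x])
    · refine Eventually.of_forall fun x => ?_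
      have := NormedSpace.expSeries_div_hasSum_exp
        (-θ * Complex.exp (α * (x + Real.pi * Complex.I)))
      rw [← Complex.exp_eq_exp_ℂ] at this
      convert! this.mul_right (Complex.exp (α * (x + Real.pi * Complex.I) - Complex.exp x)) using 1
      rw [wrightKernel, ← Complex.exp_add, Complex.exp_add (x : ℂ), Complex.exp_pi_mul_I]
      congr 1; ring
  have hint : ∀ n : ℕ, ∫ x, F n x = (-θ) ^ n / (n.factorial : ℂ) *
      (Complex.exp (((Real.pi * (α * (n + 1)) : ℝ) : ℂ) * Complex.I)
        * (Real.Gamma (α * (n + 1)) : ℝ)) := by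
    intro n
    have ha : 0 < ((α * (n + 1) : ℝ) : ℂ).re := by rw [Complex.ofReal_re]; positivity
    have hG := (integral_exp_mul_sub_exp ha (ψ := 0) (by simp [Real.pi_pos])).2
    rw [Complex.Gamma_ofReal] at hG
    rw [← hG, ← integral_const_mul, ← integral_const_mul]
    congr 1; ext x
    simp only [hF, Complex.ofReal_zero, zero_mul, add_zero]
    rw [mul_pow, ← Complex.exp_nat_mul, mul_div_right_comm, mul_assoc, ← Complex.exp_add,
      ← Complex.exp_add]
    congr 2
    push_cast
    ring
  simp only [hint] at hsum
  have him := (Complex.hasSum_im hsum).mul_left Real.pi⁻¹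
  convert! him using 1
  ext n
  rw [← Complex.ofReal_neg, ← Complex.ofReal_pow, ← Complex.ofReal_natCast n.factorial,
    ← Complex.ofReal_div, Complex.im_ofReal_mul,
    Complex.im_mul_ofReal, Complex.exp_ofReal_mul_I_im, ← div_div, div_eq_mul_inv _ (Real.Gamma _),
    inv_Gamma_one_sub (by positivity)]
  ring

theorem wrightM_eq {α : ℝ} (h0 : 0 < α) (h1 : α < 1) (θ : ℝ) :
    wrightM α θ = Real.pi⁻¹ * (∫ x : ℝ, wrightKernel α θ (x + Real.pi * Complex.I)).im :=
  (hasSum_wrightM h0 h1 θ).tsum_eq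

/-- An angle for which `cos φ < 0 < cos (α φ)`. -/
def wrightAngle (α : ℝ) : ℝ := Real.pi / (1 + α)

section Angle

variable {α : ℝ} (h0 : 0 < α) (h1 : α < 1)
include h0 h1

theorem wrightAngle_pos : 0 < wrightAngle α := by
  have := Real.pi_pos; unfold wrightAngle; positivity

theorem wrightAngle_lt_pi : wrightAngle α < Real.pi := by
  rw [wrightAngle, div_lt_iff₀ (by linarith)]; nlinarith [Real.pi_pos]

theorem pi_div_two_lt_wrightAngle : Real.pi / 2 < wrightAngle α := by
  rw [wrightAngle, div_lt_div_iff₀ (by norm_num) (by linarith)]; nlinarith [Real.pi_pos]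

theorem mul_wrightAngle_lt : α * wrightAngle α < Real.pi / 2 := by
  rw [wrightAngle, ← mul_div_assoc, div_lt_div_iff₀ (by linarith) (by norm_num)]
  nlinarith [Real.pi_pos]

theorem cos_wrightAngle_neg : Real.cos (wrightAngle α) < 0 :=
  Real.cos_neg_of_pi_div_two_lt_of_lt (pi_div_two_lt_wrightAngle h0 h1)
    (by linarith [wrightAngle_lt_pi h0 h1, Real.pi_pos])

theorem cos_mul_wrightAngle_pos : 0 < Real.cos (α * wrightAngle α) := by
  refine Real.cos_pos_of_mem_Ioo ⟨?_, mul_wrightAngle_lt h0 h1⟩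
  have := mul_pos h0 (wrightAngle_pos h0 h1)
  linarith [Real.pi_pos]

/-- In the strip cos y ≤ cos φ < 0. Half of this decay absorbs the term in θ, the other half remains
as an integrable bound uniform in the strip. -/
theorem exists_norm_wrightKernel_le {θ : ℝ} (hθ : 0 ≤ θ) : ∃ C, ∀ x y : ℝ,
    y ∈ Icc (wrightAngle α) Real.pi → ‖wrightKernel α θ (x + y * Complex.I)‖ ≤
      Real.exp C * Real.exp (α * x - (-Real.cos (wrightAngle α) / 2) * Real.exp x) := by
  have hκ := cos_wrightAngle_neg h0 h1
  obtain ⟨C, hC⟩ := exists_mul_rpow_le h0 h1 hθ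
    (show 0 < -Real.cos (wrightAngle α) / 2 by linarith)
  refine ⟨C, fun x y hy => ?_⟩
  rw [norm_wrightKernel, ← Real.exp_add]
  refine Real.exp_le_exp.2 ?_
  have e1 : Real.cos y ≤ Real.cos (wrightAngle α) :=
    Real.cos_le_cos_of_nonneg_of_le_pi (wrightAngle_pos h0 h1).le hy.2 hy.1
  have e2 : Real.exp x * Real.cos y ≤ Real.exp x * Real.cos (wrightAngle α) := by gcongr
  have e3 : -(θ * (Real.exp (α * x) * Real.cos (α * y))) ≤ θ * Real.exp (α * x) := by
    have : 0 ≤ θ * Real.exp (α * x) := by positivity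
    nlinarith [Real.neg_one_le_cos (α * y)]
  have e4 := hC x
  linarith

theorem integrable_wrightKernel_angle {θ : ℝ} (hθ : 0 ≤ θ) :
    Integrable fun x : ℝ => wrightKernel α θ (x + wrightAngle α * Complex.I) := by
  obtain ⟨C, hC⟩ := exists_norm_wrightKernel_le h0 h1 hθ
  have hκ := cos_wrightAngle_neg h0 h1
  have hc := (differentiable_wrightKernel α θ).continuous
  refine ((integrable_exp_mul_sub_exp h0 (show 0 < -Real.cos (wrightAngle α) / 2 by
    linarith)).const_mul (Real.exp C)).mono'
    (by fun_prop : Continuous fun x : ℝ =>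
      wrightKernel α θ (x + wrightAngle α * Complex.I)).aestronglyMeasurable
    (Eventually.of_forall fun x => hC x _ ⟨le_rfl, (wrightAngle_lt_pi h0 h1).le⟩)

/-- Lowering the line from π to φ keeps the decay of exp λ and gains cos(αφ) > 0, so that exp(-θλ^α)
also decays in θ. -/
theorem wrightM_eq_angle {θ : ℝ} (hθ : 0 ≤ θ) : wrightM α θ =
    Real.pi⁻¹ * (∫ x : ℝ, wrightKernel α θ (x + wrightAngle α * Complex.I)).im := by
  obtain ⟨C, hC⟩ := exists_norm_wrightKernel_le h0 h1 hθ
  have hκ : 0 < -Real.cos (wrightAngle α) / 2 := by linarith [cos_wrightAngle_neg h0 h1]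
  rw [wrightM_eq h0 h1, integral_horizontal_eq (differentiable_wrightKernel α θ)
    (wrightAngle_lt_pi h0 h1).le ((integrable_exp_mul_sub_exp h0 hκ).const_mul (Real.exp C))
    (by simpa using (tendsto_exp_mul_sub_exp_atBot h0 hκ).const_mul (Real.exp C))
    (by simpa using (tendsto_exp_mul_sub_exp_atTop (p := α) hκ).const_mul (Real.exp C)) hC]

/-- The kernel is real on the real axis, so Cauchy's theorem on (-∞, l] × [0, φ] trades the left
half-line for a vertical segment as far as imaginary parts go. This removes the region of small |λ|,
where exp(-θλ^α) gives no decay. -/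
theorem im_integral_Iic_wrightKernel {θ : ℝ} (hθ : 0 ≤ θ) (l : ℝ) :
    (∫ x in Iic l, wrightKernel α θ (x + wrightAngle α * Complex.I)).im =
      (Complex.I • ∫ y in (0 : ℝ)..wrightAngle α, wrightKernel α θ (l + y * Complex.I)).im := by
  set φ := wrightAngle α with hφ
  have hφ0 : 0 < φ := wrightAngle_pos h0 h1
  have hreal : ∀ N : ℝ, (∫ x in -N..l, wrightKernel α θ (x + (0 : ℝ) * Complex.I)).im = 0 := by
    intro N
    have : ∀ x : ℝ, wrightKernel α θ (x + (0 : ℝ) * Complex.I) =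
        ((Real.exp (Real.exp x - θ * Real.exp (α * x) + α * x) : ℝ) : ℂ) := by
      intro x; simp only [wrightKernel]; push_cast; simp
    simp only [this]
    rw [intervalIntegral.integral_ofReal, Complex.ofReal_im]
  have hrect : ∀ N : ℝ, (∫ x in -N..l, wrightKernel α θ (x + φ * Complex.I)).im =
      (Complex.I • ∫ y in (0 : ℝ)..φ, wrightKernel α θ (l + y * Complex.I)).im -
      (Complex.I • ∫ y in (0 : ℝ)..φ, wrightKernel α θ ((-N : ℝ) + y * Complex.I)).im := by
    intro N
    have h := Complex.integral_boundary_rect_eq_zero_of_differentiableOn (wrightKernel α θ)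
      ⟨-N, 0⟩ ⟨l, φ⟩ (differentiable_wrightKernel α θ).differentiableOn
    have h' := congrArg Complex.im h
    simp only [Complex.sub_im, Complex.add_im, Complex.zero_im] at h'
    rw [hreal N] at h'
    linarith
  have hv : Tendsto (fun N : ℝ => Complex.I • ∫ y in (0 : ℝ)..φ,
      wrightKernel α θ ((-N : ℝ) + y * Complex.I)) atTop (𝓝 0) := by
    set K := Real.exp (Real.exp l + θ * Real.exp (α * l)) with hK
    refine squeeze_zero_norm' (a := fun N => K * Real.exp (α * -N) * |φ - 0|) ?_ ?_
    · filter_upwards [eventually_ge_atTop (-l)] with N hN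
      rw [norm_smul, Complex.norm_I, one_mul]
      refine intervalIntegral.norm_integral_le_of_norm_le_const fun y _ => ?_
      rw [norm_wrightKernel, hK, ← Real.exp_add]
      refine Real.exp_le_exp.2 ?_
      have hNl : -N ≤ l := by linarith
      have e1 : Real.exp (-N) * Real.cos y ≤ Real.exp l := by
        calc _ ≤ Real.exp (-N) * 1 := by gcongr; exact Real.cos_le_one y
          _ ≤ Real.exp l := by rw [mul_one]; gcongr
      have e2 : -(θ * (Real.exp (α * -N) * Real.cos (α * y))) ≤ θ * Real.exp (α * l) := by
        have e3 : θ * Real.exp (α * -N) ≤ θ * Real.exp (α * l) := by gcongr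
        have : 0 ≤ θ * Real.exp (α * -N) := by positivity
        nlinarith [Real.neg_one_le_cos (α * y)]
      linarith
    · have : Tendsto (fun N : ℝ => Real.exp (α * -N)) atTop (𝓝 0) :=
        Real.tendsto_exp_atBot.comp (tendsto_neg_atTop_atBot.const_mul_atBot h0)
      simpa using (this.const_mul K).mul_const |φ - 0|
  have hlim := (Complex.continuous_im.tendsto _).comp (intervalIntegral_tendsto_integral_Iic l
    (integrable_wrightKernel_angle h0 h1 hθ).integrableOn tendsto_neg_atTop_atBot)
  have hlim2 := ((Complex.continuous_im.tendsto _).comp hv).const_sub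
    (Complex.I • ∫ y in (0 : ℝ)..φ, wrightKernel α θ (l + y * Complex.I)).im
  rw [Complex.zero_im, sub_zero] at hlim2
  refine tendsto_nhds_unique hlim (hlim2.congr fun N => ?_)
  exact (hrect N).symm

/-- The Wright function decays faster than every exponential. -/
theorem exists_abs_wrightM_le {c : ℝ} (hc : 0 < c) :
    ∃ C, 0 < C ∧ ∀ θ, 0 ≤ θ → |wrightM α θ| ≤ C * Real.exp (-(c * θ)) := by
  set φ := wrightAngle α with hφ
  have hφ0 : 0 < φ := wrightAngle_pos h0 h1
  have hcα : 0 < Real.cos (α * φ) := cos_mul_wrightAngle_pos h0 h1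
  have hκ : 0 < -Real.cos φ := by linarith [cos_wrightAngle_neg h0 h1]
  -- On the part of the contour that is kept, |λ| ≥ exp l and the argument is at most φ; this `l`
  -- makes Re λ^α ≥ c there.
  obtain ⟨l, hl⟩ : ∃ l : ℝ, c = Real.exp (α * l) * Real.cos (α * φ) := by
    refine ⟨Real.log (c / Real.cos (α * φ)) / α, ?_⟩
    rw [mul_div_cancel₀ _ h0.ne', Real.exp_log (by positivity), div_mul_cancel₀ _ hcα.ne']
  set I2 := ∫ x in Ioi l, Real.exp (α * x - -Real.cos φ * Real.exp x) with hI2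
  have hI2i := integrable_exp_mul_sub_exp h0 hκ
  have hI20 : 0 ≤ I2 := integral_nonneg fun x => (Real.exp_pos _).le
  refine ⟨Real.pi⁻¹ * (Real.exp (Real.exp l + α * l) * φ + I2) , by positivity, fun θ hθ => ?_⟩
  have hexp : ∀ x y, l ≤ x → y ∈ Icc 0 φ →
      c * θ ≤ θ * (Real.exp (α * x) * Real.cos (α * y)) := by
    intro x y hx hy
    rw [hl, mul_comm θ]
    have : Real.cos (α * φ) ≤ Real.cos (α * y) := by
      refine Real.cos_le_cos_of_nonneg_of_le_pi (mul_nonneg h0.le hy.1) ?_ ?_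
      · linarith [mul_wrightAngle_lt h0 h1, Real.pi_pos]
      · have := hy.2; gcongr
    gcongr
  have hsplit := wrightM_eq_angle h0 h1 hθ
  rw [← hφ, ← integral_add_compl (measurableSet_Iic (a := l))
    (integrable_wrightKernel_angle h0 h1 hθ), compl_Iic, Complex.add_im,
    im_integral_Iic_wrightKernel h0 h1 hθ] at hsplit
  rw [hsplit, abs_mul, abs_of_pos (inv_pos.2 Real.pi_pos), mul_assoc]
  refine mul_le_mul_of_nonneg_left ?_ (inv_pos.2 Real.pi_pos).le
  refine (abs_add_le _ _).trans ?_
  rw [add_mul]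
  refine add_le_add ((Complex.abs_im_le_norm _).trans ?_) ((Complex.abs_im_le_norm _).trans ?_)
  · rw [norm_smul, Complex.norm_I, one_mul]
    refine (intervalIntegral.norm_integral_le_of_norm_le_const (C := Real.exp (Real.exp l + α * l) *
      Real.exp (-(c * θ))) fun y hy => ?_).trans (le_of_eq ?_)
    · rw [uIoc_of_le hφ0.le] at hy
      rw [norm_wrightKernel, ← Real.exp_add]
      refine Real.exp_le_exp.2 ?_
      have e1 : Real.exp l * Real.cos y ≤ Real.exp l :=
        mul_le_of_le_one_right (Real.exp_pos _).le (Real.cos_le_one y)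
      have := hexp l y le_rfl ⟨hy.1.le, hy.2⟩
      linarith
    · rw [sub_zero, abs_of_pos hφ0]; ring
  · rw [hI2, ← integral_mul_const]
    refine norm_integral_le_of_norm_le (hI2i.integrableOn.mul_const _) ?_
    filter_upwards [ae_restrict_mem measurableSet_Ioi] with x hx
    rw [norm_wrightKernel, ← Real.exp_add]
    refine Real.exp_le_exp.2 ?_
    have := hexp x φ (le_of_lt hx) ⟨hφ0.le, le_rfl⟩
    linarith

theorem continuous_wrightM : Continuous (wrightM α) := by
  have : wrightM α = fun θ =>
      Real.pi⁻¹ * (∫ x : ℝ, wrightKernel α θ (x + Real.pi * Complex.I)).im := by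
    ext θ; exact wrightM_eq h0 h1 θ
  rw [this]
  refine continuous_const.mul (Complex.continuous_im.comp ?_)
  refine continuous_iff_continuousAt.2 fun θ₀ => ?_
  obtain ⟨C, hC⟩ := exists_mul_rpow_le h0 h1 (show 0 ≤ |θ₀| + 1 by positivity)
    (show (0 : ℝ) < 1 / 2 by norm_num)
  refine continuousAt_of_dominated (bound := fun x => Real.exp C *
    Real.exp (α * x - 1 / 2 * Real.exp x)) ?_ ?_
    ((integrable_exp_mul_sub_exp h0 (by norm_num)).const_mul _) ?_
  · refine Eventually.of_forall fun θ => Continuous.aestronglyMeasurable ?_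
    have := (differentiable_wrightKernel α θ).continuous
    fun_prop
  · filter_upwards [Metric.ball_mem_nhds θ₀ one_pos] with θ hθ
    refine Eventually.of_forall fun x => ?_
    rw [norm_wrightKernel, ← Real.exp_add]
    refine Real.exp_le_exp.2 ?_
    rw [Metric.mem_ball, Real.dist_eq] at hθ
    have h2 : |θ| ≤ |θ₀| + 1 := by
      have := abs_sub_abs_le_abs_sub θ θ₀; linarith
    have h3 : -(θ * (Real.exp (α * x) * Real.cos (α * Real.pi))) ≤
        (|θ₀| + 1) * Real.exp (α * x) := by
      calc _ ≤ |θ * (Real.exp (α * x) * Real.cos (α * Real.pi))| := neg_le_abs _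
        _ = |θ| * (Real.exp (α * x) * |Real.cos (α * Real.pi)|) := by
            rw [abs_mul, abs_mul, Real.abs_exp]
        _ ≤ (|θ₀| + 1) * (Real.exp (α * x) * 1) := by
            gcongr; exact Real.abs_cos_le_one _
        _ = _ := by rw [mul_one]
    have := hC x
    rw [Real.cos_pi]
    linarith
  · refine Eventually.of_forall fun x => ?_
    unfold wrightKernel
    fun_prop

end Angle

end WrightFunction

/-! ### The Mellin transform of the Wright function. -/

section MellinTransform

theorem mellin_eq_integral_exp (f : ℝ → ℂ) (z : ℂ) :
    mellin f z = ∫ t : ℝ, Complex.exp (z * t) * f (Real.exp t) := by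
  rw [mellin, ← integral_exp_smul_comp_exp]
  congr 1; ext t
  rw [Complex.real_smul, smul_eq_mul, ← mul_assoc]
  congr 1
  rw [Complex.cpow_def_of_ne_zero (by exact_mod_cast (Real.exp_pos t).ne'),
    ← Complex.ofReal_log (Real.exp_pos t).le, Real.log_exp, Complex.ofReal_exp, ← Complex.exp_add]
  congr 1; ring

/-- With θ = exp t the Mellin integrand times the kernel factors as P(t + αx)W(x). Fubini and
translation invariance then leave a product of two Gamma integrals. The values s = ±1 serve the
conjugate lines at ±φ. -/
theorem integral_exp_mul_wrightKernel {α : ℝ} (h0 : 0 < α) {z : ℂ} (hz0 : 0 < z.re)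
    (hz1 : z.re < 1) {φ s : ℝ} (hs : Complex.exp (s * Real.pi * Complex.I) = -1)
    (hφ : |φ - s * Real.pi| < Real.pi / 2) (hαφ : |α * φ| < Real.pi / 2) :
    Integrable (fun t : ℝ => Complex.exp (z * t) *
      ∫ x : ℝ, wrightKernel α (Real.exp t) (x + φ * Complex.I)) ∧
    ∫ t : ℝ, Complex.exp (z * t) * ∫ x : ℝ, wrightKernel α (Real.exp t) (x + φ * Complex.I) =
      Complex.Gamma z * (Complex.exp (s * Real.pi * Complex.I * (α * (1 - z)))
        * Complex.Gamma (α * (1 - z))) := by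
  set a : ℂ := α * (1 - z) with ha
  have ha0 : 0 < a.re := by
    rw [ha, Complex.re_ofReal_mul, Complex.sub_re, Complex.one_re]
    exact mul_pos h0 (by linarith)
  set P : ℝ → ℂ := fun t => Complex.exp (z * (t + (α * φ : ℝ) * Complex.I)
      - Complex.exp (t + (α * φ : ℝ) * Complex.I)) with hP
  have hPi : Integrable P := (integral_exp_mul_sub_exp hz0 hαφ).1
  have hPe : ∫ t, P t = Complex.Gamma z := (integral_exp_mul_sub_exp hz0 hαφ).2
  have hPc : Continuous P := by fun_prop
  set W : ℝ → ℂ := fun x => Complex.exp (s * Real.pi * Complex.I * a) *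
    Complex.exp (a * (x + (φ - s * Real.pi : ℝ) * Complex.I)
      - Complex.exp (x + (φ - s * Real.pi : ℝ) * Complex.I)) with hW
  have hWi : Integrable W := (integral_exp_mul_sub_exp ha0 hφ).1.const_mul _
  have hWe : ∫ x, W x = Complex.exp (s * Real.pi * Complex.I * a) * Complex.Gamma a := by
    rw [← (integral_exp_mul_sub_exp ha0 hφ).2, ← integral_const_mul]
  have hWc : Continuous W := by fun_prop
  have hker : ∀ t x : ℝ, Complex.exp (z * t) * wrightKernel α (Real.exp t) (x + φ * Complex.I) =
      P (t + α * x) * W x := by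
    intro t x
    have e1 : Complex.exp (x + φ * Complex.I) =
        -Complex.exp (x + (φ - s * Real.pi : ℝ) * Complex.I) := by
      have : (x : ℂ) + φ * Complex.I =
          (x + (φ - s * Real.pi : ℝ) * Complex.I) + s * Real.pi * Complex.I := by
        push_cast; ring
      rw [this, Complex.exp_add, hs]; ring
    have e2 : (Real.exp t : ℂ) * Complex.exp (α * (x + φ * Complex.I)) =
        Complex.exp ((t + α * x : ℝ) + (α * φ : ℝ) * Complex.I) := by
      rw [Complex.ofReal_exp, ← Complex.exp_add]; congr 1; push_cast; ring
    rw [wrightKernel, e1, e2, hP, hW]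
    simp only
    rw [← Complex.exp_add, ← Complex.exp_add, ← Complex.exp_add]
    congr 1
    rw [ha]; push_cast; ring
  clear_value P W
  have hprod : Integrable (fun q : ℝ × ℝ => P (q.1 + α * q.2) * W q.2)
      (volume.prod volume) := by
    rw [integrable_prod_iff' (Continuous.aestronglyMeasurable (by fun_prop))]
    refine ⟨Eventually.of_forall fun x => (hPi.comp_add_right (α * x)).mul_const (W x), ?_⟩
    have : ∀ x, ∫ t, ‖P (t + α * x) * W x‖ = (∫ t, ‖P t‖) * ‖W x‖ := by
      intro x
      simp only [norm_mul]
      rw [integral_mul_const, integral_add_right_eq_self (fun t => ‖P t‖)]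
    simp only [this]
    exact hWi.norm.const_mul _
  have hfun : (fun t : ℝ => Complex.exp (z * t) *
      ∫ x : ℝ, wrightKernel α (Real.exp t) (x + φ * Complex.I)) =
      fun t => ∫ x, P (t + α * x) * W x := by
    ext t
    rw [← integral_const_mul]
    simp only [hker]
  rw [hfun]
  refine ⟨hprod.integral_prod_left, ?_⟩
  rw [integral_integral_swap hprod]
  have : ∀ x, ∫ t, P (t + α * x) * W x = Complex.Gamma z * W x := by
    intro x
    rw [integral_mul_const, integral_add_right_eq_self P, hPe]
  simp only [this]
  rw [integral_const_mul, hWe]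

theorem complex_inv_Gamma_one_sub {s : ℂ} (hs : 0 < s.re) :
    (Complex.Gamma (1 - s))⁻¹ =
      (Real.pi : ℂ)⁻¹ * (Complex.sin (Real.pi * s) * Complex.Gamma s) := by
  have h := Complex.Gamma_ne_zero_of_re_pos hs
  have h2 : Complex.Gamma (1 - s) = Real.pi / Complex.sin (Real.pi * s) / Complex.Gamma s := by
    rw [← Complex.Gamma_mul_Gamma_one_sub s, mul_div_cancel_left₀ _ h]
  rw [h2, inv_div, div_div_eq_mul_div]
  ring

variable {α : ℝ} (h0 : 0 < α) (h1 : α < 1)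
include h0 h1

/-- The imaginary part is the difference of the integrals over the lines ±φ divided by 2i. The two
phases combine into a sine and reflection applies. The factor Γ(α(1 - z)) restricts the computation
to Re z < 1. -/
theorem mellin_wrightM_of_re_lt_one {z : ℂ} (hz0 : 0 < z.re) (hz1 : z.re < 1) :
    mellin (fun θ => (wrightM α θ : ℂ)) z =
      Complex.Gamma z * (Complex.Gamma (1 - α + α * z))⁻¹ := by
  set φ := wrightAngle α with hφ
  have hφ0 := wrightAngle_pos h0 h1
  have hφ1 := wrightAngle_lt_pi h0 h1
  have hφ2 := pi_div_two_lt_wrightAngle h0 h1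
  have hφ3 := mul_wrightAngle_lt h0 h1
  rw [← hφ] at hφ0 hφ1 hφ2 hφ3
  have hαφ : |α * φ| < Real.pi / 2 := by rw [abs_of_pos (by positivity)]; exact hφ3
  obtain ⟨hi1, he1⟩ := integral_exp_mul_wrightKernel h0 hz0 hz1 (φ := φ) (s := 1)
    (by simp) (by rw [abs_lt]; constructor <;> linarith) hαφ
  obtain ⟨hi2, he2⟩ := integral_exp_mul_wrightKernel h0 hz0 hz1 (φ := -φ) (s := -1)
    (by simp [Complex.exp_neg]) (by rw [abs_lt]; constructor <;> linarith)
    (by rwa [mul_neg, abs_neg])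
  have hM : ∀ t : ℝ, (wrightM α (Real.exp t) : ℂ) = (2 * Real.pi * Complex.I)⁻¹ *
      ((∫ x : ℝ, wrightKernel α (Real.exp t) (x + φ * Complex.I))
        - ∫ x : ℝ, wrightKernel α (Real.exp t) (x + (-φ : ℝ) * Complex.I)) := by
    intro t
    have hc : ∫ x : ℝ, wrightKernel α (Real.exp t) (x + (-φ : ℝ) * Complex.I) =
        starRingEnd ℂ (∫ x : ℝ, wrightKernel α (Real.exp t) (x + φ * Complex.I)) := by
      rw [← integral_conj]
      congr 1; ext x
      rw [← wrightKernel_conj]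
      congr 1; simp
    rw [hc, wrightM_eq_angle h0 h1 (Real.exp_pos t).le, ← hφ, Complex.ofReal_mul,
      Complex.im_eq_sub_conj]
    have := Complex.I_ne_zero
    push_cast
    field_simp
  rw [mellin_eq_integral_exp]
  have hI : ∀ t : ℝ, Complex.exp (z * t) * (wrightM α (Real.exp t) : ℂ) =
      (2 * Real.pi * Complex.I)⁻¹ * (Complex.exp (z * t) *
        (∫ x : ℝ, wrightKernel α (Real.exp t) (x + φ * Complex.I)) - Complex.exp (z * t) *
        ∫ x : ℝ, wrightKernel α (Real.exp t) (x + (-φ : ℝ) * Complex.I)) := by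
    intro t; rw [hM]; ring
  simp only [hI]
  rw [integral_const_mul, integral_sub hi1 hi2, he1, he2]
  have ha0 : 0 < ((α : ℂ) * (1 - z)).re := by
    rw [Complex.re_ofReal_mul, Complex.sub_re, Complex.one_re]
    exact mul_pos h0 (by linarith)
  have e : (1 : ℂ) - α + α * z = 1 - α * (1 - z) := by ring
  rw [e, complex_inv_Gamma_one_sub ha0, Complex.sin]
  have e1 : (((1 : ℝ) : ℂ) * Real.pi * Complex.I * (α * (1 - z))) =
      Real.pi * (α * (1 - z)) * Complex.I := by push_cast; ring
  have e2 : (((-1 : ℝ) : ℂ) * Real.pi * Complex.I * (α * (1 - z))) =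
      -(Real.pi * (α * (1 - z))) * Complex.I := by push_cast; ring
  rw [e1, e2]
  rw [mul_inv, mul_inv, Complex.inv_I]
  ring

theorem continuous_ofReal_wrightM : Continuous fun θ => (wrightM α θ : ℂ) :=
  Complex.continuous_ofReal.comp (continuous_wrightM h0 h1)

theorem wrightM_isBigO_atTop :
    (fun θ => (wrightM α θ : ℂ)) =O[atTop] fun t => Real.exp (-1 * t) := by
  obtain ⟨C, -, hC⟩ := exists_abs_wrightM_le h0 h1 one_pos
  refine Asymptotics.IsBigO.of_bound C ?_
  filter_upwards [eventually_ge_atTop 0] with t ht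
  rw [Complex.norm_real, Real.norm_eq_abs, Real.norm_of_nonneg (Real.exp_pos _).le, neg_mul]
  exact hC t ht

theorem wrightM_isBigO_zero :
    (fun θ => (wrightM α θ : ℂ)) =O[𝓝[>] 0] fun t => t ^ (-(0 : ℝ)) := by
  simp only [neg_zero, Real.rpow_zero]
  exact (((continuous_ofReal_wrightM h0 h1).tendsto 0).mono_left nhdsWithin_le_nhds).isBigO_one ℝ

theorem mellinConvergent_wrightM {z : ℂ} (hz : 0 < z.re) :
    MellinConvergent (fun θ => (wrightM α θ : ℂ)) z :=
  mellinConvergent_of_isBigO_rpow_exp one_pos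
    ((continuous_ofReal_wrightM h0 h1).locallyIntegrable.locallyIntegrableOn _)
    (wrightM_isBigO_atTop h0 h1) (wrightM_isBigO_zero h0 h1) hz

/-- The Mellin transform of the Wright function. -/
theorem mellin_wrightM {z : ℂ} (hz : 0 < z.re) :
    mellin (fun θ => (wrightM α θ : ℂ)) z =
      Complex.Gamma z * (Complex.Gamma (1 - α + α * z))⁻¹ := by
  set U : Set ℂ := {w | 0 < w.re} with hU
  have hUo : IsOpen U := isOpen_lt continuous_const Complex.continuous_re
  have hf : AnalyticOnNhd ℂ (mellin fun θ => (wrightM α θ : ℂ)) U := by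
    refine DifferentiableOn.analyticOnNhd (fun w hw => ?_) hUo
    exact (mellin_differentiableAt_of_isBigO_rpow_exp one_pos
      ((continuous_ofReal_wrightM h0 h1).locallyIntegrable.locallyIntegrableOn _)
      (wrightM_isBigO_atTop h0 h1) (wrightM_isBigO_zero h0 h1) hw).differentiableWithinAt
  have hg : AnalyticOnNhd ℂ (fun w => Complex.Gamma w * (Complex.Gamma (1 - α + α * w))⁻¹) U := by
    refine DifferentiableOn.analyticOnNhd (fun w hw => ?_) hUo
    refine DifferentiableAt.differentiableWithinAt ?_
    refine (Complex.differentiableAt_Gamma _ fun m hm => ?_).mul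
      (Complex.differentiable_one_div_Gamma.differentiableAt.comp w
        (f := fun w : ℂ => 1 - (α : ℂ) + α * w) (by fun_prop))
    rw [hU, mem_ofPred_eq, hm] at hw
    simp only [Complex.neg_re, Complex.natCast_re] at hw
    linarith [Nat.cast_nonneg (α := ℝ) m]
  have hpre : IsPreconnected U := (convex_halfSpace_re_gt 0).isPreconnected
  have h2 : ((1 / 2 : ℝ) : ℂ) ∈ U := by
    rw [hU, mem_ofPred_eq, Complex.ofReal_re]; norm_num
  -- Both sides are analytic for Re z > 0 and agree near z = 1/2, so the identity theorem removes
  -- the restriction Re z < 1.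
  refine hf.eqOn_of_preconnected_of_eventuallyEq hg hpre h2 ?_ hz
  have hV : {w : ℂ | w.re < 1} ∈ 𝓝 ((1 / 2 : ℝ) : ℂ) :=
    (isOpen_lt Complex.continuous_re continuous_const).mem_nhds (by
      rw [mem_ofPred_eq, Complex.ofReal_re]; norm_num)
  filter_upwards [hUo.mem_nhds h2, hV] with w hw hw1
  exact mellin_wrightM_of_re_lt_one h0 h1 hw hw1

theorem integral_wrightM : ∫ θ in Ioi 0, wrightM α θ = 1 := by
  have h := mellin_wrightM h0 h1 (z := 1) (by simp)
  have e : (1 : ℂ) - α + α * 1 = 1 := by ring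
  rw [e, Complex.Gamma_one, inv_one, mul_one, mellin] at h
  simp only [sub_self, Complex.cpow_zero, one_smul] at h
  rw [integral_complex_ofReal] at h
  exact_mod_cast h

theorem integrableOn_exp_mul_wrightM (w : ℝ) (n : ℕ) :
    IntegrableOn (fun θ => θ ^ n * (Real.exp (w * θ) * |wrightM α θ|)) (Ioi 0) := by
  obtain ⟨C, hC0, hC⟩ := exists_abs_wrightM_le h0 h1 (show 0 < |w| + 1 by positivity)
  have hi := (integrableOn_rpow_mul_exp_neg_mul_rpow (p := 1) (s := n) (b := 1)
    (by linarith [Nat.cast_nonneg (α := ℝ) n]) one_pos one_pos).const_mul C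
  have hc := continuous_wrightM h0 h1
  refine hi.mono' (by fun_prop) ?_
  filter_upwards [ae_restrict_mem measurableSet_Ioi] with θ hθ
  have hθ' : 0 < θ := hθ
  rw [Real.norm_of_nonneg (by positivity)]
  simp only [Real.rpow_one, Real.rpow_natCast]
  calc θ ^ n * (Real.exp (w * θ) * |wrightM α θ|)
      ≤ θ ^ n * (Real.exp (|w| * θ) * (C * Real.exp (-((|w| + 1) * θ)))) := by
        gcongr
        · exact le_abs_self w
        · exact hC θ hθ'.le
    _ = C * (θ ^ n * Real.exp (-1 * θ)) := by
        have : -1 * θ = |w| * θ + -((|w| + 1) * θ) := by ring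
        rw [this, Real.exp_add]; ring

end MellinTransform

/-! ### Mellin transforms of averages of dilations. -/

section MellinConvolution

/-- The Mellin transform turns an average of dilations into a product. -/
theorem hasMellin_integral_comp_mul {S : Set ℝ} (hS : MeasurableSet S) {k c : ℝ → ℝ} {F : ℝ → ℂ}
    (hk : Measurable k) (hc : Measurable c) (hF : Measurable F) (hc0 : ∀ τ ∈ S, 0 < c τ) {z : ℂ}
    (hFz : MellinConvergent F z) (hkc : IntegrableOn (fun τ => |k τ| * c τ ^ (-z.re)) S) :
    HasMellin (fun s => ∫ τ in S, (k τ : ℂ) * F (s * c τ)) z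
      ((∫ τ in S, (k τ : ℂ) * (c τ : ℂ) ^ (-z)) * mellin F z) := by
  have hm : AEStronglyMeasurable (fun q : ℝ × ℝ => (q.1 : ℂ) ^ (z - 1) *
      ((k q.2 : ℂ) * F (q.1 * c q.2)))
      ((volume.restrict (Ioi 0)).prod (volume.restrict S)) := by
    refine Measurable.aestronglyMeasurable ?_
    have : Measurable fun q : ℝ × ℝ => F (q.1 * c q.2) :=
      hF.comp (measurable_fst.mul (hc.comp measurable_snd))
    have h2 : Measurable fun q : ℝ × ℝ => (k q.2 : ℂ) :=
      Complex.measurable_ofReal.comp (hk.comp measurable_snd)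
    have h3 : Measurable fun q : ℝ × ℝ => (q.1 : ℂ) ^ (z - 1) :=
      (Complex.measurable_ofReal.comp measurable_fst).pow_const _
    exact h3.mul (h2.mul this)
  have hnorm : ∀ τ ∈ S, ∫ s : ℝ in Ioi 0, ‖(s : ℂ) ^ (z - 1) * ((k τ : ℂ) * F (s * c τ))‖ =
      (|k τ| * c τ ^ (-z.re)) * ∫ s : ℝ in Ioi 0, ‖(s : ℂ) ^ (z - 1) * F s‖ := by
    intro τ hτ
    have hcτ := hc0 τ hτ
    have e : ∀ s ∈ Ioi (0 : ℝ), ‖(s : ℂ) ^ (z - 1) * ((k τ : ℂ) * F (s * c τ))‖ =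
        (|k τ| * c τ ^ (1 - z.re)) * (fun s : ℝ => ‖(s : ℂ) ^ (z - 1) * F s‖) (s * c τ) := by
      intro s hs
      have hs' : 0 < s := hs
      simp only [norm_mul, Complex.norm_real, Real.norm_eq_abs]
      rw [Complex.norm_cpow_eq_rpow_re_of_pos hs',
        Complex.norm_cpow_eq_rpow_re_of_pos (mul_pos hs' hcτ), Complex.sub_re, Complex.one_re,
        Real.mul_rpow hs'.le hcτ.le]
      have : c τ ^ (1 - z.re) * c τ ^ (z.re - 1) = 1 := by
        rw [← Real.rpow_add hcτ]; simp
      linear_combination (-(|k τ| * s ^ (z.re - 1) * ‖F (s * c τ)‖)) * this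
    rw [setIntegral_congr_fun measurableSet_Ioi e, integral_const_mul,
      integral_comp_mul_right_Ioi (fun s : ℝ => ‖(s : ℂ) ^ (z - 1) * F s‖) 0 hcτ, zero_mul, smul_eq_mul, ← mul_assoc]
    congr 1
    rw [mul_assoc]
    congr 1
    rw [← Real.rpow_neg_one, ← Real.rpow_add hcτ]
    congr 1; ring
  have hprod : Integrable (fun q : ℝ × ℝ => (q.1 : ℂ) ^ (z - 1) *
      ((k q.2 : ℂ) * F (q.1 * c q.2)))
      ((volume.restrict (Ioi 0)).prod (volume.restrict S)) := by
    rw [integrable_prod_iff' hm]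
    constructor
    · filter_upwards [ae_restrict_mem hS] with τ hτ
      have := ((MellinConvergent.comp_mul_left (hc0 τ hτ)).2 hFz)
      have h2 := Integrable.const_mul this (k τ : ℂ)
      refine h2.congr (Eventually.of_forall fun s => ?_)
      simp only [smul_eq_mul, mul_comm (c τ)]
      ring
    · refine ((hkc.mul_const (∫ s : ℝ in Ioi 0, ‖(s : ℂ) ^ (z - 1) * F s‖))).congr ?_
      filter_upwards [ae_restrict_mem hS] with τ hτ
      exact (hnorm τ hτ).symm
  have hfun : (fun s : ℝ => (s : ℂ) ^ (z - 1) • ∫ τ in S, (k τ : ℂ) * F (s * c τ)) =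
      fun s : ℝ => ∫ τ in S, (s : ℂ) ^ (z - 1) * ((k τ : ℂ) * F (s * c τ)) := by
    ext s
    rw [integral_const_mul, smul_eq_mul]
  refine ⟨?_, ?_⟩
  · rw [MellinConvergent, hfun]
    exact hprod.integral_prod_left
  · rw [mellin, hfun, integral_integral_swap hprod, ← integral_mul_const]
    refine setIntegral_congr_fun hS fun τ hτ => ?_
    have h2 := mellin_comp_mul_right F z (hc0 τ hτ)
    rw [mellin, smul_eq_mul] at h2
    simp only [smul_eq_mul] at h2
    rw [mul_assoc, ← h2, ← integral_const_mul]
    congr 1; ext s; ring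

end MellinConvolution

theorem integrableOn_beta_weight {a b : ℝ} (ha : 0 < a) (hb : 0 < b) :
    IntegrableOn (fun τ : ℝ => (1 - τ) ^ (b - 1) * τ ^ (a - 1)) (Ioo 0 1) := by
  have h := (Complex.betaIntegral_convergent (u := a) (v := b) (by simpa) (by simpa)).norm
  rw [intervalIntegrable_iff_integrableOn_Ioo_of_le zero_le_one] at h
  refine h.congr_fun (fun τ hτ => ?_) measurableSet_Ioo
  have e : ((1 : ℂ) - τ) = ((1 - τ : ℝ) : ℂ) := by push_cast; rfl
  simp only [norm_mul]
  rw [e, Complex.norm_cpow_eq_rpow_re_of_pos hτ.1,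
    Complex.norm_cpow_eq_rpow_re_of_pos (sub_pos.2 hτ.2), mul_comm]
  simp

/-! ### The fractional integration identity for the Wright function. -/

section WrightFunction

variable {α : ℝ} (h0 : 0 < α) (h1 : α < 1)
include h0 h1

/-- The exponent is chosen so that (sτ^(-α))^(-1/α) = s^(-1/α) τ, which cancels the factor τ⁻¹ in
the average over τ. -/
theorem exists_mul_wrightM_le_rpow : ∃ C, 0 < C ∧ ∀ θ, 0 < θ →
    |θ * wrightM α θ| ≤ C * θ ^ (-(1 / α)) := by
  obtain ⟨C, hC0, hC⟩ := exists_abs_wrightM_le h0 h1 one_pos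
  obtain ⟨D, hD⟩ : ∃ D, ∀ θ : ℝ, 0 < θ → θ ^ (1 / α + 1) * Real.exp (-θ) ≤ D := by
    have hcont : Continuous fun θ : ℝ => θ ^ (1 / α + 1) * Real.exp (-θ) :=
      (Real.continuous_rpow_const (by positivity)).mul (by fun_prop)
    have ht := tendsto_rpow_mul_exp_neg_mul_atTop_nhds_zero (1 / α + 1) 1 one_pos
    obtain ⟨N, hN⟩ := (ht.eventually_le_const (zero_lt_one)).exists_forall_of_atTop
    obtain ⟨D, hD⟩ := (isCompact_Icc (a := (0 : ℝ)) (b := N)).exists_bound_of_continuousOn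
      hcont.continuousOn
    refine ⟨max D 1, fun θ hθ => ?_⟩
    rcases le_total θ N with h | h
    · exact ((le_abs_self _).trans (hD θ ⟨hθ.le, h⟩)).trans (le_max_left _ _)
    · have := hN θ h
      rw [neg_one_mul] at this
      exact this.trans (le_max_right _ _)
  have hD0 : 0 < D := lt_of_lt_of_le (by positivity) (hD 1 one_pos)
  refine ⟨C * D, by positivity, fun θ hθ => ?_⟩
  have h := hC θ hθ.le
  rw [abs_mul, abs_of_pos hθ]
  calc θ * |wrightM α θ| ≤ θ * (C * Real.exp (-(1 * θ))) := by gcongr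
    _ = C * (θ ^ (1 / α + 1) * Real.exp (-θ)) * θ ^ (-(1 / α)) := by
        have : θ = θ ^ (1 / α + 1) * θ ^ (-(1 / α)) := by
          rw [← Real.rpow_add hθ, show 1 / α + 1 + -(1 / α) = 1 by ring, Real.rpow_one]
        rw [one_mul]
        nth_rewrite 1 [this]
        ring
    _ ≤ C * D * θ ^ (-(1 / α)) := by
        gcongr; exact hD θ hθ

/-- Mellin inversion recovers a function at points of continuity. The bound from
`exists_mul_wrightM_le_rpow` dominates the integrand uniformly for parameters above s/2. -/
theorem continuousAt_wright_average {s : ℝ} (hs : 0 < s) :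
    ContinuousAt (fun s : ℝ => ∫ τ in Ioo (0 : ℝ) 1, (((1 - τ) ^ (-α) * τ⁻¹ : ℝ) : ℂ) *
      (((s * τ ^ (-α)) * wrightM α (s * τ ^ (-α)) : ℝ) : ℂ)) s := by
  obtain ⟨C, hC0, hC⟩ := exists_mul_wrightM_le_rpow h0 h1
  have hint := (integrableOn_beta_weight (a := 1) (b := 1 - α) one_pos
    (by linarith)).const_mul (C * (s / 2) ^ (-(1 / α)))
  refine continuousAt_of_dominated (bound := fun τ => C * (s / 2) ^ (-(1 / α)) *
    ((1 - τ) ^ (1 - α - 1) * τ ^ (1 - 1 : ℝ))) ?_ ?_ hint ?_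
  · refine Eventually.of_forall fun s' => Measurable.aestronglyMeasurable ?_
    have := (continuous_wrightM h0 h1).measurable
    fun_prop
  · filter_upwards [eventually_gt_nhds (show s / 2 < s by linarith)] with s' hs'
    filter_upwards [ae_restrict_mem measurableSet_Ioo] with τ hτ
    have hτ0 := hτ.1
    have hτ1 : 0 < 1 - τ := sub_pos.2 hτ.2
    have hs0 : 0 < s' := by linarith
    rw [norm_mul, Complex.norm_real, Complex.norm_real, Real.norm_of_nonneg (by positivity),
      Real.norm_eq_abs]
    have h := hC (s' * τ ^ (-α)) (by positivity)
    have e : (s' * τ ^ (-α)) ^ (-(1 / α)) = s' ^ (-(1 / α)) * τ := by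
      rw [Real.mul_rpow hs0.le (by positivity), ← Real.rpow_mul hτ0.le]
      congr 1
      rw [neg_mul_neg, mul_one_div_cancel h0.ne', Real.rpow_one]
    rw [e] at h
    have h2 : s' ^ (-(1 / α)) ≤ (s / 2) ^ (-(1 / α)) :=
      Real.rpow_le_rpow_of_nonpos (by linarith) hs'.le (by
        have : 0 < 1 / α := by positivity
        linarith)
    calc (1 - τ) ^ (-α) * τ⁻¹ * |s' * τ ^ (-α) * wrightM α (s' * τ ^ (-α))|
        ≤ (1 - τ) ^ (-α) * τ⁻¹ * (C * ((s / 2) ^ (-(1 / α)) * τ)) := by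
          gcongr
          exact h.trans (by gcongr)
      _ = _ := by
          rw [show 1 - α - 1 = -α by ring, sub_self, Real.rpow_zero]
          field_simp
  · filter_upwards with τ
    have := continuous_wrightM h0 h1
    fun_prop

/-- The fractional integral of the density `α θ M_α(θ)` along the scaling reproduces `M_α`. -/
theorem integral_wright_average {s : ℝ} (hs : 0 < s) :
    ∫ τ in Ioo (0 : ℝ) 1, ((1 - τ) ^ (-α) * τ⁻¹) *
      (α * (s * τ ^ (-α)) * wrightM α (s * τ ^ (-α))) = Real.Gamma (1 - α) * wrightM α s := by
  set F : ℝ → ℂ := fun θ => ((θ * wrightM α θ : ℝ) : ℂ) with hF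
  set k : ℝ → ℝ := fun τ => (1 - τ) ^ (-α) * τ⁻¹ with hk
  set c : ℝ → ℝ := fun τ => τ ^ (-α) with hc
  set A : ℝ → ℂ := fun s => ∫ τ in Ioo (0 : ℝ) 1, (k τ : ℂ) * F (s * c τ) with hA
  have hM := (continuous_wrightM h0 h1).measurable
  have hc0 : ∀ τ ∈ Ioo (0 : ℝ) 1, 0 < c τ := fun τ hτ => Real.rpow_pos_of_pos hτ.1 _
  have hFcpow : F = fun θ : ℝ => (θ : ℂ) ^ (1 : ℂ) • (wrightM α θ : ℂ) := by
    ext θ; simp [hF]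
  have hΓ : Complex.Gamma (1 - α) ≠ 0 := by
    refine Complex.Gamma_ne_zero_of_re_pos ?_
    simp; exact h1
  have hmel : ∀ z : ℂ, 0 < z.re → HasMellin A z
      ((α : ℂ)⁻¹ * Complex.Gamma (1 - α) * mellin (fun θ => (wrightM α θ : ℂ)) z) := by
    intro z hz
    have hz1 : 0 < (z + 1).re := by simp; linarith
    have hFz : MellinConvergent F z := by
      rw [hFcpow, MellinConvergent.cpow_smul]
      exact mellinConvergent_wrightM h0 h1 hz1
    have hFm : mellin F z = Complex.Gamma (z + 1) * (Complex.Gamma (1 + α * z))⁻¹ := by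
      rw [hFcpow, mellin_cpow_smul, mellin_wrightM h0 h1 hz1]
      congr 3; ring
    have hαz : 0 < α * z.re := by positivity
    have h := hasMellin_integral_comp_mul (S := Ioo 0 1) measurableSet_Ioo (k := k) (c := c)
      (F := F) (by fun_prop) (by fun_prop) (by fun_prop) hc0 hFz ?_
    -- The average contributes a Beta factor, B(αz, 1 - α), and the functional equation of Γ turns
    -- its product with the transform of θM_α(θ) into a multiple of the transform of M_α.
    · have hbeta : ∫ τ in Ioo (0 : ℝ) 1, (k τ : ℂ) * (c τ : ℂ) ^ (-z) =
          Complex.betaIntegral (α * z) (1 - α) := by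
        rw [Complex.betaIntegral, intervalIntegral.integral_of_le zero_le_one,
          integral_Ioc_eq_integral_Ioo]
        refine setIntegral_congr_fun measurableSet_Ioo fun τ hτ => ?_
        have hτ0 : (τ : ℂ) ≠ 0 := by exact_mod_cast hτ.1.ne'
        simp only [hk, hc]
        rw [Complex.ofReal_mul, Complex.ofReal_cpow (sub_pos.2 hτ.2).le,
          Complex.ofReal_cpow hτ.1.le, Complex.ofReal_inv, ← Complex.cpow_neg_one,
          Complex.ofReal_neg, Complex.cpow_def_of_ne_zero hτ0, Complex.cpow_def_of_ne_zero hτ0,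
          Complex.cpow_def_of_ne_zero hτ0, ← Complex.ofReal_log hτ.1.le]
        have e2 : Complex.exp ((Real.log τ : ℂ) * -(α : ℂ)) ^ (-z) =
            Complex.exp ((Real.log τ : ℂ) * (α * z)) := by
          have : (Real.log τ : ℂ) * -(α : ℂ) = ((Real.log τ * -α : ℝ) : ℂ) := by push_cast; rfl
          rw [Complex.cpow_def_of_ne_zero (Complex.exp_ne_zero _), this, ← Complex.ofReal_exp,
            ← Complex.ofReal_log (Real.exp_pos _).le, Real.log_exp]
          congr 1; push_cast; ring
        rw [e2, mul_assoc, ← Complex.exp_add, mul_comm]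
        congr 1
        · congr 1; ring
        · push_cast; congr 1; ring
      rw [hbeta, hFm] at h
      have hB := Complex.Gamma_mul_Gamma_eq_betaIntegral (s := α * z) (t := 1 - α)
        (by rw [Complex.re_ofReal_mul]; exact hαz) (by simp; exact h1)
      have hαz0 : (α : ℂ) * z ≠ 0 := by
        intro hh
        have := congrArg Complex.re hh
        rw [Complex.re_ofReal_mul, Complex.zero_re] at this
        linarith
      have hz0 : z ≠ 0 := fun hh => hαz0 (by rw [hh, mul_zero])
      have hα0 : (α : ℂ) ≠ 0 := by exact_mod_cast h0.ne'
      have hG2 : Complex.Gamma (α * z) ≠ 0 := Complex.Gamma_ne_zero_of_re_pos (by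
        rw [Complex.re_ofReal_mul]; exact hαz)
      have hG3 : Complex.Gamma (1 - α + α * z) ≠ 0 := Complex.Gamma_ne_zero_of_re_pos (by
        rw [Complex.add_re, Complex.re_ofReal_mul]
        simp; linarith)
      convert! h using 1
      rw [mellin_wrightM h0 h1 hz, Complex.Gamma_add_one z hz0, add_comm (1 : ℂ) (α * z),
        Complex.Gamma_add_one _ hαz0]
      have e3 : (α : ℂ) * z + (1 - α) = 1 - α + α * z := by ring
      rw [e3] at hB
      have hB' : Complex.betaIntegral (α * z) (1 - α) =
          Complex.Gamma (α * z) * Complex.Gamma (1 - α) / Complex.Gamma (1 - α + α * z) := by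
        rw [hB]; field_simp
      rw [hB']
      field_simp
    · refine (integrableOn_beta_weight (a := α * z.re) (b := 1 - α) hαz
        (by linarith)).congr_fun (fun τ hτ => ?_) measurableSet_Ioo
      have hτ0 := hτ.1
      have hτ1 : 0 < 1 - τ := sub_pos.2 hτ.2
      simp only [hk, hc]
      rw [abs_of_pos (by positivity), ← Real.rpow_mul hτ0.le, mul_assoc, ← Real.rpow_neg_one τ,
        ← Real.rpow_add hτ0]
      congr 2 <;> ring
  -- The difference of the two sides has zero Mellin transform on Re z = 1, so inversion makes it
  -- vanish.
  set G : ℝ → ℂ := fun s => (α : ℂ) • A s - Complex.Gamma (1 - α) • (wrightM α s : ℂ) with hG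
  have hGm : ∀ z : ℂ, 0 < z.re → HasMellin G z 0 := by
    intro z hz
    have h2 := hasMellin_sub ((hmel z hz).1.const_smul (α : ℂ))
      ((mellinConvergent_wrightM h0 h1 hz).const_smul (Complex.Gamma (1 - α)))
    refine ⟨h2.1, ?_⟩
    rw [h2.2, mellin_const_smul, mellin_const_smul, (hmel z hz).2]
    have hα0 : (α : ℂ) ≠ 0 := by exact_mod_cast h0.ne'
    simp only [smul_eq_mul]
    field_simp
    ring
  have hGc : ContinuousAt G s := by
    refine ((continuousAt_wright_average h0 h1 hs).const_smul (α : ℂ)).sub ?_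
    exact ((continuous_ofReal_wrightM h0 h1).const_smul (Complex.Gamma (1 - α))).continuousAt
  have hline : ∀ y : ℝ, mellin G (((1 : ℝ) : ℂ) + y * Complex.I) = 0 := fun y =>
    (hGm _ (by simp)).2
  have hinv := mellinInv_mellin_eq 1 G hs (hGm _ (by simp)).1
    (by unfold Complex.VerticalIntegrable; simp only [hline]; exact integrable_zero _ _ _) hGc
  have hG0 : G s = 0 := by
    rw [← hinv, mellinInv]
    simp only [hline, smul_zero, integral_zero]
  have hAs : A s = ((∫ τ in Ioo (0 : ℝ) 1, k τ * (s * c τ * wrightM α (s * c τ)) : ℝ) : ℂ) := by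
    rw [hA, ← integral_complex_ofReal]
    simp only [hF]
    congr 1; ext τ; push_cast; ring
  have hfin : ∫ τ in Ioo (0 : ℝ) 1, k τ * (α * (s * c τ) * wrightM α (s * c τ)) =
      α * ∫ τ in Ioo (0 : ℝ) 1, k τ * (s * c τ * wrightM α (s * c τ)) := by
    rw [← integral_const_mul]
    congr 1; ext τ; ring
  simp only [hG] at hG0
  rw [hAs, smul_eq_mul, smul_eq_mul, sub_eq_zero] at hG0
  rw [hfin]
  have e4 : Complex.Gamma (1 - α) = (Real.Gamma (1 - α) : ℂ) := by
    rw [← Complex.Gamma_ofReal]; push_cast; rfl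
  rw [e4] at hG0
  exact_mod_cast hG0

end WrightFunction

/-! ### Subordination integrals for vector-valued functions. -/

section Subordination

variable {E : Type*} [NormedAddCommGroup E] [NormedSpace ℝ E]

theorem integrableOn_smul_of_exp_growth {h : ℝ → ℝ} (hc : Continuous h)
    (hh : ∀ w, IntegrableOn (fun θ => Real.exp (w * θ) * |h θ|) (Ioi 0)) {v : ℝ → E}
    (hv : ContinuousOn v (Ioi 0)) {K w : ℝ} (hK : ∀ s, 0 < s → ‖v s‖ ≤ K * Real.exp (w * s)) :
    IntegrableOn (fun θ => h θ • v θ) (Ioi 0) := by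
  refine ((hh w).const_mul K).mono'
    ((hc.continuousOn.smul hv).aestronglyMeasurable measurableSet_Ioi) ?_
  filter_upwards [ae_restrict_mem measurableSet_Ioi] with θ hθ
  rw [norm_smul, Real.norm_eq_abs]
  calc |h θ| * ‖v θ‖ ≤ |h θ| * (K * Real.exp (w * θ)) := by gcongr; exact hK θ hθ
    _ = _ := by ring

theorem integral_Ioi_comp_rpow_mul (α : ℝ) {τ : ℝ} (hτ : 0 < τ) (g : ℝ → E) :
    ∫ θ in Ioi (0 : ℝ), g (τ ^ α * θ) = τ ^ (-α) • ∫ θ in Ioi (0 : ℝ), g θ := by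
  have := integral_comp_mul_left_Ioi g 0 (Real.rpow_pos_of_pos hτ α)
  rw [this, mul_zero, Real.rpow_neg hτ.le]

variable {α : ℝ} (h0 : 0 < α) (h1 : α < 1)
include h0 h1

theorem integrableOn_exp_mul_abs_wrightM (w : ℝ) :
    IntegrableOn (fun θ => Real.exp (w * θ) * |wrightM α θ|) (Ioi 0) := by
  simpa using integrableOn_exp_mul_wrightM h0 h1 w 0

theorem integrableOn_exp_mul_abs_density (w : ℝ) :
    IntegrableOn (fun θ => Real.exp (w * θ) * |α * θ * wrightM α θ|) (Ioi 0) := by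
  refine IntegrableOn.congr_fun ((integrableOn_exp_mul_wrightM h0 h1 w 1).const_mul α)
    (fun θ hθ => ?_) measurableSet_Ioi
  have hθ' : 0 < θ := hθ
  simp only [abs_mul, abs_of_pos h0, abs_of_pos hθ', pow_one]
  ring

theorem continuous_density : Continuous fun θ => α * θ * wrightM α θ := by
  have := continuous_wrightM h0 h1
  fun_prop

/-- Replacing θ by θτ^(-α) moves all dependence on τ into the scalar density; after Fubini the
integral over τ is evaluated by `integral_wright_average` for each θ. -/
theorem integral_density_average [CompleteSpace E] {v : ℝ → E} (hv : Continuous v) {K w : ℝ} (hw : 0 ≤ w)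
    (hK : ∀ s, 0 < s → ‖v s‖ ≤ K * Real.exp (w * s)) :
    ∫ τ in Ioo (0 : ℝ) 1, ((1 - τ) ^ (-α) * τ ^ (α - 1)) •
      ∫ θ in Ioi (0 : ℝ), (α * θ * wrightM α θ) • v (τ ^ α * θ) =
    Real.Gamma (1 - α) • ∫ θ in Ioi (0 : ℝ), wrightM α θ • v θ := by
  set ψ : ℝ → ℝ := fun θ => α * θ * wrightM α θ with hψ
  have hψc : Continuous ψ := continuous_density h0 h1
  have hK0 : 0 ≤ K := by
    have := (norm_nonneg _).trans (hK 1 one_pos)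
    exact nonneg_of_mul_nonneg_left this (Real.exp_pos _)
  -- dilation of the inner variable
  have hcancel : ∀ τ ∈ Ioo (0 : ℝ) 1, ∀ θ : ℝ, τ ^ α * θ * τ ^ (-α) = θ := by
    intro τ hτ θ
    rw [mul_right_comm, ← Real.rpow_add hτ.1]; simp
  set Φ : ℝ × ℝ → E := fun q => ((1 - q.1) ^ (-α) * q.1⁻¹ * ψ (q.2 * q.1 ^ (-α))) • v q.2 with hΦ
  have hΦm : AEStronglyMeasurable Φ
      ((volume.restrict (Ioo (0 : ℝ) 1)).prod (volume.restrict (Ioi (0 : ℝ)))) := by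
    refine AEStronglyMeasurable.smul ?_ (hv.comp continuous_snd).aestronglyMeasurable
    have := hψc.measurable
    exact Measurable.aestronglyMeasurable (by fun_prop)
  set I := ∫ θ in Ioi (0 : ℝ), Real.exp (w * θ) * |ψ θ| with hI
  have hIi := integrableOn_exp_mul_abs_density h0 h1 w
  have hnormle : ∀ τ ∈ Ioo (0 : ℝ) 1, ∀ θ, 0 < θ →
      ‖ψ θ • v (τ ^ α * θ)‖ ≤ K * (Real.exp (w * θ) * |ψ θ|) := by
    intro τ hτ θ hθ
    have hτα := Real.rpow_pos_of_pos hτ.1 α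
    rw [norm_smul, Real.norm_eq_abs]
    have h2 : ‖v (τ ^ α * θ)‖ ≤ K * Real.exp (w * θ) := by
      refine (hK _ (by positivity)).trans ?_
      have : τ ^ α * θ ≤ θ :=
        mul_le_of_le_one_left hθ.le (Real.rpow_le_one hτ.1.le hτ.2.le h0.le)
      gcongr
    calc |ψ θ| * ‖v (τ ^ α * θ)‖ ≤ |ψ θ| * (K * Real.exp (w * θ)) := by gcongr
      _ = _ := by ring
  have hinner : ∀ τ ∈ Ioo (0 : ℝ) 1, IntegrableOn (fun θ => ψ θ • v (τ ^ α * θ)) (Ioi 0) := by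
    intro τ hτ
    refine (hIi.const_mul K).mono' (Continuous.aestronglyMeasurable (by fun_prop)) ?_
    filter_upwards [ae_restrict_mem measurableSet_Ioi] with θ hθ
    exact hnormle τ hτ θ hθ
  have hslice : ∀ τ ∈ Ioo (0 : ℝ) 1,
      IntegrableOn (fun θ => ψ (θ * τ ^ (-α)) • v θ) (Ioi 0) := by
    intro τ hτ
    have hτα := Real.rpow_pos_of_pos hτ.1 α
    rw [← mul_zero (τ ^ α), ← integrableOn_Ioi_comp_mul_left_iff _ _ hτα]
    refine (hinner τ hτ).congr_fun (fun θ _ => ?_) measurableSet_Ioi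
    simp only [hcancel τ hτ]
  have hprod : Integrable Φ
      ((volume.restrict (Ioo (0 : ℝ) 1)).prod (volume.restrict (Ioi (0 : ℝ)))) := by
    rw [integrable_prod_iff hΦm]
    constructor
    · filter_upwards [ae_restrict_mem measurableSet_Ioo] with τ hτ
      refine ((hslice τ hτ).smul ((1 - τ) ^ (-α) * τ⁻¹)).congr (Eventually.of_forall fun θ => ?_)
      simp only [hΦ, Pi.smul_apply, smul_smul]
    · have hw := (integrableOn_beta_weight (a := α) (b := 1 - α) h0
        (by linarith)).mul_const (K * I)
      refine hw.mono' hΦm.norm.integral_prod_right' ?_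
      filter_upwards [ae_restrict_mem measurableSet_Ioo] with τ hτ
      have hτ0 := hτ.1
      have hτ1 : 0 < 1 - τ := sub_pos.2 hτ.2
      rw [Real.norm_of_nonneg (integral_nonneg fun _ => norm_nonneg _)]
      have e : ∀ θ, ‖Φ (τ, θ)‖ = ((1 - τ) ^ (-α) * τ⁻¹) *
          (fun θ => ‖ψ (θ * τ ^ (-α)) • v θ‖) θ := by
        intro θ
        simp only [hΦ]
        rw [mul_smul, norm_smul, Real.norm_of_nonneg (by positivity)]
      simp only [e]
      rw [integral_const_mul]
      have e2 := integral_Ioi_comp_rpow_mul α hτ.1 (fun θ => ‖ψ (θ * τ ^ (-α)) • v θ‖)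
      simp only [hcancel τ hτ] at e2
      have e3 : ∫ θ in Ioi (0 : ℝ), ‖ψ (θ * τ ^ (-α)) • v θ‖ =
          τ ^ α * ∫ θ in Ioi (0 : ℝ), ‖ψ θ • v (τ ^ α * θ)‖ := by
        rw [e2, smul_eq_mul, ← mul_assoc, ← Real.rpow_add hτ0]; simp
      rw [e3]
      have e4 : ∫ θ in Ioi (0 : ℝ), ‖ψ θ • v (τ ^ α * θ)‖ ≤ K * I := by
        rw [hI, ← integral_const_mul]
        refine setIntegral_mono_on (hinner τ hτ).norm (hIi.const_mul K) measurableSet_Ioi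
          fun θ hθ => hnormle τ hτ θ hθ
      calc (1 - τ) ^ (-α) * τ⁻¹ * (τ ^ α * ∫ θ in Ioi (0 : ℝ), ‖ψ θ • v (τ ^ α * θ)‖)
          ≤ (1 - τ) ^ (-α) * τ⁻¹ * (τ ^ α * (K * I)) := by gcongr
        _ = (1 - τ) ^ (1 - α - 1) * τ ^ (α - 1) * (K * I) := by
            rw [show 1 - α - 1 = -α by ring, Real.rpow_sub_one hτ0.ne']
            field_simp
  have hL : ∀ τ ∈ Ioo (0 : ℝ) 1, ((1 - τ) ^ (-α) * τ ^ (α - 1)) •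
      ∫ θ in Ioi (0 : ℝ), ψ θ • v (τ ^ α * θ) = ∫ θ in Ioi (0 : ℝ), Φ (τ, θ) := by
    intro τ hτ
    have e2 := integral_Ioi_comp_rpow_mul α hτ.1 (fun θ => ψ (θ * τ ^ (-α)) • v θ)
    simp only [hcancel τ hτ] at e2
    rw [e2]
    simp only [hΦ, mul_smul _ (ψ _)]
    rw [integral_smul, smul_smul]
    congr 1
    rw [mul_assoc, ← Real.rpow_add hτ.1, ← Real.rpow_neg_one]
    congr 2; ring
  rw [setIntegral_congr_fun measurableSet_Ioo hL, integral_integral_swap hprod, ← integral_smul]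
  refine setIntegral_congr_fun measurableSet_Ioi fun θ hθ => ?_
  simp only [hΦ]
  rw [integral_smul_const, smul_smul, ← integral_wright_average h0 h1 hθ]

/-- After Fubini, for fixed θ the integrand is M_α(θ) times the derivative in s of ∫_0^{s^α θ} T. -/
theorem integral_wright_smul_integral {T : ℝ → E} (hT : Continuous T) {K w : ℝ} (hw : 0 ≤ w)
    (hK : ∀ s, 0 < s → ‖T s‖ ≤ K * Real.exp (w * s)) [CompleteSpace E] {t : ℝ} (ht : 0 < t) :
    ∫ s in (0 : ℝ)..t, s ^ (α - 1) •
      ∫ θ in Ioi (0 : ℝ), (α * θ * wrightM α θ) • T (s ^ α * θ) =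
    ∫ θ in Ioi (0 : ℝ), wrightM α θ • ∫ r in (0 : ℝ)..(t ^ α * θ), T r := by
  set Φ : ℝ × ℝ → E := fun q => (q.1 ^ (α - 1) * (α * q.2 * wrightM α q.2)) •
    T (q.1 ^ α * q.2) with hΦ
  have hMc := continuous_wrightM h0 h1
  have hpow : IntegrableOn (fun s : ℝ => s ^ (α - 1)) (Ioc 0 t) := by
    rw [← intervalIntegrable_iff_integrableOn_Ioc_of_le ht.le]
    exact intervalIntegral.intervalIntegrable_rpow' (by linarith)
  have hΦm : AEStronglyMeasurable Φ
      ((volume.restrict (Ioc (0 : ℝ) t)).prod (volume.restrict (Ioi (0 : ℝ)))) := by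
    refine AEStronglyMeasurable.smul ?_ ?_
    · have := hMc.measurable
      exact Measurable.aestronglyMeasurable (by fun_prop)
    · refine (hT.comp (Continuous.mul ?_ continuous_snd)).aestronglyMeasurable
      exact (Real.continuous_rpow_const h0.le).comp continuous_fst
  have hprod : Integrable Φ
      ((volume.restrict (Ioc (0 : ℝ) t)).prod (volume.restrict (Ioi (0 : ℝ)))) := by
    have hb := (hpow.mul_const K).mul_prod
      (integrableOn_exp_mul_abs_density h0 h1 (w * t ^ α))
    refine hb.mono' hΦm ?_
    rw [Measure.prod_restrict]
    filter_upwards [ae_restrict_mem (measurableSet_Ioc.prod measurableSet_Ioi)] with q hq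
    have hs : 0 < q.1 := hq.1.1
    have hst : q.1 ≤ t := hq.1.2
    have hθ : 0 < q.2 := hq.2
    simp only [hΦ]
    rw [norm_smul, norm_mul, Real.norm_of_nonneg (by positivity), Real.norm_eq_abs]
    have h2 : ‖T (q.1 ^ α * q.2)‖ ≤ K * Real.exp (w * t ^ α * q.2) := by
      refine (hK _ (by positivity)).trans ?_
      have hK0 : 0 ≤ K := by
        have := (norm_nonneg _).trans (hK 1 one_pos)
        exact nonneg_of_mul_nonneg_left this (Real.exp_pos _)
      rw [mul_assoc w]
      gcongr
    calc q.1 ^ (α - 1) * |α * q.2 * wrightM α q.2| * ‖T (q.1 ^ α * q.2)‖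
        ≤ q.1 ^ (α - 1) * |α * q.2 * wrightM α q.2| * (K * Real.exp (w * t ^ α * q.2)) := by
          gcongr
      _ = _ := by ring
  have hL : ∀ s, s ^ (α - 1) • ∫ θ in Ioi (0 : ℝ), (α * θ * wrightM α θ) • T (s ^ α * θ) =
      ∫ θ in Ioi (0 : ℝ), Φ (s, θ) := by
    intro s
    simp only [hΦ, mul_smul (s ^ (α - 1))]
    rw [integral_smul]
  rw [intervalIntegral.integral_of_le ht.le]
  simp only [hL]
  rw [integral_integral_swap hprod]
  refine setIntegral_congr_fun measurableSet_Ioi fun θ hθ => ?_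
  have hθ' : 0 < θ := hθ
  have e : ∀ s, Φ (s, θ) = wrightM α θ • ((α * s ^ (α - 1) * θ) • T (s ^ α * θ)) := by
    intro s; simp only [hΦ, smul_smul]; congr 1; ring
  simp only [e]
  rw [integral_smul, ← intervalIntegral.integral_of_le ht.le]
  congr 1
  have hV : ∀ r, HasDerivAt (fun r => ∫ σ in (0 : ℝ)..r, T σ) (T r) r := fun r =>
    intervalIntegral.integral_hasDerivAt_right (hT.intervalIntegrable _ _)
      (hT.stronglyMeasurableAtFilter _ _) hT.continuousAt
  have hcpow : Continuous fun s : ℝ => s ^ α := Real.continuous_rpow_const h0.le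
  rw [intervalIntegral.integral_eq_sub_of_hasDerivAt_of_le ht.le
    (f := fun s => ∫ σ in (0 : ℝ)..(s ^ α * θ), T σ)]
  · simp [Real.zero_rpow h0.ne']
  · have : Continuous fun r => ∫ σ in (0 : ℝ)..r, T σ :=
      continuous_iff_continuousAt.2 fun r => (hV r).continuousAt
    exact (this.comp (hcpow.mul continuous_const)).continuousOn
  · intro s hs
    have h2 : HasDerivAt (fun s : ℝ => s ^ α * θ) (α * s ^ (α - 1) * θ) s :=
      (Real.hasDerivAt_rpow_const (Or.inl hs.1.ne')).mul_const θ
    exact (hV (s ^ α * θ)).scomp s h2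
  · refine IntervalIntegrable.smul_continuousOn ?_ (Continuous.continuousOn (by fun_prop))
    exact ((intervalIntegral.intervalIntegrable_rpow' (by linarith)).const_mul α).mul_const θ

end Subordination

/-! ### The operator families `opG`, `opE` and their relations. -/

section SubordinateFamily

variable {𝕜 : Type*} [RCLike 𝕜] {E : Type*} [NormedAddCommGroup E] [NormedSpace ℝ E]
  [NormedSpace 𝕜 E] [IsScalarTower ℝ 𝕜 E]

/-- Subordination of a strongly continuous, exponentially bounded family. -/
theorem exists_subordinate {T : ℝ → E →L[𝕜] E} (hT : ∀ x, ContinuousOn (fun t => T t x) (Ici 0))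
    {K w : ℝ} (hK0 : 0 ≤ K) (hw : 0 ≤ w) (hK : ∀ t, 0 ≤ t → ‖T t‖ ≤ K * Real.exp (w * t))
    {h : ℝ → ℝ} (hc : Continuous h)
    (hh : ∀ w, IntegrableOn (fun θ => Real.exp (w * θ) * |h θ|) (Ioi 0)) {α : ℝ} (hα : 0 < α) :
    ∃ G : ℝ → E →L[ℝ] E, (∀ x, ContinuousOn (fun t => G t x) (Ici 0)) ∧
      ∀ t, 0 ≤ t → ∀ x, G t x = ∫ θ in Ioi (0 : ℝ), h θ • T (t ^ α * θ) x := by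
  have hcT : ∀ t, 0 ≤ t → ∀ x, ContinuousOn (fun θ => T (t ^ α * θ) x) (Ioi 0) := by
    intro t ht x
    refine (hT x).comp (by fun_prop) fun θ hθ => ?_
    have hθ' : 0 < θ := hθ
    exact mem_Ici.2 (by positivity)
  have hbd : ∀ b t, 0 ≤ t → t ≤ b → ∀ x, ∀ s, 0 < s →
      ‖T (t ^ α * s) x‖ ≤ (K * ‖x‖) * Real.exp (w * b ^ α * s) := by
    intro b t ht htb x s hs
    refine ((T _).le_opNorm x).trans ?_
    have h1 := hK (t ^ α * s) (by positivity)
    have h2 : K * Real.exp (w * (t ^ α * s)) ≤ K * Real.exp (w * b ^ α * s) := by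
      rw [mul_assoc w]; gcongr
    calc _ ≤ (K * Real.exp (w * b ^ α * s)) * ‖x‖ := by gcongr; exact h1.trans h2
      _ = _ := by ring
  have hint : ∀ t, 0 ≤ t → ∀ x, IntegrableOn (fun θ => h θ • T (t ^ α * θ) x) (Ioi 0) :=
    fun t ht x => integrableOn_smul_of_exp_growth hc hh (hcT t ht x) (hbd t t ht le_rfl x)
  have hex : ∀ t, ∃ S : E →L[ℝ] E, 0 ≤ t → ∀ x, S x = ∫ θ in Ioi (0 : ℝ), h θ • T (t ^ α * θ) x := by
    intro t
    by_cases ht : 0 ≤ t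
    · refine ⟨LinearMap.mkContinuous
        { toFun := fun x => ∫ θ in Ioi (0 : ℝ), h θ • T (t ^ α * θ) x
          map_add' := fun x y => ?_
          map_smul' := fun c x => ?_ }
        (K * ∫ θ in Ioi (0 : ℝ), Real.exp (w * t ^ α * θ) * |h θ|) fun x => ?_, fun _ x => rfl⟩
      · rw [← integral_add (hint t ht x) (hint t ht y)]
        simp only [map_add, smul_add]
      · rw [RingHom.id_apply, ← integral_smul]
        congr 1; ext θ
        rw [(T _).map_smul_of_tower, smul_comm]
      · change ‖∫ θ in Ioi (0 : ℝ), h θ • T (t ^ α * θ) x‖ ≤ _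
        rw [mul_right_comm, ← integral_const_mul]
        refine norm_integral_le_of_norm_le ((hh _).const_mul _) ?_
        filter_upwards [ae_restrict_mem measurableSet_Ioi] with θ hθ
        rw [norm_smul, Real.norm_eq_abs]
        calc |h θ| * ‖T (t ^ α * θ) x‖
            ≤ |h θ| * (K * ‖x‖ * Real.exp (w * t ^ α * θ)) := by
              gcongr; exact hbd t t ht le_rfl x θ hθ
          _ = _ := by ring
    · exact ⟨0, fun h => absurd h ht⟩
  choose G hG using hex
  refine ⟨G, fun x => ?_, hG⟩
  have heq : EqOn (fun t => G t x) (fun t => ∫ θ in Ioi (0 : ℝ), h θ • T (t ^ α * θ) x) (Ici 0) :=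
    fun t ht => hG t ht x
  refine ContinuousOn.congr ?_ heq
  intro t ht
  have ht' : 0 ≤ t := ht
  have hnear : ∀ᶠ s in 𝓝[Ici 0] t, 0 ≤ s ∧ s ≤ t + 1 := by
    filter_upwards [self_mem_nhdsWithin, mem_nhdsWithin_of_mem_nhds
      (Iio_mem_nhds (show t < t + 1 by linarith))] with s hs hs1
    exact ⟨hs, le_of_lt hs1⟩
  refine tendsto_integral_filter_of_dominated_convergence
    (fun θ => (K * ‖x‖) * (Real.exp (w * (t + 1) ^ α * θ) * |h θ|)) ?_ ?_
    ((hh _).const_mul _) ?_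
  · filter_upwards [hnear] with s hs using (hint s hs.1 x).aestronglyMeasurable
  · filter_upwards [hnear] with s hs
    filter_upwards [ae_restrict_mem measurableSet_Ioi] with θ hθ
    rw [norm_smul, Real.norm_eq_abs]
    calc |h θ| * ‖T (s ^ α * θ) x‖
        ≤ |h θ| * (K * ‖x‖ * Real.exp (w * (t + 1) ^ α * θ)) := by
          gcongr; exact hbd (t + 1) s hs.1 hs.2 x θ hθ
      _ = _ := by ring
  · filter_upwards [ae_restrict_mem measurableSet_Ioi] with θ hθ
    have hθ' : 0 < θ := hθ
    have hcp : ContinuousOn (fun s : ℝ => s ^ α * θ) (Ici 0) :=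
      ((Real.continuous_rpow_const hα.le).mul continuous_const).continuousOn
    have hcomp : ContinuousOn (fun s : ℝ => T (s ^ α * θ) x) (Ici 0) := by
      refine (hT x).comp hcp fun s hs => ?_
      have : 0 ≤ s := hs
      exact mem_Ici.2 (by positivity)
    exact (hcomp t ht).const_smul (h θ)

variable {A : E →ₗ.[𝕜] E}

/-- `E_α(t) x = ∫_0^∞ M_α(θ) T(t^α θ) x dθ`, which is the fractional integral of order `1 - α` of
`K_α x`. -/
def opE (A : E →ₗ.[𝕜] E) (α t : ℝ) (x : E) : E :=
  if α = 1 then semigroup A t x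
  else ∫ θ in Ioi (0 : ℝ), wrightM α θ • semigroup A (t ^ α * θ) x

variable [CompleteSpace E] (hT : IsSemigroupGeneratedByNeg A (semigroup A)) {α : ℝ} (h0 : 0 < α)
  (h1 : α ≤ 1)
include hT h0 h1

/-- This packages pointwise integrals as strongly continuous bounded operators, so that the general
convolution lemmas below apply. -/
theorem exists_opG : ∃ G : ℝ → E →L[ℝ] E, (∀ x, ContinuousOn (fun t => G t x) (Ici 0)) ∧
    ∀ t, 0 ≤ t → ∀ x, G t x = opG A α t x := by
  by_cases hα : α = 1
  · refine ⟨fun t => (semigroup A t).restrictScalars ℝ, hT.cont, fun t _ x => ?_⟩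
    simp [opG, hα]
  · have h1' := lt_of_le_of_ne h1 hα
    obtain ⟨K, w, hK0, hw, hK⟩ := hT.exists_norm_le
    obtain ⟨G, hGc, hG⟩ := exists_subordinate hT.cont hK0.le hw hK (continuous_density h0 h1')
      (integrableOn_exp_mul_abs_density h0 h1') h0
    exact ⟨G, hGc, fun t ht x => by rw [hG t ht, opG, if_neg hα]⟩

theorem exists_opE : ∃ G : ℝ → E →L[ℝ] E, (∀ x, ContinuousOn (fun t => G t x) (Ici 0)) ∧
    ∀ t, 0 ≤ t → ∀ x, G t x = opE A α t x := by
  by_cases hα : α = 1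
  · refine ⟨fun t => (semigroup A t).restrictScalars ℝ, hT.cont, fun t _ x => ?_⟩
    simp [opE, hα]
  · have h1' := lt_of_le_of_ne h1 hα
    obtain ⟨K, w, hK0, hw, hK⟩ := hT.exists_norm_le
    obtain ⟨G, hGc, hG⟩ := exists_subordinate hT.cont hK0.le hw hK (continuous_wrightM h0 h1')
      (integrableOn_exp_mul_abs_wrightM h0 h1') h0
    exact ⟨G, hGc, fun t ht x => by rw [hG t ht, opE, if_neg hα]⟩

theorem integrableOn_smul_semigroup {h : ℝ → ℝ} (hc : Continuous h)
    (hh : ∀ w, IntegrableOn (fun θ => Real.exp (w * θ) * |h θ|) (Ioi 0)) {t : ℝ} (ht : 0 ≤ t)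
    (x : E) : IntegrableOn (fun θ => h θ • semigroup A (t ^ α * θ) x) (Ioi 0) := by
  obtain ⟨K, w, hK0, hw, hK⟩ := hT.exists_norm_le
  refine integrableOn_smul_of_exp_growth hc hh (K := K * ‖x‖) (w := w * t ^ α) ?_ ?_
  · refine (hT.cont x).comp (by fun_prop) fun θ hθ => ?_
    have hθ' : 0 < θ := hθ
    exact mem_Ici.2 (by positivity)
  · intro s hs
    calc _ ≤ ‖semigroup A (t ^ α * s)‖ * ‖x‖ := ContinuousLinearMap.le_opNorm _ _
      _ ≤ K * Real.exp (w * (t ^ α * s)) * ‖x‖ := by gcongr; exact hK _ (by positivity)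
      _ = _ := by rw [mul_assoc w]; ring

theorem resolvent_opG {ξ : ℝ} {R : E →L[𝕜] E} (hR : IsResolventAt A ξ R) {t : ℝ} (ht : 0 ≤ t)
    (x : E) : R (opG A α t x) = opG A α t (R x) := by
  by_cases hα : α = 1
  · simp only [opG, if_pos hα]
    exact hT.resolvent_apply hR ht x
  · have h1' := lt_of_le_of_ne h1 hα
    simp only [opG, if_neg hα]
    have := (R.restrictScalars ℝ).integral_comp_comm (integrableOn_smul_semigroup hT h0 h1
      (continuous_density h0 h1') (integrableOn_exp_mul_abs_density h0 h1') ht x)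
    refine this.symm.trans (setIntegral_congr_fun measurableSet_Ioi fun θ hθ => ?_)
    have hθ' : 0 < θ := hθ
    simp only [ContinuousLinearMap.coe_restrictScalars', R.map_smul_of_tower]
    rw [hT.resolvent_apply hR (by positivity)]

theorem resolvent_opE {ξ : ℝ} {R : E →L[𝕜] E} (hR : IsResolventAt A ξ R) {t : ℝ} (ht : 0 ≤ t)
    (x : E) : R (opE A α t x) = opE A α t (R x) := by
  by_cases hα : α = 1
  · simp only [opE, if_pos hα]
    exact hT.resolvent_apply hR ht x
  · have h1' := lt_of_le_of_ne h1 hα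
    simp only [opE, if_neg hα]
    have := (R.restrictScalars ℝ).integral_comp_comm (integrableOn_smul_semigroup hT h0 h1
      (continuous_wrightM h0 h1') (integrableOn_exp_mul_abs_wrightM h0 h1') ht x)
    refine this.symm.trans (setIntegral_congr_fun measurableSet_Ioi fun θ hθ => ?_)
    have hθ' : 0 < θ := hθ
    simp only [ContinuousLinearMap.coe_restrictScalars', R.map_smul_of_tower]
    rw [hT.resolvent_apply hR (by positivity)]

/-- The substitution s = tτ cancels all powers of t outside the semigroup and reduces the claim to
`integral_density_average`. -/
theorem fracInt_opK {t : ℝ} (ht : 0 < t) (x : E) :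
    fracInt (1 - α) 0 (fun s => opK A α s x) t = opE A α t x := by
  by_cases hα : α = 1
  · subst hα
    simp [fracInt, opK, opG, opE]
  have h1' := lt_of_le_of_ne h1 hα
  obtain ⟨K, w, hK0, hw, hK⟩ := hT.exists_norm_le
  rw [fracInt, if_neg (by linarith : 1 - α ≠ 0)]
  simp only [opK, opG, opE, if_neg hα]
  -- The truncation `max η 0` extends the orbit continuously to the whole line without changing it
  -- on the range of integration.
  set v : ℝ → E := fun η => semigroup A (t ^ α * max η 0) x with hv
  have hvc : Continuous v := (hT.cont x).comp_continuous (by fun_prop) fun η =>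
    mem_Ici.2 (by positivity)
  have hvK : ∀ s, 0 < s → ‖v s‖ ≤ (K * ‖x‖) * Real.exp (w * t ^ α * s) := by
    intro s hs
    simp only [hv, max_eq_left hs.le]
    calc _ ≤ ‖semigroup A (t ^ α * s)‖ * ‖x‖ := ContinuousLinearMap.le_opNorm _ _
      _ ≤ K * Real.exp (w * (t ^ α * s)) * ‖x‖ := by gcongr; exact hK _ (by positivity)
      _ = _ := by rw [mul_assoc w]; ring
  have key := integral_density_average h0 h1' hvc (by positivity) hvK
  have hR : ∫ θ in Ioi (0 : ℝ), wrightM α θ • v θ =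
      ∫ θ in Ioi (0 : ℝ), wrightM α θ • semigroup A (t ^ α * θ) x := by
    refine setIntegral_congr_fun measurableSet_Ioi fun θ hθ => ?_
    simp only [hv, max_eq_left (le_of_lt (mem_Ioi.1 hθ))]
  rw [hR] at key
  have hΓ : Real.Gamma (1 - α) ≠ 0 := (Real.Gamma_pos_of_pos (by linarith)).ne'
  rw [inv_smul_eq_iff₀ hΓ, ← key]
  have hs := intervalIntegral.smul_integral_comp_mul_left (a := 0) (b := 1)
    (fun s => (t - s) ^ (1 - α - 1) • s ^ (α - 1) • ∫ θ in Ioi (0 : ℝ),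
      (α * θ * wrightM α θ) • semigroup A (s ^ α * θ) x) t
  rw [mul_zero, mul_one] at hs
  rw [← hs, ← intervalIntegral.integral_smul, intervalIntegral.integral_of_le zero_le_one,
    integral_Ioc_eq_integral_Ioo]
  refine setIntegral_congr_fun measurableSet_Ioo fun τ hτ => ?_
  have hτ1 : 0 < 1 - τ := sub_pos.2 hτ.2
  rw [smul_smul, smul_smul]
  have e1 : t * (t - t * τ) ^ (1 - α - 1) * (t * τ) ^ (α - 1) =
      (1 - τ) ^ (-α) * τ ^ (α - 1) := by
    rw [show t - t * τ = t * (1 - τ) by ring, Real.mul_rpow ht.le hτ1.le,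
      Real.mul_rpow ht.le hτ.1.le, show 1 - α - 1 = -α by ring]
    have : t * t ^ (-α) * t ^ (α - 1) = 1 := by
      nth_rewrite 1 [← Real.rpow_one t]
      rw [← Real.rpow_add ht, ← Real.rpow_add ht, show 1 + -α + (α - 1) = 0 by ring,
        Real.rpow_zero]
    linear_combination ((1 - τ) ^ (-α) * τ ^ (α - 1)) * this
  rw [e1]
  congr 1
  refine setIntegral_congr_fun measurableSet_Ioi fun θ hθ => ?_
  have hθ' : 0 < θ := hθ
  have hτ0 := hτ.1
  rw [hv]
  beta_reduce
  rw [max_eq_left (by positivity), Real.mul_rpow ht.le hτ.1.le, mul_assoc (t ^ α)]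

/-- Subordination of ∫_0^r T(s)y ds = x - T(r)x at r = t^α θ; the term x is reproduced because M_α
has total mass 1. -/
theorem integral_opK_graph {x y : E} (hxy : (x, y) ∈ A.graph) {t : ℝ} (ht : 0 < t) :
    ∫ s in (0 : ℝ)..t, opK A α s y = x - opE A α t x := by
  by_cases hα : α = 1
  · subst hα
    simp only [opK, opG, opE, if_true, sub_self, Real.rpow_zero, one_smul]
    exact hT.integral_graph hxy ht.le
  have h1' := lt_of_le_of_ne h1 hα
  obtain ⟨K, w, hK0, hw, hK⟩ := hT.exists_norm_le
  simp only [opK, opG, opE, if_neg hα]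
  set v : ℝ → E := fun η => semigroup A (max η 0) y with hv
  have hvc : Continuous v := (hT.cont y).comp_continuous (by fun_prop) fun η =>
    mem_Ici.2 (by positivity)
  have hvK : ∀ s, 0 < s → ‖v s‖ ≤ (K * ‖y‖) * Real.exp (w * s) := by
    intro s hs
    simp only [hv, max_eq_left hs.le]
    calc _ ≤ ‖semigroup A s‖ * ‖y‖ := ContinuousLinearMap.le_opNorm _ _
      _ ≤ K * Real.exp (w * s) * ‖y‖ := by gcongr; exact hK _ hs.le
      _ = _ := by ring
  have key := integral_wright_smul_integral h0 h1' hvc hw hvK ht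
  have hL : ∫ s in (0 : ℝ)..t, s ^ (α - 1) • ∫ θ in Ioi (0 : ℝ),
      (α * θ * wrightM α θ) • semigroup A (s ^ α * θ) y =
      ∫ s in (0 : ℝ)..t, s ^ (α - 1) • ∫ θ in Ioi (0 : ℝ),
      (α * θ * wrightM α θ) • v (s ^ α * θ) := by
    refine intervalIntegral.integral_congr fun s hs => ?_
    rw [uIcc_of_le ht.le] at hs
    have hs0 := hs.1
    congr 1
    refine setIntegral_congr_fun measurableSet_Ioi fun θ hθ => ?_
    have hθ' : 0 < θ := hθ
    simp only [hv]
    rw [max_eq_left (by positivity)]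
  rw [hL, key]
  have hRR : ∀ θ ∈ Ioi (0 : ℝ), wrightM α θ • ∫ r in (0 : ℝ)..(t ^ α * θ), v r =
      wrightM α θ • x - wrightM α θ • semigroup A (t ^ α * θ) x := by
    intro θ hθ
    have hθ' : 0 < θ := hθ
    rw [← smul_sub, ← hT.integral_graph hxy (by positivity)]
    congr 1
    refine intervalIntegral.integral_congr fun s hs => ?_
    rw [uIcc_of_le (by positivity)] at hs
    simp only [hv]
    rw [max_eq_left hs.1]
  rw [setIntegral_congr_fun measurableSet_Ioi hRR, integral_sub, integral_smul_const,
    integral_wrightM h0 h1', one_smul]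
  · have := integrableOn_exp_mul_abs_wrightM h0 h1' 0
    simp only [zero_mul, Real.exp_zero, one_mul] at this
    refine Integrable.smul_const ?_ x
    exact (integrable_norm_iff (continuous_wrightM h0 h1').aestronglyMeasurable).1 this
  · exact integrableOn_smul_semigroup hT h0 h1 (continuous_wrightM h0 h1')
      (integrableOn_exp_mul_abs_wrightM h0 h1') ht.le x

end SubordinateFamily

/-! ### Convolutions of a weakly singular power with a strongly continuous family. -/

theorem intervalIntegrable_sub_rpow {b : ℝ} (hb : 0 < b) (c d t : ℝ) :
    IntervalIntegrable (fun s => (t - s) ^ (b - 1)) volume c d := by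
  have := (intervalIntegral.intervalIntegrable_rpow' (a := t - c) (b := t - d)
    (r := b - 1) (by linarith)).comp_sub_left t
  simpa using this

section StronglyContinuous

variable {E : Type*} [NormedAddCommGroup E] [NormedSpace ℝ E] [CompleteSpace E]
  {G : ℝ → E →L[ℝ] E} (hG : ∀ x, ContinuousOn (fun t => G t x) (Ici 0))
include hG

theorem exists_norm_le_of_strongly_continuous (b : ℝ) :
    ∃ C, 0 ≤ C ∧ ∀ t, 0 ≤ t → t ≤ b → ‖G t‖ ≤ C := by
  obtain ⟨C, hC⟩ : ∃ C, ∀ i : Icc (0 : ℝ) b, ‖G i‖ ≤ C := by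
    refine banach_steinhaus fun x => ?_
    obtain ⟨C, hC⟩ := isCompact_Icc.exists_bound_of_continuousOn
      ((hG x).mono (fun t (ht : t ∈ Icc (0 : ℝ) b) => ht.1))
    exact ⟨C, fun i => hC i i.2⟩
  exact ⟨max C 0, le_max_right _ _, fun t h0 hb => (hC ⟨t, h0, hb⟩).trans (le_max_left _ _)⟩

/-- Strong continuity together with local boundedness (Banach-Steinhaus) gives joint continuity. It
provides measurability of `G` applied to a merely measurable function. -/
theorem continuous_uncurry_max : Continuous fun q : ℝ × E => G (max q.1 0) q.2 := by
  rw [continuous_iff_continuousAt]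
  rintro ⟨t, x⟩
  obtain ⟨C, hC0, hC⟩ := exists_norm_le_of_strongly_continuous hG (max t 0 + 1)
  have h1 : Tendsto (fun q : ℝ × E => G (max q.1 0) x) (𝓝 (t, x)) (𝓝 (G (max t 0) x)) := by
    have : Continuous fun s : ℝ => G (max s 0) x :=
      (hG x).comp_continuous (by fun_prop) fun s => mem_Ici.2 (le_max_right s 0)
    exact (this.comp continuous_fst).tendsto (t, x)
  have h2 : Tendsto (fun q : ℝ × E => G (max q.1 0) (q.2 - x)) (𝓝 (t, x)) (𝓝 0) := by
    refine squeeze_zero_norm' (a := fun q : ℝ × E => C * ‖q.2 - x‖) ?_ ?_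
    · have hev : ∀ᶠ q : ℝ × E in 𝓝 (t, x), max q.1 0 < max t 0 + 1 :=
        (continuous_fst.max continuous_const).continuousAt.eventually_lt
          continuousAt_const (by simp)
      filter_upwards [hev] with q hq
      exact ((G _).le_opNorm _).trans (by gcongr; exact hC _ (le_max_right _ _) hq.le)
    · have : Continuous fun q : ℝ × E => C * ‖q.2 - x‖ := by fun_prop
      simpa using this.tendsto (t, x)
  have h3 := h1.add h2
  simp only [add_zero] at h3
  refine h3.congr fun q => ?_
  rw [map_sub]; abel

theorem aestronglyMeasurable_apply {X : Type*} [MeasurableSpace X] {μ : Measure X} {f : X → ℝ}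
    {w : X → E} (hf : AEStronglyMeasurable f μ) (hw : AEStronglyMeasurable w μ) :
    AEStronglyMeasurable (fun x => G (max (f x) 0) (w x)) μ :=
  (continuous_uncurry_max hG).comp_aestronglyMeasurable (hf.prodMk hw)

theorem aestronglyMeasurable_conv {b c t : ℝ} {w : ℝ → E}
    (hw : AEStronglyMeasurable w (volume.restrict (Ioc c t))) :
    AEStronglyMeasurable (fun s => (t - s) ^ (b - 1) • G (t - s) (w s))
      (volume.restrict (Ioc c t)) := by
  have h1 : AEStronglyMeasurable (fun s => (t - s) ^ (b - 1) • G (max (t - s) 0) (w s))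
      (volume.restrict (Ioc c t)) := by
    refine AEStronglyMeasurable.smul ?_ (aestronglyMeasurable_apply hG ?_ hw)
    · exact (Measurable.aestronglyMeasurable (by fun_prop))
    · exact (Measurable.aestronglyMeasurable (by fun_prop))
  refine h1.congr ?_
  filter_upwards [ae_restrict_mem measurableSet_Ioc] with s hs
  rw [max_eq_left (sub_nonneg.2 hs.2)]

theorem intervalIntegrable_conv {b c t N : ℝ} (hb : 0 < b) (hct : c ≤ t) {w : ℝ → E}
    (hw : AEStronglyMeasurable w (volume.restrict (Ioc c t))) (hN : ∀ s ∈ Ioc c t, ‖w s‖ ≤ N) :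
    IntervalIntegrable (fun s => (t - s) ^ (b - 1) • G (t - s) (w s)) volume c t := by
  obtain ⟨C, hC0, hC⟩ := exists_norm_le_of_strongly_continuous hG (t - c)
  rw [intervalIntegrable_iff_integrableOn_Ioc_of_le hct]
  have h1 : IntegrableOn (fun s => (t - s) ^ (b - 1)) (Ioc c t) := by
    rw [← intervalIntegrable_iff_integrableOn_Ioc_of_le hct]
    exact intervalIntegrable_sub_rpow hb c t t
  refine (h1.mul_const (C * N)).mono' (aestronglyMeasurable_conv hG hw) ?_
  filter_upwards [ae_restrict_mem measurableSet_Ioc] with s hs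
  have hs0 := sub_nonneg.2 hs.2
  rw [norm_smul, Real.norm_of_nonneg (by positivity)]
  gcongr
  exact ((G _).le_opNorm _).trans
    (mul_le_mul (hC _ hs0 (by linarith [hs.1])) (hN s hs) (norm_nonneg _) hC0)

/-- Cutting the integral off at t - ε leaves a bounded kernel, for which dominated convergence gives
continuity. The removed piece is at most CNε^b/b uniformly in t. -/
theorem continuousOn_conv {b c T N : ℝ} (hb : 0 < b) (hb1 : b ≤ 1) {w : ℝ → E}
    (hw : AEStronglyMeasurable w (volume.restrict (Ioc c T))) (hN : ∀ s ∈ Ioc c T, ‖w s‖ ≤ N)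
    (hN0 : 0 ≤ N) :
    ContinuousOn (fun t => ∫ s in c..t, (t - s) ^ (b - 1) • G (t - s) (w s)) (Icc c T) := by
  obtain ⟨C, hC0, hC⟩ := exists_norm_le_of_strongly_continuous hG (T - c)
  have hsub : ∀ {t}, t ∈ Icc c T → Ioc c t ⊆ Ioc c T := fun ht => Ioc_subset_Ioc_right ht.2
  have hint : ∀ t ∈ Icc c T,
      IntervalIntegrable (fun s => (t - s) ^ (b - 1) • G (t - s) (w s)) volume c t := fun t ht =>
    intervalIntegrable_conv hG hb ht.1 (hw.mono_set (hsub ht)) fun s hs => hN s (hsub ht hs)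
  have happ : ∀ ε > 0, ContinuousOn
      (fun t => ∫ s in c..(max c (t - ε)), (t - s) ^ (b - 1) • G (t - s) (w s)) (Icc c T) := by
    intro ε hε
    have hm : ∀ t ∈ Icc c T, max c (t - ε) ≤ t := fun t ht => max_le ht.1 (by linarith)
    have heq : EqOn (fun t => ∫ s in c..(max c (t - ε)), (t - s) ^ (b - 1) • G (t - s) (w s))
        (fun t => ∫ s in Ioc c T, (Ioc c (max c (t - ε))).indicator
          (fun s => (t - s) ^ (b - 1) • G (t - s) (w s)) s) (Icc c T) := by
      intro t ht
      simp only
      rw [intervalIntegral.integral_of_le (le_max_left _ _), setIntegral_indicator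
        measurableSet_Ioc, inter_eq_right.2 (Ioc_subset_Ioc_right ((hm t ht).trans ht.2))]
    refine ContinuousOn.congr ?_ heq
    intro t₀ ht₀
    refine continuousWithinAt_of_dominated (bound := fun _ => ε ^ (b - 1) * (C * N)) ?_ ?_
      ?_ ?_
    · filter_upwards [self_mem_nhdsWithin] with t ht
      rw [aestronglyMeasurable_indicator_iff measurableSet_Ioc,
        Measure.restrict_restrict measurableSet_Ioc,
        inter_eq_left.2 (Ioc_subset_Ioc_right ((hm t ht).trans ht.2))]
      exact (aestronglyMeasurable_conv hG (hw.mono_set (hsub ht))).mono_set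
        (Ioc_subset_Ioc_right (hm t ht))
    · filter_upwards [self_mem_nhdsWithin] with t ht
      filter_upwards [ae_restrict_mem measurableSet_Ioc] with s hs
      by_cases hst : s ∈ Ioc c (max c (t - ε))
      · rw [indicator_of_mem hst]
        have hs1 : s ≤ t - ε := by
          rcases le_max_iff.1 hst.2 with h | h
          · exact absurd hs.1 (not_lt.2 h)
          · exact h
        have hs0 : 0 ≤ t - s := by linarith
        rw [norm_smul, Real.norm_of_nonneg (by positivity)]
        refine mul_le_mul (Real.rpow_le_rpow_of_nonpos hε (by linarith) (by linarith)) ?_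
          (norm_nonneg _) (by positivity)
        exact ((G _).le_opNorm _).trans
          (mul_le_mul (hC _ hs0 (by linarith [hs.1, ht.2])) (hN s hs) (norm_nonneg _) hC0)
      · rw [indicator_of_notMem hst, norm_zero]; positivity
    · exact integrable_const _
    -- The indicator jumps, as a function of t at t₀, only for s equal to the cut-off point, which
    -- is a null set.
    · have hne : ∀ᵐ s : ℝ ∂(volume.restrict (Ioc c T)), s ≠ max c (t₀ - ε) :=
        ae_restrict_of_ae (Measure.ae_ne volume _)
      filter_upwards [ae_restrict_mem measurableSet_Ioc, hne] with s hs hsne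
      have hcm : ContinuousAt (fun t => max c (t - ε)) t₀ := by fun_prop
      rcases lt_or_gt_of_ne hsne with h | h
      · have hs1 : s < t₀ - ε := by
          rcases lt_max_iff.1 h with h | h
          · exact absurd hs.1 (not_lt.2 h.le)
          · exact h
        have hev : ∀ᶠ t in 𝓝[Icc c T] t₀, s < max c (t - ε) :=
          (hcm.eventually_const_lt h).filter_mono nhdsWithin_le_nhds
        have hev2 : ∀ᶠ t in 𝓝[Icc c T] t₀, s < t := by
          refine (eventually_gt_nhds ?_).filter_mono nhdsWithin_le_nhds
          linarith
        have hcont : ContinuousAt (fun t => (t - s) ^ (b - 1) • G (max (t - s) 0) (w s)) t₀ := by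
          refine ContinuousAt.smul ?_ ?_
          · exact ContinuousAt.rpow_const (by fun_prop) (Or.inl (by linarith))
          · have : Continuous fun t => G (max (t - s) 0) (w s) :=
              (continuous_uncurry_max hG).comp (by fun_prop : Continuous fun t => (t - s, w s))
            exact this.continuousAt
        refine hcont.continuousWithinAt.congr_of_eventuallyEq ?_ ?_
        · filter_upwards [hev, hev2] with t h1 h2
          rw [indicator_of_mem (show s ∈ Ioc c (max c (t - ε)) from ⟨hs.1, h1.le⟩), max_eq_left (by linarith)]
        · rw [indicator_of_mem (show s ∈ Ioc c (max c (t₀ - ε)) from ⟨hs.1, h.le⟩), max_eq_left (by linarith)]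
      · have hev : ∀ᶠ t in 𝓝[Icc c T] t₀, max c (t - ε) < s :=
          (hcm.eventually_lt_const h).filter_mono nhdsWithin_le_nhds
        refine (continuousWithinAt_const (b := (0 : E))).congr_of_eventuallyEq ?_ ?_
        · filter_upwards [hev] with t h1
          exact indicator_of_notMem (fun h2 => absurd h2.2 (not_le.2 h1)) _
        · exact indicator_of_notMem (fun h2 => absurd h2.2 (not_le.2 h)) _
  refine continuousOn_of_uniform_approx_of_continuousOn fun u hu => ?_
  obtain ⟨δ, hδ, hδu⟩ := Metric.mem_uniformity_dist.1 hu
  obtain ⟨ε, hε, hεδ⟩ : ∃ ε > 0, C * N * (ε ^ b / b) < δ := by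
    have hcont : Continuous fun ε : ℝ => C * N * (ε ^ b / b) :=
      continuous_const.mul ((Real.continuous_rpow_const hb.le).div_const b)
    have h0 : Tendsto (fun ε : ℝ => C * N * (ε ^ b / b)) (𝓝[>] 0) (𝓝 0) := by
      have := (hcont.tendsto 0).mono_left (nhdsWithin_le_nhds (s := Ioi 0))
      simpa [Real.zero_rpow hb.ne'] using this
    have := (h0.eventually_lt_const hδ).and self_mem_nhdsWithin
    obtain ⟨ε, h1, h2⟩ := this.exists
    exact ⟨ε, h2, h1⟩
  refine ⟨_, happ ε hε, fun t ht => hδu ?_⟩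
  have hm1 : c ≤ max c (t - ε) := le_max_left _ _
  have hm2 : max c (t - ε) ≤ t := max_le ht.1 (by linarith)
  have hi1 := (hint t ht).mono_set (by
    rw [uIcc_of_le hm1, uIcc_of_le ht.1]; exact Icc_subset_Icc_right hm2 :
    uIcc c (max c (t - ε)) ⊆ uIcc c t)
  have hi2 := (hint t ht).mono_set (by
    rw [uIcc_of_le hm2, uIcc_of_le ht.1]; exact Icc_subset_Icc_left hm1 :
    uIcc (max c (t - ε)) t ⊆ uIcc c t)
  rw [dist_eq_norm, ← intervalIntegral.integral_add_adjacent_intervals hi1 hi2,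
    add_sub_cancel_left]
  refine lt_of_le_of_lt ?_ hεδ
  set m := max c (t - ε) with hm
  have hbd : ‖∫ s in m..t, (t - s) ^ (b - 1) • G (t - s) (w s)‖ ≤
      ∫ s in m..t, C * N * (t - s) ^ (b - 1) := by
    refine intervalIntegral.norm_integral_le_of_norm_le hm2 ?_
      ((intervalIntegrable_sub_rpow hb m t t).const_mul _)
    refine Eventually.of_forall fun s hs => ?_
    have hs0 := sub_nonneg.2 hs.2
    have hsc : c < s := lt_of_le_of_lt hm1 hs.1
    rw [norm_smul, Real.norm_of_nonneg (by positivity), mul_comm]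
    gcongr
    exact ((G _).le_opNorm _).trans (mul_le_mul (hC _ hs0 (by linarith [ht.2]))
      (hN s ⟨hsc, hs.2.trans ht.2⟩) (norm_nonneg _) hC0)
  refine hbd.trans ?_
  rw [intervalIntegral.integral_const_mul]
  gcongr
  rw [intervalIntegral.integral_comp_sub_left (fun s => s ^ (b - 1)), sub_self,
    integral_rpow (Or.inl (by linarith))]
  simp only [sub_add_cancel, Real.zero_rpow hb.ne', sub_zero]
  gcongr
  linarith [le_max_right c (t - ε)]

end StronglyContinuous

/-! ### Beta integrals and Fubini's theorem on a triangle. -/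

theorem integral_beta_kernel {a b r t : ℝ} (ha : 0 < a) (hb : 0 < b) (hrt : r < t) :
    ∫ s in r..t, (t - s) ^ (b - 1) * (s - r) ^ (a - 1) =
      (t - r) ^ (a + b - 1) * (Real.Gamma a * Real.Gamma b / Real.Gamma (a + b)) := by
  have h1 := Complex.betaIntegral_scaled a b (sub_pos.2 hrt)
  have h2 := Complex.Gamma_mul_Gamma_eq_betaIntegral (s := a) (t := b) (by simpa) (by simpa)
  have hG : Complex.Gamma (a + b) ≠ 0 := by
    rw [← Complex.ofReal_add, Complex.Gamma_ofReal]
    exact_mod_cast (Real.Gamma_pos_of_pos (add_pos ha hb)).ne'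
  have h3 : ∫ s in r..t, (t - s) ^ (b - 1) * (s - r) ^ (a - 1) =
      ∫ x in (0 : ℝ)..(t - r), (t - r - x) ^ (b - 1) * x ^ (a - 1) := by
    have := intervalIntegral.integral_comp_sub_right (a := r) (b := t)
      (fun x => (t - r - x) ^ (b - 1) * x ^ (a - 1)) r
    rw [sub_self] at this
    rw [← this]
    simp only [sub_sub_sub_cancel_right]
  rw [h3]
  have h4 : ∫ x in (0 : ℝ)..(t - r), (x : ℂ) ^ ((a : ℂ) - 1) * (((t - r : ℝ) : ℂ) - x) ^ ((b : ℂ) - 1)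
      = ((∫ x in (0 : ℝ)..(t - r), (t - r - x) ^ (b - 1) * x ^ (a - 1) : ℝ) : ℂ) := by
    rw [← intervalIntegral.integral_ofReal]
    refine intervalIntegral.integral_congr fun x hx => ?_
    rw [uIcc_of_le (sub_pos.2 hrt).le] at hx
    simp only [Complex.ofReal_mul]
    rw [Complex.ofReal_cpow hx.1, Complex.ofReal_cpow (sub_nonneg.2 hx.2)]
    push_cast
    ring
  rw [h4] at h1
  apply Complex.ofReal_injective
  rw [h1, Complex.ofReal_mul, Complex.ofReal_cpow (sub_pos.2 hrt).le]
  push_cast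
  rw [← Complex.Gamma_ofReal, ← Complex.Gamma_ofReal, ← Complex.Gamma_ofReal]
  push_cast
  rw [h2, mul_div_cancel_left₀ _ hG]

theorem intervalIntegrable_beta_kernel {a b r t : ℝ} (ha : 0 < a) (hb : 0 < b) (hrt : r ≤ t) :
    IntervalIntegrable (fun s => (t - s) ^ (b - 1) * (s - r) ^ (a - 1)) volume r t := by
  rcases hrt.eq_or_lt with rfl | hrt
  · exact IntervalIntegrable.refl
  -- A non-integrable function has integral 0, whereas the Beta integral is positive.
  refine intervalIntegral.intervalIntegrable_of_integral_ne_zero ?_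
  rw [integral_beta_kernel ha hb hrt]
  have := Real.Gamma_pos_of_pos ha
  have := Real.Gamma_pos_of_pos hb
  have := Real.Gamma_pos_of_pos (add_pos ha hb)
  have := sub_pos.2 hrt
  positivity

section Triangle

variable {E : Type*} [NormedAddCommGroup E] [NormedSpace ℝ E]

theorem setIntegral_triangle {c t s : ℝ} (hs : s ∈ Ioc c t) (F : ℝ → E) :
    ∫ r in Ioc c t, (Iio s).indicator F r = ∫ r in c..s, F r := by
  rw [setIntegral_indicator measurableSet_Iio, intervalIntegral.integral_of_le hs.1.le,
    integral_Ioc_eq_integral_Ioo]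
  congr 2
  ext r
  simp only [mem_inter_iff, mem_Ioc, mem_Iio, mem_Ioo]
  exact ⟨fun h => ⟨h.1.1, h.2⟩, fun h => ⟨⟨h.1, h.2.le.trans hs.2⟩, h.2⟩⟩

theorem setIntegral_triangle' {c t r : ℝ} (hr : r ∈ Ioc c t) (F : ℝ → E) :
    ∫ s in Ioc c t, (Ioi r).indicator F s = ∫ s in r..t, F s := by
  rw [setIntegral_indicator measurableSet_Ioi, intervalIntegral.integral_of_le hr.2]
  congr 2
  ext s
  simp only [mem_inter_iff, mem_Ioc, mem_Ioi]
  exact ⟨fun h => ⟨h.2, h.1.2⟩, fun h => ⟨⟨hr.1.trans h.1, h.2⟩, h.1⟩⟩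

/-- Interchange of the order of integration over a triangle. -/
theorem integral_triangle_swap {c t : ℝ} (hct : c ≤ t) {F : ℝ → ℝ → E}
    (hF : Integrable ({q : ℝ × ℝ | q.2 < q.1}.indicator fun q => F q.1 q.2)
      ((volume.restrict (Ioc c t)).prod (volume.restrict (Ioc c t)))) :
    ∫ s in c..t, ∫ r in c..s, F s r = ∫ r in c..t, ∫ s in r..t, F s r := by
  have h := integral_integral_swap (f := fun s r =>
    {q : ℝ × ℝ | q.2 < q.1}.indicator (fun q => F q.1 q.2) (s, r)) hF
  rw [intervalIntegral.integral_of_le hct, intervalIntegral.integral_of_le hct]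
  convert! h using 1
  · exact setIntegral_congr_fun measurableSet_Ioc fun s hs => (setIntegral_triangle hs _).symm
  · exact setIntegral_congr_fun measurableSet_Ioc fun r hr => (setIntegral_triangle' hr _).symm

/-- A criterion for integrability over a triangle, by comparison with a product of powers. -/
theorem integrable_triangle {a b c t : ℝ} (ha : 0 < a) (hb : 0 < b) {F : ℝ → ℝ → E} {g : ℝ → ℝ}
    (hg : AEStronglyMeasurable g (volume.restrict (Ioc c t)))
    (hgi : IntegrableOn (fun r => (t - r) ^ (a + b - 1) * g r) (Ioc c t))
    (hF : AEStronglyMeasurable ({q : ℝ × ℝ | q.2 < q.1}.indicator fun q => F q.1 q.2)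
      ((volume.restrict (Ioc c t)).prod (volume.restrict (Ioc c t))))
    (hbd : ∀ s r, c < r → r < s → s ≤ t →
      ‖F s r‖ ≤ (t - s) ^ (b - 1) * (s - r) ^ (a - 1) * g r) :
    Integrable ({q : ℝ × ℝ | q.2 < q.1}.indicator fun q => F q.1 q.2)
      ((volume.restrict (Ioc c t)).prod (volume.restrict (Ioc c t))) := by
  have hS : MeasurableSet {q : ℝ × ℝ | q.2 < q.1} := measurableSet_lt measurable_snd measurable_fst
  have hm : AEStronglyMeasurable ({q : ℝ × ℝ | q.2 < q.1}.indicator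
      fun q => (t - q.1) ^ (b - 1) * (q.1 - q.2) ^ (a - 1) * g q.2)
      ((volume.restrict (Ioc c t)).prod (volume.restrict (Ioc c t))) := by
    refine AEStronglyMeasurable.indicator ?_ hS
    refine AEStronglyMeasurable.mul ?_ hg.comp_snd
    exact Measurable.aestronglyMeasurable (by fun_prop)
  have hslice : ∀ r ∈ Ioc c t, ∀ (s : ℝ), {q : ℝ × ℝ | q.2 < q.1}.indicator
      (fun q => (t - q.1) ^ (b - 1) * (q.1 - q.2) ^ (a - 1) * g q.2) (s, r) =
      (Ioi r).indicator (fun s => (t - s) ^ (b - 1) * (s - r) ^ (a - 1) * g r) s :=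
    fun r hr s => rfl
  have hH : Integrable ({q : ℝ × ℝ | q.2 < q.1}.indicator
      fun q => (t - q.1) ^ (b - 1) * (q.1 - q.2) ^ (a - 1) * g q.2)
      ((volume.restrict (Ioc c t)).prod (volume.restrict (Ioc c t))) := by
    rw [integrable_prod_iff' hm]
    constructor
    · filter_upwards [ae_restrict_mem measurableSet_Ioc] with r hr
      change IntegrableOn ((Ioi r).indicator
        (fun s => (t - s) ^ (b - 1) * (s - r) ^ (a - 1) * g r)) (Ioc c t)
      have := (intervalIntegrable_iff_integrableOn_Ioc_of_le hr.2).1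
        ((intervalIntegrable_beta_kernel ha hb hr.2).mul_const (g r))
      have h2 := this.integrable_indicator measurableSet_Ioc
      refine (h2.integrableOn (s := Ioc c t)).congr_fun (fun s hs => ?_) measurableSet_Ioc
      by_cases hrs : r < s
      · rw [indicator_of_mem (show s ∈ Ioi r from hrs),
          indicator_of_mem (show s ∈ Ioc r t from ⟨hrs, hs.2⟩)]
      · rw [indicator_of_notMem (show s ∉ Ioi r from hrs),
          indicator_of_notMem (show s ∉ Ioc r t from fun h => hrs h.1)]
    · have hK := (hgi.norm.const_mul (Real.Gamma a * Real.Gamma b / Real.Gamma (a + b)))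
      refine hK.congr ?_
      have hne : ∀ᵐ r : ℝ ∂(volume.restrict (Ioc c t)), r ≠ t :=
        ae_restrict_of_ae (Measure.ae_ne volume _)
      filter_upwards [ae_restrict_mem measurableSet_Ioc, hne] with r hr hrt
      have hrt' : r < t := lt_of_le_of_ne hr.2 hrt
      have e : ∀ s, ‖{q : ℝ × ℝ | q.2 < q.1}.indicator
          (fun q => (t - q.1) ^ (b - 1) * (q.1 - q.2) ^ (a - 1) * g q.2) (s, r)‖ =
          (Ioi r).indicator (fun s => ‖(t - s) ^ (b - 1) * (s - r) ^ (a - 1) * g r‖) s := by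
        intro s
        rw [norm_indicator_eq_indicator_norm]; rfl
      simp only [e]
      rw [setIntegral_triangle' hr]
      have e2 : ∫ s in r..t, ‖(t - s) ^ (b - 1) * (s - r) ^ (a - 1) * g r‖ =
          ∫ s in r..t, (t - s) ^ (b - 1) * (s - r) ^ (a - 1) * ‖g r‖ := by
        refine intervalIntegral.integral_congr fun s hs => ?_
        rw [uIcc_of_le hr.2] at hs
        have := sub_nonneg.2 hs.1
        have := sub_nonneg.2 hs.2
        simp only [norm_mul]
        rw [Real.norm_of_nonneg (by positivity : 0 ≤ (t - s) ^ (b - 1)),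
          Real.norm_of_nonneg (by positivity : 0 ≤ (s - r) ^ (a - 1))]
      rw [e2, intervalIntegral.integral_mul_const, integral_beta_kernel ha hb hrt', norm_mul,
        Real.norm_of_nonneg (by have := sub_pos.2 hrt'; positivity)]
      ring
  refine hH.mono' hF ?_
  rw [Measure.prod_restrict]
  filter_upwards [ae_restrict_mem (measurableSet_Ioc.prod measurableSet_Ioc)] with q hq
  by_cases h : q.2 < q.1
  · rw [indicator_of_mem (show q ∈ {q : ℝ × ℝ | q.2 < q.1} from h),
      indicator_of_mem (show q ∈ {q : ℝ × ℝ | q.2 < q.1} from h)]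
    exact hbd _ _ hq.2.1 h hq.1.2
  · rw [indicator_of_notMem (show q ∉ {q : ℝ × ℝ | q.2 < q.1} from h),
      indicator_of_notMem (show q ∉ {q : ℝ × ℝ | q.2 < q.1} from h), norm_zero]

end Triangle

/-! ### Associativity of convolutions. -/

section ConvolutionFubini

variable {E : Type*} [NormedAddCommGroup E] [NormedSpace ℝ E] [CompleteSpace E]
  {G : ℝ → E →L[ℝ] E} (hG : ∀ x, ContinuousOn (fun t => G t x) (Ici 0))
include hG

/-- Bounded operators pass through the inner integral, and after the swap the inner integral depends
only on t - r. With `G` the identity this underlies the semigroup law of fractional integrals; with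
the family behind `opG` it treats K_α. -/
theorem integral_conv_conv {a b c t : ℝ} (ha : 0 < a) (hb : 0 < b) (hct : c ≤ t) {w : ℝ → E}
    (hw : AEStronglyMeasurable w (volume.restrict (Ioc c t)))
    (hwi : ∀ s ∈ Ioc c t, IntervalIntegrable (fun r => (s - r) ^ (a - 1) • w r) volume c s)
    (hwt : IntegrableOn (fun r => (t - r) ^ (a + b - 1) * ‖w r‖) (Ioc c t)) :
    ∫ s in c..t, (t - s) ^ (b - 1) • G (t - s) (∫ r in c..s, (s - r) ^ (a - 1) • w r) =
      ∫ r in c..t, ∫ σ in (0 : ℝ)..(t - r), (t - r - σ) ^ (a - 1) • σ ^ (b - 1) • G σ (w r) := by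
  obtain ⟨K, hK0, hK⟩ := exists_norm_le_of_strongly_continuous hG (t - c)
  have hint : Integrable ({q : ℝ × ℝ | q.2 < q.1}.indicator fun q =>
      (fun s r => (t - s) ^ (b - 1) • (s - r) ^ (a - 1) • G (t - s) (w r)) q.1 q.2)
      ((volume.restrict (Ioc c t)).prod (volume.restrict (Ioc c t))) := by
    refine integrable_triangle (F := fun s r => (t - s) ^ (b - 1) • (s - r) ^ (a - 1) •
      G (t - s) (w r)) ha hb (g := fun r => K * ‖w r‖) (hw.norm.const_mul K) ?_ ?_ ?_
    · have := Integrable.const_mul hwt K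
      simpa only [mul_left_comm, IntegrableOn] using this
    · refine AEStronglyMeasurable.indicator ?_ (measurableSet_lt measurable_snd measurable_fst)
      have h1 : AEStronglyMeasurable (fun q : ℝ × ℝ =>
          (t - q.1) ^ (b - 1) • (q.1 - q.2) ^ (a - 1) • G (max (t - q.1) 0) (w q.2))
          ((volume.restrict (Ioc c t)).prod (volume.restrict (Ioc c t))) := by
        refine AEStronglyMeasurable.smul (Measurable.aestronglyMeasurable (by fun_prop)) ?_
        refine AEStronglyMeasurable.smul (Measurable.aestronglyMeasurable (by fun_prop)) ?_
        exact aestronglyMeasurable_apply hG (Measurable.aestronglyMeasurable (by fun_prop))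
          hw.comp_snd
      refine h1.congr ?_
      rw [Measure.prod_restrict]
      filter_upwards [ae_restrict_mem (measurableSet_Ioc.prod measurableSet_Ioc)] with q hq
      rw [max_eq_left (sub_nonneg.2 hq.1.2)]
    · intro s r hr hrs hs
      have h1 := sub_nonneg.2 hs
      have h2 := (sub_pos.2 hrs).le
      rw [norm_smul, norm_smul, Real.norm_of_nonneg (by positivity),
        Real.norm_of_nonneg (by positivity), mul_assoc]
      gcongr
      exact ((G _).le_opNorm _).trans (by gcongr; exact hK _ h1 (by linarith))
  have hswap := integral_triangle_swap (F := fun s r => (t - s) ^ (b - 1) • (s - r) ^ (a - 1) •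
    G (t - s) (w r)) hct hint
  have hL : ∫ s in c..t, (t - s) ^ (b - 1) • G (t - s) (∫ r in c..s, (s - r) ^ (a - 1) • w r) =
      ∫ s in c..t, ∫ r in c..s, (t - s) ^ (b - 1) • (s - r) ^ (a - 1) • G (t - s) (w r) := by
    rw [intervalIntegral.integral_of_le hct, intervalIntegral.integral_of_le hct]
    refine setIntegral_congr_fun measurableSet_Ioc fun s hs => ?_
    rw [intervalIntegral.integral_smul,
      ← ContinuousLinearMap.intervalIntegral_comp_comm _ (hwi s hs)]
    simp only [map_smul]
  rw [hL, hswap]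
  refine intervalIntegral.integral_congr fun r _ => ?_
  have h := intervalIntegral.integral_comp_sub_left (a := r) (b := t)
    (fun σ => (t - r - σ) ^ (a - 1) • σ ^ (b - 1) • G σ (w r)) t
  rw [sub_self] at h
  rw [← h]
  refine intervalIntegral.integral_congr fun s _ => ?_
  simp only [sub_sub_sub_cancel_left]
  exact smul_comm _ _ _

theorem integral_integral_conv {b c t : ℝ} (hb : 0 < b) (hct : c ≤ t) {w : ℝ → E}
    (hw : IntegrableOn w (Ioc c t))
    (hwt : IntegrableOn (fun r => (t - r) ^ b * ‖w r‖) (Ioc c t)) :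
    ∫ s in c..t, ∫ r in c..s, (s - r) ^ (b - 1) • G (s - r) (w r) =
      ∫ r in c..t, ∫ σ in (0 : ℝ)..(t - r), σ ^ (b - 1) • G σ (w r) := by
  obtain ⟨K, hK0, hK⟩ := exists_norm_le_of_strongly_continuous hG (t - c)
  have hint : Integrable ({q : ℝ × ℝ | q.2 < q.1}.indicator fun q =>
      (fun s r => (s - r) ^ (b - 1) • G (s - r) (w r)) q.1 q.2)
      ((volume.restrict (Ioc c t)).prod (volume.restrict (Ioc c t))) := by
    refine integrable_triangle (F := fun s r => (s - r) ^ (b - 1) • G (s - r) (w r)) hb one_pos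
      (g := fun r => K * ‖w r‖)
      (hw.aestronglyMeasurable.norm.const_mul K) ?_ ?_ ?_
    · have := Integrable.const_mul hwt K
      simpa only [mul_left_comm, add_sub_cancel_right, IntegrableOn] using this
    · have hS := measurableSet_lt (α := ℝ) measurable_snd measurable_fst
      have h1 : AEStronglyMeasurable ({q : ℝ × ℝ | q.2 < q.1}.indicator fun q : ℝ × ℝ =>
          (q.1 - q.2) ^ (b - 1) • G (max (q.1 - q.2) 0) (w q.2))
          ((volume.restrict (Ioc c t)).prod (volume.restrict (Ioc c t))) := by
        refine AEStronglyMeasurable.indicator ?_ hS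
        refine AEStronglyMeasurable.smul (Measurable.aestronglyMeasurable (by fun_prop)) ?_
        exact aestronglyMeasurable_apply hG (Measurable.aestronglyMeasurable (by fun_prop))
          hw.aestronglyMeasurable.comp_snd
      refine h1.congr (Eventually.of_forall fun q => indicator_congr (fun q hq => ?_) |> congr_fun <| q)
      have hq' : q.2 < q.1 := hq
      rw [max_eq_left (sub_pos.2 hq').le]
    · intro s r hr hrs hs
      have h2 := (sub_pos.2 hrs).le
      rw [norm_smul, Real.norm_of_nonneg (by positivity), sub_self, Real.rpow_zero, one_mul]
      gcongr
      exact ((G _).le_opNorm _).trans (by gcongr; exact hK _ h2 (by linarith))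
  rw [integral_triangle_swap (F := fun s r => (s - r) ^ (b - 1) • G (s - r) (w r)) hct hint]
  refine intervalIntegral.integral_congr fun r _ => ?_
  have h := intervalIntegral.integral_comp_sub_right (a := r) (b := t)
    (fun σ => σ ^ (b - 1) • G σ (w r)) r
  rw [sub_self] at h
  exact h

end ConvolutionFubini

/-! ### Riemann-Liouville integrals and their semigroup law. -/

section FractionalIntegral

variable {E : Type*} [NormedAddCommGroup E] [NormedSpace ℝ E]

theorem fracInt_congr {δ c t : ℝ} (hct : c < t) {v w : ℝ → E} (h : EqOn v w (Ioc c t)) :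
    fracInt δ c v t = fracInt δ c w t := by
  unfold fracInt
  split_ifs
  · exact h ⟨hct, le_rfl⟩
  · rw [intervalIntegral.integral_of_le hct.le, intervalIntegral.integral_of_le hct.le]
    congr 1
    exact setIntegral_congr_fun measurableSet_Ioc fun s hs => by simp only [h hs]

theorem FracIntExists.congr {δ c t : ℝ} (hct : c < t) {v w : ℝ → E} (h : EqOn v w (Ioc c t))
    (hv : FracIntExists δ c v t) : FracIntExists δ c w t := fun hδ => by
  refine (hv hδ).congr_ae ?_
  rw [uIoc_of_le hct.le]
  filter_upwards [ae_restrict_mem measurableSet_Ioc] with s hs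
  rw [h hs]

theorem fracExists_of_bounded {δ c t N : ℝ} (hδ : 0 ≤ δ) (hct : c ≤ t) {w : ℝ → E}
    (hw : AEStronglyMeasurable w (volume.restrict (Ioc c t))) (hN : ∀ s ∈ Ioc c t, ‖w s‖ ≤ N) :
    FracIntExists δ c w t := fun hδ0 => by
  rw [intervalIntegrable_iff_integrableOn_Ioc_of_le hct]
  refine Integrable.smul_bdd ((intervalIntegrable_iff_integrableOn_Ioc_of_le hct).1
    (intervalIntegrable_sub_rpow (lt_of_le_of_ne hδ (Ne.symm hδ0)) c t t)) N hw ?_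
  filter_upwards [ae_restrict_mem measurableSet_Ioc] with s hs using hN s hs

variable [CompleteSpace E]

theorem fracInt_clm {F : Type*} [NormedAddCommGroup F] [NormedSpace ℝ F] [CompleteSpace F]
    (L : E →L[ℝ] F) {δ c t : ℝ} {w : ℝ → E}
    (h : FracIntExists δ c w t) : fracInt δ c (fun s => L (w s)) t = L (fracInt δ c w t) := by
  unfold fracInt
  split_ifs with hδ
  · rfl
  · rw [map_smul, ← L.intervalIntegral_comp_comm (h hδ)]
    simp only [map_smul]

/-- The semigroup law of the Riemann-Liouville integrals. -/
theorem fracInt_fracInt {a b c t : ℝ} (ha : 0 ≤ a) (hb : 0 ≤ b) (hct : c < t) {w : ℝ → E}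
    (hw : AEStronglyMeasurable w (volume.restrict (Ioc c t)))
    (hwi : ∀ s ∈ Ioc c t, FracIntExists a c w s) (hwt : FracIntExists (a + b) c w t) :
    fracInt b c (fracInt a c w) t = fracInt (a + b) c w t := by
  rcases ha.eq_or_lt with rfl | ha
  · rw [zero_add]
    exact fracInt_congr hct fun s _ => by simp [fracInt]
  rcases hb.eq_or_lt with rfl | hb
  · rw [add_zero]; simp [fracInt]
  have hab : a + b ≠ 0 := by positivity
  have h := integral_conv_conv (G := fun _ => ContinuousLinearMap.id ℝ E)
    (fun x => continuousOn_const) ha hb hct.le hw (fun s hs => hwi s hs ha.ne') (by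
      have hi : IntegrableOn (fun s => ‖(t - s) ^ (a + b - 1) • w s‖) (Ioc c t) :=
        ((intervalIntegrable_iff_integrableOn_Ioc_of_le hct.le).1 (hwt hab)).norm
      refine hi.congr_fun (fun s hs => ?_) measurableSet_Ioc
      have := sub_nonneg.2 hs.2
      simp only [norm_smul]
      rw [Real.norm_of_nonneg (by positivity)])
  simp only [ContinuousLinearMap.id_apply] at h
  have h2 : ∫ r in c..t, ∫ σ in (0 : ℝ)..(t - r), (t - r - σ) ^ (a - 1) • σ ^ (b - 1) • w r =
      (Real.Gamma a * Real.Gamma b / Real.Gamma (a + b)) •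
        ∫ r in c..t, (t - r) ^ (a + b - 1) • w r := by
    rw [← intervalIntegral.integral_smul]
    refine intervalIntegral.integral_congr_ae ?_
    filter_upwards [Measure.ae_ne volume t] with r hrt hr
    rw [uIoc_of_le hct.le] at hr
    have hrt' : 0 < t - r := sub_pos.2 (lt_of_le_of_ne hr.2 hrt)
    simp only [smul_smul]
    rw [intervalIntegral.integral_smul_const]
    have := integral_beta_kernel hb ha hrt'
    simp only [sub_zero] at this
    rw [this, add_comm b a]
    congr 1
    ring
  rw [h2] at h
  rw [fracInt, if_neg hb.ne', fracInt, if_neg hab]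
  have h3 : ∫ s in c..t, (t - s) ^ (b - 1) • fracInt a c w s =
      (Real.Gamma a)⁻¹ • ∫ s in c..t, (t - s) ^ (b - 1) • ∫ r in c..s, (s - r) ^ (a - 1) • w r := by
    rw [← intervalIntegral.integral_smul]
    refine intervalIntegral.integral_congr fun s _ => ?_
    simp only [fracInt, if_neg ha.ne']
    exact smul_comm _ _ _
  rw [h3, h, smul_smul, smul_smul]
  have := Real.Gamma_pos_of_pos ha
  have := Real.Gamma_pos_of_pos hb
  have := Real.Gamma_pos_of_pos (add_pos ha hb)
  congr 1
  field_simp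

end FractionalIntegral

theorem eqOn_zero_of_integral_eq_zero {E : Type*} [NormedAddCommGroup E]
    [NormedSpace ℝ E] [CompleteSpace E] {c T : ℝ} (hcT : c < T) {φ : ℝ → E}
    (hφ : ContinuousOn φ (Icc c T)) (h : ∀ t ∈ Ioc c T, ∫ s in c..t, φ s = 0) :
    EqOn φ 0 (Icc c T) := by
  have h1 : EqOn φ 0 (Ioo c T) := by
    intro t ht
    have hnhds : Icc c T ∈ 𝓝 t := Icc_mem_nhds ht.1 ht.2
    have hd : HasDerivAt (fun t => ∫ s in c..t, φ s) (φ t) t := by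
      refine intervalIntegral.integral_hasDerivAt_right ?_ ?_ (hφ.continuousAt hnhds)
      · refine (hφ.mono ?_).intervalIntegrable
        rw [uIcc_of_le ht.1.le]
        exact Icc_subset_Icc_right ht.2.le
      · exact (hφ.mono Ioo_subset_Icc_self).stronglyMeasurableAtFilter isOpen_Ioo t ht
    have h0 : HasDerivAt (fun t => ∫ s in c..t, φ s) 0 t := by
      refine (hasDerivAt_const t (0 : E)).congr_of_eventuallyEq ?_
      filter_upwards [Ioo_mem_nhds ht.1 ht.2] with s hs using h s ⟨hs.1, hs.2.le⟩
    exact hd.unique h0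
  refine h1.of_subset_closure hφ continuousOn_const Ioo_subset_Icc_self ?_
  rw [closure_Ioo hcT.ne]

theorem integrableOn_Ioc_of_norm_le {E : Type*} [NormedAddCommGroup E] {c t N : ℝ} {w : ℝ → E}
    (hw : AEStronglyMeasurable w (volume.restrict (Ioc c t))) (hN : ∀ s ∈ Ioc c t, ‖w s‖ ≤ N) :
    IntegrableOn w (Ioc c t) := by
  refine Integrable.of_bound hw N ?_
  filter_upwards [ae_restrict_mem measurableSet_Ioc] with s hs using hN s hs

theorem integrableOn_rpow_mul_norm {E : Type*} [NormedAddCommGroup E] {α c t : ℝ} (h0 : 0 ≤ α)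
    {w : ℝ → E} (hw : IntegrableOn w (Ioc c t)) :
    IntegrableOn (fun r => (t - r) ^ α * ‖w r‖) (Ioc c t) := by
  have hc : ContinuousOn (fun r : ℝ => (t - r) ^ α) (Icc c t) :=
    ((Real.continuous_rpow_const h0).comp (by fun_prop)).continuousOn
  have hw' : IntegrableOn (fun r => ‖w r‖) (Icc c t) :=
    (integrableOn_Icc_iff_integrableOn_Ioc (by simp)).2 hw.norm
  exact (hw'.continuousOn_mul hc isCompact_Icc).mono_set Ioc_subset_Icc_self

/-! ### Convolution with K_α and the variation of constants formula. -/

section Kernel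

variable {𝕜 : Type*} [RCLike 𝕜] {E : Type*} [NormedAddCommGroup E] [NormedSpace ℝ E]
  [NormedSpace 𝕜 E] [IsScalarTower ℝ 𝕜 E] [CompleteSpace E] {A : E →ₗ.[𝕜] E}
  (hT : IsSemigroupGeneratedByNeg A (semigroup A)) {α : ℝ} (h0 : 0 < α) (h1 : α ≤ 1)
include hT h0 h1

theorem intervalIntegrable_opK {c t N : ℝ} (hct : c ≤ t) {w : ℝ → E}
    (hw : AEStronglyMeasurable w (volume.restrict (Ioc c t))) (hN : ∀ s ∈ Ioc c t, ‖w s‖ ≤ N) :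
    IntervalIntegrable (fun s => opK A α (t - s) (w s)) volume c t := by
  obtain ⟨G, hGc, hG⟩ := exists_opG hT h0 h1
  refine (intervalIntegrable_conv hGc h0 hct hw hN).congr_ae ?_
  rw [uIoc_of_le hct]
  filter_upwards [ae_restrict_mem measurableSet_Ioc] with s hs
  rw [opK, hG _ (sub_nonneg.2 hs.2)]

theorem intervalIntegrable_opE {c t N : ℝ} (hct : c ≤ t) {w : ℝ → E}
    (hw : AEStronglyMeasurable w (volume.restrict (Ioc c t))) (hN : ∀ s ∈ Ioc c t, ‖w s‖ ≤ N) :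
    IntervalIntegrable (fun s => opE A α (t - s) (w s)) volume c t := by
  obtain ⟨G, hGc, hG⟩ := exists_opE hT h0 h1
  refine (intervalIntegrable_conv hGc one_pos hct hw hN).congr_ae ?_
  rw [uIoc_of_le hct]
  filter_upwards [ae_restrict_mem measurableSet_Ioc] with s hs
  rw [hG _ (sub_nonneg.2 hs.2), sub_self, Real.rpow_zero, one_smul]

theorem continuousOn_integral_opK {c T N : ℝ} (hN0 : 0 ≤ N) {w : ℝ → E}
    (hw : AEStronglyMeasurable w (volume.restrict (Ioc c T))) (hN : ∀ s ∈ Ioc c T, ‖w s‖ ≤ N) :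
    ContinuousOn (fun t => ∫ s in c..t, opK A α (t - s) (w s)) (Icc c T) := by
  obtain ⟨G, hGc, hG⟩ := exists_opG hT h0 h1
  refine (continuousOn_conv hGc h0 h1 hw hN hN0).congr fun t ht => ?_
  refine intervalIntegral.integral_congr fun s hs => ?_
  rw [uIcc_of_le ht.1] at hs
  simp only [opK, hG _ (sub_nonneg.2 hs.2)]

/-- Associativity moves the fractional integral from `w` onto the kernel, where I^{1-α}K_α = E_α. -/
theorem integral_opK_fracInt {c t N : ℝ} (hct : c ≤ t) {w : ℝ → E}
    (hw : AEStronglyMeasurable w (volume.restrict (Ioc c t))) (hN : ∀ s ∈ Ioc c t, ‖w s‖ ≤ N) :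
    ∫ s in c..t, opK A α (t - s) (fracInt (1 - α) c w s) =
      ∫ s in c..t, opE A α (t - s) (w s) := by
  by_cases hα : α = 1
  · subst hα
    simp [fracInt, opK, opG, opE]
  obtain ⟨G, hGc, hG⟩ := exists_opG hT h0 h1
  have h1' : 0 < 1 - α := sub_pos.2 (lt_of_le_of_ne h1 hα)
  have hwn : IntegrableOn (fun r => ‖w r‖) (Ioc c t) :=
    (integrableOn_Ioc_of_norm_le hw hN).norm
  have h := integral_conv_conv hGc h1' h0 hct hw
    (fun s hs => fracExists_of_bounded h1'.le hs.1.le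
      (hw.mono_set (Ioc_subset_Ioc_right hs.2)) (fun r hr => hN r ⟨hr.1, hr.2.trans hs.2⟩) h1'.ne')
    (by simpa using hwn)
  have hΓ := (Real.Gamma_pos_of_pos h1').ne'
  have hL : ∫ s in c..t, opK A α (t - s) (fracInt (1 - α) c w s) = (Real.Gamma (1 - α))⁻¹ •
      ∫ s in c..t, (t - s) ^ (α - 1) • G (t - s) (∫ r in c..s, (s - r) ^ (1 - α - 1) • w r) := by
    rw [← intervalIntegral.integral_smul]
    refine intervalIntegral.integral_congr fun s hs => ?_
    rw [uIcc_of_le hct] at hs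
    simp only [opK, fracInt, if_neg h1'.ne', ← hG _ (sub_nonneg.2 hs.2), map_smul]
    exact smul_comm _ _ _
  rw [hL, h, ← intervalIntegral.integral_smul]
  refine intervalIntegral.integral_congr_ae ?_
  filter_upwards [Measure.ae_ne volume t] with r hrt hr
  rw [uIoc_of_le hct] at hr
  have hrt' : 0 < t - r := sub_pos.2 (lt_of_le_of_ne hr.2 hrt)
  rw [← fracInt_opK hT h0 h1 hrt', fracInt, if_neg h1'.ne']
  congr 1
  refine intervalIntegral.integral_congr fun σ hσ => ?_
  rw [uIcc_of_le hrt'.le] at hσ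
  simp only [opK, hG _ hσ.1]

theorem integral_opK_integral {c t N : ℝ} (hct : c ≤ t) {w : ℝ → E}
    (hw : AEStronglyMeasurable w (volume.restrict (Ioc c t))) (hN : ∀ s ∈ Ioc c t, ‖w s‖ ≤ N) :
    ∫ s in c..t, opK A α (t - s) (∫ r in c..s, w r) =
      ∫ s in c..t, ∫ σ in (0 : ℝ)..(t - s), opK A α σ (w s) := by
  obtain ⟨G, hGc, hG⟩ := exists_opG hT h0 h1
  have hwi := integrableOn_Ioc_of_norm_le hw hN
  have hwt := integrableOn_rpow_mul_norm h0.le hwi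
  have h := integral_conv_conv hGc one_pos h0 hct hw (fun s hs => by
      simp only [sub_self, Real.rpow_zero, one_smul]
      rw [intervalIntegrable_iff_integrableOn_Ioc_of_le hs.1.le]
      exact hwi.mono_set (Ioc_subset_Ioc_right hs.2)) (by simpa using hwt)
  simp only [sub_self, Real.rpow_zero, one_smul] at h
  convert! h using 1
  · refine intervalIntegral.integral_congr fun s hs => ?_
    rw [uIcc_of_le hct] at hs
    simp only [opK, hG _ (sub_nonneg.2 hs.2)]
  · refine intervalIntegral.integral_congr fun s hs => ?_
    rw [uIcc_of_le hct] at hs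
    refine intervalIntegral.integral_congr fun σ hσ => ?_
    rw [uIcc_of_le (sub_nonneg.2 hs.2)] at hσ
    simp only [opK, hG _ hσ.1]

/-- Convolution with `K_α` commutes with integration. -/
theorem integral_opK_integral_comm {c t N : ℝ} (hct : c ≤ t) {w : ℝ → E}
    (hw : AEStronglyMeasurable w (volume.restrict (Ioc c t))) (hN : ∀ s ∈ Ioc c t, ‖w s‖ ≤ N) :
    ∫ s in c..t, opK A α (t - s) (∫ r in c..s, w r) =
      ∫ s in c..t, ∫ r in c..s, opK A α (s - r) (w r) := by
  rw [integral_opK_integral hT h0 h1 hct hw hN]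
  obtain ⟨G, hGc, hG⟩ := exists_opG hT h0 h1
  have hwi := integrableOn_Ioc_of_norm_le hw hN
  have hwt := integrableOn_rpow_mul_norm h0.le hwi
  have h := integral_integral_conv hGc h0 hct hwi hwt
  convert! h.symm using 1
  · refine intervalIntegral.integral_congr fun s hs => ?_
    rw [uIcc_of_le hct] at hs
    refine intervalIntegral.integral_congr fun σ hσ => ?_
    rw [uIcc_of_le (sub_nonneg.2 hs.2)] at hσ
    simp only [opK, hG _ hσ.1]
  · refine intervalIntegral.integral_congr fun s hs => ?_
    rw [uIcc_of_le hct] at hs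
    refine intervalIntegral.integral_congr fun σ hσ => ?_
    rw [uIcc_of_le hs.1] at hσ
    simp only [opK, hG _ (sub_nonneg.2 hσ.2)]

/-- The integration is moved onto the kernel, and the primitive of K_α applied to y = Ax is x - E_α
x by `integral_opK_graph`. This is how A leaves the equation. -/
theorem integral_opK_integral_graph {c t N : ℝ} (hct : c ≤ t) {x y : ℝ → E}
    (hxy : ∀ s, (x s, y s) ∈ A.graph)
    (hy : AEStronglyMeasurable y (volume.restrict (Ioc c t))) (hN : ∀ s ∈ Ioc c t, ‖y s‖ ≤ N) :
    ∫ s in c..t, opK A α (t - s) (∫ r in c..s, y r) =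
      ∫ s in c..t, (x s - opE A α (t - s) (x s)) := by
  rw [integral_opK_integral hT h0 h1 hct hy hN]
  refine intervalIntegral.integral_congr_ae ?_
  filter_upwards [Measure.ae_ne volume t] with r hrt hr
  rw [uIoc_of_le hct] at hr
  exact integral_opK_graph hT h0 h1 (hxy r) (sub_pos.2 (lt_of_le_of_ne hr.2 hrt))

theorem opK_sub {t : ℝ} (ht : 0 ≤ t) (x y : E) :
    opK A α t (x - y) = opK A α t x - opK A α t y := by
  obtain ⟨G, -, hG⟩ := exists_opG hT h0 h1
  simp only [opK, ← hG t ht, map_sub, smul_sub]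

/-- The variation of constants formula for the integrated equation. -/
theorem eq_opE_add_integral_opK {ξ : ℝ} {R : E →L[𝕜] E} (hR : IsResolventAt A ξ R)
    {c T N : ℝ} (hcT : c < T) {u g : ℝ → E} (hu : ContinuousOn u (Icc c T)) (hN0 : 0 ≤ N)
    (hg : AEStronglyMeasurable g (volume.restrict (Ioc c T))) (hN : ∀ s ∈ Ioc c T, ‖g s‖ ≤ N)
    (x : E) (heq : ∀ t ∈ Ioc c T, fracInt (1 - α) c (fun s => R (u s) - R x) t =
      ∫ s in c..t, (R (g s) - (u s - ξ • R (u s)))) :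
    ∀ t ∈ Ioc c T, u t = opE A α (t - c) x + ∫ s in c..t, opK A α (t - s) (g s) := by
  obtain ⟨S, hSc, hS⟩ := exists_opE hT h0 h1
  obtain ⟨N', hN'⟩ := isCompact_Icc.exists_bound_of_continuousOn hu
  have hRu : ContinuousOn (fun s => R (u s)) (Icc c T) := R.continuous.comp_continuousOn hu
  have hy : ContinuousOn (fun s => u s - ξ • R (u s)) (Icc c T) := hu.sub (hRu.const_smul ξ)
  obtain ⟨N₁, hN₁⟩ := isCompact_Icc.exists_bound_of_continuousOn hRu
  obtain ⟨N₂, hN₂⟩ := isCompact_Icc.exists_bound_of_continuousOn hy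
  have hRg : AEStronglyMeasurable (fun s => R (g s)) (volume.restrict (Ioc c T)) :=
    R.continuous.comp_aestronglyMeasurable hg
  have hRgN : ∀ s ∈ Ioc c T, ‖R (g s)‖ ≤ ‖R‖ * N := fun s hs =>
    (R.le_opNorm _).trans (by gcongr; exact hN s hs)
  have hRgi := integrableOn_Ioc_of_norm_le hRg hRgN
  have hmeas : ∀ {w : ℝ → E}, ContinuousOn w (Icc c T) → ∀ {t}, t ≤ T →
      AEStronglyMeasurable w (volume.restrict (Ioc c t)) := fun hw t ht =>
    ((hw.mono Ioc_subset_Icc_self).mono (Ioc_subset_Ioc_right ht)).aestronglyMeasurable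
      measurableSet_Ioc
  have hconv := continuousOn_integral_opK hT h0 h1 hN0 hg hN
  have hopE : ∀ z, ContinuousOn (fun t => opE A α (t - c) z) (Icc c T) := by
    intro z
    refine ContinuousOn.congr ((hSc z).comp (t := Ici 0) (s := Icc c T) (f := fun t => t - c)
      (by fun_prop) fun t ht => sub_nonneg.2 ht.1) fun t ht => ?_
    exact (hS _ (sub_nonneg.2 ht.1) z).symm
  have hpos : ∀ t ∈ Ioc c T, ∫ s in c..t,
      R (u s - opE A α (s - c) x - ∫ r in c..s, opK A α (s - r) (g r)) = 0 := by
    intro t ht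
    have hct := ht.1.le
    have hsubI : uIcc c t ⊆ Icc c T := by
      rw [uIcc_of_le hct]; exact Icc_subset_Icc_right ht.2
    have hsub : Ioc c t ⊆ Ioc c T := Ioc_subset_Ioc_right ht.2
    have hsub' : ∀ s ∈ Ioc c t, s ∈ Icc c T := fun s hs => Ioc_subset_Icc_self (hsub hs)
    have hprim : ∀ {w : ℝ → E}, IntegrableOn w (Ioc c T) →
        ContinuousOn (fun s => ∫ r in c..s, w r) (Icc c T) := fun hw =>
      intervalIntegral.continuousOn_primitive_interval
        (by rw [uIcc_of_le hcT.le]; exact (integrableOn_Icc_iff_integrableOn_Ioc (by simp)).2 hw) |>.mono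
        (by rw [uIcc_of_le hcT.le])
    have hyi : IntegrableOn (fun s => u s - ξ • R (u s)) (Ioc c T) :=
      (hy.integrableOn_compact isCompact_Icc).mono_set Ioc_subset_Icc_self
    have hPg := hprim hRgi
    have hPy := hprim hyi
    obtain ⟨N₃, hN₃⟩ := isCompact_Icc.exists_bound_of_continuousOn hPg
    obtain ⟨N₄, hN₄⟩ := isCompact_Icc.exists_bound_of_continuousOn hPy
    -- The integrated equation is convolved with K_α and its right-hand side is split.
    have key : ∫ s in c..t, opK A α (t - s) (fracInt (1 - α) c (fun s => R (u s) - R x) s) =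
        (∫ s in c..t, opK A α (t - s) (∫ r in c..s, R (g r))) -
        ∫ s in c..t, opK A α (t - s) (∫ r in c..s, (u r - ξ • R (u r))) := by
      rw [← intervalIntegral.integral_sub
        (intervalIntegrable_opK hT h0 h1 hct (hmeas hPg ht.2) fun s hs => hN₃ s (hsub' s hs))
        (intervalIntegrable_opK hT h0 h1 hct (hmeas hPy ht.2) fun s hs => hN₄ s (hsub' s hs))]
      rw [intervalIntegral.integral_of_le hct, intervalIntegral.integral_of_le hct]
      refine setIntegral_congr_fun measurableSet_Ioc fun s hs => ?_
      have hs' := hsub hs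
      have hi : ∀ {w : ℝ → E}, IntegrableOn w (Ioc c T) → IntervalIntegrable w volume c s :=
        fun hw => (intervalIntegrable_iff_integrableOn_Ioc_of_le hs.1.le).2
          (hw.mono_set (Ioc_subset_Ioc_right hs'.2))
      rw [heq s hs', intervalIntegral.integral_sub (hi hRgi) (hi hyi),
        opK_sub hT h0 h1 (sub_nonneg.2 hs.2)]
    have hRux : ContinuousOn (fun s => R (u s) - R x) (Icc c T) := hRu.sub continuousOn_const
    obtain ⟨N₅, hN₅⟩ := isCompact_Icc.exists_bound_of_continuousOn hRux
    -- After these rewrites E_α * Ru occurs on both sides. Its cancellation leaves ∫ Ru on one side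
    -- and only terms in `x` and `g` on the other.
    rw [integral_opK_fracInt hT h0 h1 hct (hmeas hRux ht.2) (fun s hs => hN₅ s (hsub' s hs)),
      integral_opK_integral_comm hT h0 h1 hct (hRg.mono_set hsub) (fun s hs => hRgN s (hsub hs)),
      integral_opK_integral_graph hT h0 h1 hct (fun s => hR.mem_graph (u s)) (hmeas hy ht.2)
        (fun s hs => hN₂ s (hsub' s hs))] at key
    have iE := intervalIntegrable_opE hT h0 h1 hct (hmeas hRu ht.2) (fun s hs => hN₁ s (hsub' s hs))
    have iEx := intervalIntegrable_opE hT h0 h1 hct (w := fun _ => R x) (N := ‖R x‖)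
      aestronglyMeasurable_const (fun s hs => le_rfl)
    have iR : IntervalIntegrable (fun s => R (u s)) volume c t :=
      (hRu.mono hsubI).intervalIntegrable
    have e1 : ∫ s in c..t, opE A α (t - s) (R (u s) - R x) =
        (∫ s in c..t, opE A α (t - s) (R (u s))) - ∫ s in c..t, opE A α (s - c) (R x) := by
      have hflip : ∫ s in c..t, opE A α (s - c) (R x) = ∫ s in c..t, opE A α (t - s) (R x) := by
        have a1 := intervalIntegral.integral_comp_sub_left (a := c) (b := t)
          (fun σ => opE A α σ (R x)) t
        have a2 := intervalIntegral.integral_comp_sub_right (a := c) (b := t)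
          (fun σ => opE A α σ (R x)) c
        rw [sub_self] at a1 a2
        exact a2.trans a1.symm
      rw [hflip, ← intervalIntegral.integral_sub iE iEx]
      refine intervalIntegral.integral_congr fun s hs => ?_
      rw [uIcc_of_le hct] at hs
      simp only [← hS _ (sub_nonneg.2 hs.2), map_sub]
    have e2 : ∀ s ∈ Icc c T, (∫ r in c..s, opK A α (s - r) (R (g r))) =
        R (∫ r in c..s, opK A α (s - r) (g r)) := by
      intro s hs
      have hss : Ioc c s ⊆ Ioc c T := Ioc_subset_Ioc_right hs.2
      have := (R.restrictScalars ℝ).intervalIntegral_comp_comm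
        (intervalIntegrable_opK hT h0 h1 hs.1 (hg.mono_set hss) fun r hr => hN r (hss hr))
      refine Eq.trans ?_ this
      refine intervalIntegral.integral_congr fun r hr => ?_
      rw [uIcc_of_le hs.1] at hr
      simp only [opK, ContinuousLinearMap.coe_restrictScalars', R.map_smul_of_tower,
        resolvent_opG hT h0 h1 hR (sub_nonneg.2 hr.2)]
    have e3 : ∫ s in c..t, R (u s - opE A α (s - c) x - ∫ r in c..s, opK A α (s - r) (g r)) =
        (∫ s in c..t, R (u s)) - (∫ s in c..t, opE A α (s - c) (R x)) -
        ∫ s in c..t, ∫ r in c..s, opK A α (s - r) (R (g r)) := by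
      have hR3 : ContinuousOn (fun s => ∫ r in c..s, opK A α (s - r) (R (g r))) (Icc c T) :=
        (R.continuous.comp_continuousOn hconv).congr e2
      rw [← intervalIntegral.integral_sub iR ((hopE (R x)).mono hsubI).intervalIntegrable,
        ← intervalIntegral.integral_sub (iR.sub ((hopE (R x)).mono hsubI).intervalIntegrable)
          (hR3.mono hsubI).intervalIntegrable]
      refine intervalIntegral.integral_congr fun s hs => ?_
      have hs' := hsubI hs
      simp only [map_sub]
      rw [e2 s hs', resolvent_opE hT h0 h1 hR (sub_nonneg.2 hs'.1)]
    rw [e1, intervalIntegral.integral_sub iR iE] at key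
    rw [e3, ← sub_eq_zero.2 key]
    abel
  intro t ht
  -- A continuous function with vanishing primitive is zero; then R is cancelled by injectivity.
  have hz := eqOn_zero_of_integral_eq_zero hcT
    (R.continuous.comp_continuousOn ((hu.sub (hopE x)).sub hconv)) hpos (Ioc_subset_Icc_self ht)
  have := hR.injective hz
  simp only [Pi.sub_apply] at this
  rwa [sub_sub, sub_eq_zero] at this

end Kernel

theorem one_sub_gam (α β : ℝ) : 1 - gam α β = (1 - β) * (1 - α) := by rw [gam]; ring

/-! ### Integration of the Hilfer derivative. -/

section HilferDerivative

variable {E : Type*} [NormedAddCommGroup E] [NormedSpace ℝ E]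

theorem fracInt_one (c : ℝ) (w : ℝ → E) (t : ℝ) : fracInt 1 c w t = ∫ s in c..t, w s := by
  simp [fracInt]

theorem FracIntExists.clm {F : Type*} [NormedAddCommGroup F] [NormedSpace ℝ F] (L : E →L[ℝ] F)
    {δ c t : ℝ} {w : ℝ → E} (h : FracIntExists δ c w t) :
    FracIntExists δ c (fun s => L (w s)) t := fun hδ => by
  have h' := h hδ
  have h2 : IntervalIntegrable (fun s => L ((t - s) ^ (δ - 1) • w s)) volume c t :=
    ⟨L.integrable_comp h'.1, L.integrable_comp h'.2⟩
  simpa only [map_smul] using h2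

theorem aestronglyMeasurable_fracInt {δ c T : ℝ} {w : ℝ → E}
    (hw : AEStronglyMeasurable w (volume.restrict (Ioc c T))) :
    AEStronglyMeasurable (fracInt δ c w) (volume.restrict (Ioc c T)) := by
  by_cases hδ : δ = 0
  · exact hw.congr (Eventually.of_forall fun s => by simp [fracInt, hδ])
  have h : AEStronglyMeasurable ({q : ℝ × ℝ | q.2 < q.1}.indicator
      fun q => (q.1 - q.2) ^ (δ - 1) • w q.2)
      ((volume.restrict (Ioc c T)).prod (volume.restrict (Ioc c T))) := by
    refine AEStronglyMeasurable.indicator ?_ (measurableSet_lt measurable_snd measurable_fst)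
    exact AEStronglyMeasurable.smul (Measurable.aestronglyMeasurable (by fun_prop)) hw.comp_snd
  refine (h.integral_prod_right'.const_smul (Real.Gamma δ)⁻¹).congr ?_
  filter_upwards [ae_restrict_mem measurableSet_Ioc] with s hs
  rw [fracInt, if_neg hδ, ← setIntegral_triangle hs]
  rfl

variable [CompleteSpace E]

/-- The convolution is continuous up to `c`, where it is an integral over a point. For γ < 1 this
forces the initial datum of a continuous solution to vanish. -/
theorem tendsto_fracInt_zero {δ c T : ℝ} (hδ : 0 < δ) (hδ1 : δ ≤ 1) (hcT : c < T) {u : ℝ → E}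
    (hu : ContinuousOn u (Icc c T)) : Tendsto (fracInt δ c u) (𝓝[>] c) (𝓝 0) := by
  obtain ⟨N, hN⟩ := isCompact_Icc.exists_bound_of_continuousOn hu
  have h := continuousOn_conv (G := fun _ => ContinuousLinearMap.id ℝ E)
    (fun x => continuousOn_const) hδ hδ1
    ((hu.mono Ioc_subset_Icc_self).aestronglyMeasurable measurableSet_Ioc)
    (fun s hs => hN s (Ioc_subset_Icc_self hs))
    ((norm_nonneg _).trans (hN c (left_mem_Icc.2 hcT.le)))
  have h1 := (h c (left_mem_Icc.2 hcT.le)).tendsto.const_smul (Real.Gamma δ)⁻¹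
  simp only [intervalIntegral.integral_same, smul_zero, ContinuousLinearMap.id_apply] at h1
  have h2 : 𝓝[>] c ≤ 𝓝[Icc c T] c := by
    rw [← nhdsWithin_Ioo_eq_nhdsGT hcT]
    exact nhdsWithin_mono _ Ioo_subset_Icc_self
  refine (h1.mono_left h2).congr fun t => ?_
  rw [fracInt, if_neg hδ.ne']

variable {α β c T : ℝ} {u D : ℝ → E}

theorem aestronglyMeasurable_of_hasDerivWithinAt {v v' : ℝ → E}
    (h : ∀ t ∈ Ioc c T, HasDerivWithinAt v (v' t) (Icc c T) t) :
    AEStronglyMeasurable v' (volume.restrict (Ioc c T)) := by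
  refine (stronglyMeasurable_deriv v).aestronglyMeasurable.congr ?_
  filter_upwards [ae_restrict_mem measurableSet_Ioc,
    ae_restrict_of_ae (Measure.ae_ne volume T)] with t ht hne
  exact ((h t ht).hasDerivAt (Icc_mem_nhds ht.1 (lt_of_le_of_ne ht.2 hne))).deriv

theorem HasHilferDerivOn.aestronglyMeasurable (hD : HasHilferDerivOn α β c T u D) :
    AEStronglyMeasurable D (volume.restrict (Ioc c T)) := by
  obtain ⟨v', hv⟩ := hD
  refine (aestronglyMeasurable_fracInt (δ := β * (1 - α)) (aestronglyMeasurable_of_hasDerivWithinAt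
    fun t ht => (hv t ht).2.1)).congr ?_
  filter_upwards [ae_restrict_mem measurableSet_Ioc] with t ht using (hv t ht).2.2.2

/-- If `(T - s)^(δ - 1) q(s)` is integrable with `0 < δ ≤ 1`, then so is `q`. -/
theorem FracIntExists.integrableOn {δ : ℝ} (hδ : 0 < δ) (hδ1 : δ ≤ 1) (hcT : c < T) {q : ℝ → E}
    (hq : AEStronglyMeasurable q (volume.restrict (Ioc c T))) (h : FracIntExists δ c q T) :
    IntegrableOn q (Ioc c T) := by
  have h1 : IntegrableOn (fun s => (T - s) ^ (δ - 1) • q s) (Ioc c T) :=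
    (intervalIntegrable_iff_integrableOn_Ioc_of_le hcT.le).1 (h hδ.ne')
  refine (h1.norm.const_mul ((T - c) ^ (1 - δ))).mono' hq ?_
  filter_upwards [ae_restrict_mem measurableSet_Ioc,
    ae_restrict_of_ae (Measure.ae_ne volume T)] with s hs hne
  have hsT : 0 < T - s := sub_pos.2 (lt_of_le_of_ne hs.2 hne)
  have hcT' : 0 < T - c := sub_pos.2 hcT
  rw [norm_smul, Real.norm_of_nonneg (by positivity), ← mul_assoc]
  have h2 : 1 ≤ (T - c) ^ (1 - δ) * (T - s) ^ (δ - 1) := by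
    calc (1 : ℝ) = (T - c) ^ (1 - δ) * (T - c) ^ (δ - 1) := by
          rw [← Real.rpow_add hcT']; simp
      _ ≤ _ := by
          gcongr ?_ * ?_
          exact Real.rpow_le_rpow_of_nonpos hsT (by linarith [hs.1]) (by linarith)
  exact le_mul_of_one_le_left (norm_nonneg _) h2

/-- Integration of a bounded image of the Hilfer derivative. -/
theorem HasHilferDerivOn.fracInt_clm_eq (hα : α ∈ Ioc (0 : ℝ) 1) (hβ : β ∈ Icc (0 : ℝ) 1)
    (hcT : c < T) (hu : ContinuousOn u (Icc c T)) (hD : HasHilferDerivOn α β c T u D) {x : E}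
    (hx : Tendsto (fracInt (1 - gam α β) c u) (𝓝[>] c) (𝓝 x)) (hx0 : gam α β ≠ 1 → x = 0)
    (R : E →L[ℝ] E) {N : ℝ} (hN : ∀ s ∈ Ioc c T, ‖R (D s)‖ ≤ N) :
    ∀ t ∈ Ioc c T, fracInt (1 - α) c (fun s => R (u s) - R x) t = ∫ s in c..t, R (D s) := by
  have hDm := R.continuous.comp_aestronglyMeasurable hD.aestronglyMeasurable
  obtain ⟨v', hv⟩ := hD
  have hv'm := aestronglyMeasurable_of_hasDerivWithinAt fun t ht => (hv t ht).2.1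
  rw [one_sub_gam] at hx
  have hα1 : 0 ≤ 1 - α := sub_nonneg.2 hα.2
  have hβ1 : 0 ≤ 1 - β := sub_nonneg.2 hβ.2
  have hsum : (1 - β) * (1 - α) + β * (1 - α) = 1 - α := by ring
  have hδx : (1 - β) * (1 - α) ≠ 0 → x = 0 := fun h => hx0 fun h1 => h (by
    rw [← one_sub_gam, h1, sub_self])
  have hδ : 0 ≤ (1 - β) * (1 - α) := by positivity
  have hδ' : 0 ≤ β * (1 - α) := mul_nonneg hβ.1 hα1
  have hδ'1 : 0 < 1 - β * (1 - α) := by nlinarith [hα.1, hβ.1]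
  set δ := (1 - β) * (1 - α)
  set δ' := β * (1 - α)
  have hqm : AEStronglyMeasurable (fun s => R (v' s)) (volume.restrict (Ioc c T)) :=
    R.continuous.comp_aestronglyMeasurable hv'm
  have hqe : ∀ t ∈ Ioc c T, FracIntExists δ' c (fun s => R (v' s)) t := fun t ht =>
    (hv t ht).2.2.1.clm R
  have hq : ∀ t ∈ Ioc c T, fracInt δ' c (fun s => R (v' s)) t = R (D t) := fun t ht => by
    rw [fracInt_clm R (hv t ht).2.2.1, (hv t ht).2.2.2]
  have hqi : IntegrableOn (fun s => R (v' s)) (Ioc c T) := by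
    -- For δ' = 0 the inner derivative is D itself, whose image is bounded; for δ' > 0 integrability
    -- is inherited from the convergence of the outer fractional integral at `T`.
    rcases hδ'.eq_or_lt with h | h
    · refine integrableOn_Ioc_of_norm_le hqm (N := N) fun s hs => ?_
      have := hq s hs
      rw [← h, fracInt, if_pos rfl] at this
      rw [this]; exact hN s hs
    · exact (hqe T ⟨hcT, le_rfl⟩).integrableOn h (by linarith) hcT hqm
  have hsub : ∀ {t}, t ∈ Ioc c T → Ioc c t ⊆ Ioc c T := fun ht => Ioc_subset_Ioc_right ht.2
  -- By the fundamental theorem the left side is ∫ Rv' = I^{1-δ'} I^{δ'} Rv', and I^{δ'} Rv' = RD.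
  have h1 : ∀ t ∈ Ioc c T, R (fracInt δ c u t) - R x =
      fracInt (1 - δ') c (fun s => R (D s)) t := by
    intro t ht
    have hi : IntervalIntegrable (fun s => R (v' s)) volume c t :=
      (intervalIntegrable_iff_integrableOn_Ioc_of_le ht.1.le).2 (hqi.mono_set (hsub ht))
    have hftc := intervalIntegral.integral_eq_sub_of_hasDerivAt_of_tendsto ht.1
      (f := fun s => R (fracInt δ c u s)) (f' := fun s => R (v' s)) (fa := R x)
      (fb := R (fracInt δ c u t))
      (fun s hs => R.hasFDerivAt.comp_hasDerivAt s ((hv s ⟨hs.1, hs.2.le.trans ht.2⟩).2.1.hasDerivAt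
        (Icc_mem_nhds hs.1 (hs.2.trans_le ht.2)))) hi ((R.continuous.tendsto x).comp hx) (by
        refine (R.continuous.tendsto _).comp ?_
        have := (hv t ht).2.1.continuousWithinAt.tendsto
        refine this.mono_left ?_
        rw [← nhdsWithin_Ioo_eq_nhdsLT ht.1]
        exact nhdsWithin_mono _ (Ioo_subset_Icc_self.trans (Icc_subset_Icc_right ht.2)))
    rw [← hftc, ← fracInt_one, ← fracInt_congr ht.1 (fun s hs => hq s (hsub ht hs)),
      fracInt_fracInt hδ' hδ'1.le ht.1 (hqm.mono_set (hsub ht))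
        (fun s hs => hqe s (hsub ht hs)), add_sub_cancel]
    rw [add_sub_cancel]
    intro _
    simpa using hi
  have hw : ContinuousOn (fun s => R (u s) - R x) (Icc c T) :=
    (R.continuous.comp_continuousOn hu).sub continuousOn_const
  obtain ⟨N', hN'⟩ := isCompact_Icc.exists_bound_of_continuousOn hw
  have hwm : AEStronglyMeasurable (fun s => R (u s) - R x) (volume.restrict (Ioc c T)) :=
    (hw.mono Ioc_subset_Icc_self).aestronglyMeasurable measurableSet_Ioc
  -- Subtracting the constant inside or outside is the same: for δ = 0 the integral is the identity,
  -- and for δ > 0 the constant is 0.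
  have h2 : ∀ t ∈ Ioc c T, fracInt δ c (fun s => R (u s) - R x) t =
      R (fracInt δ c u t) - R x := by
    intro t ht
    by_cases hd : δ = 0
    · simp [fracInt, hd]
    · rw [hδx hd, map_zero, sub_zero, ← fracInt_clm R (hv t ht).1]
      simp only [sub_zero]
  intro t ht
  have hex : ∀ {a : ℝ}, 0 ≤ a → ∀ s ∈ Ioc c t,
      FracIntExists a c (fun s => R (u s) - R x) s := fun ha s hs =>
    fracExists_of_bounded ha hs.1.le (hwm.mono_set ((Ioc_subset_Ioc_right hs.2).trans (hsub ht)))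
      fun r hr => hN' r (Ioc_subset_Icc_self (hsub ht ⟨hr.1, hr.2.trans hs.2⟩))
  have hexD : ∀ {a : ℝ}, 0 ≤ a → ∀ s ∈ Ioc c t,
      FracIntExists a c (fun s => R (D s)) s := fun ha s hs =>
    fracExists_of_bounded ha hs.1.le (hDm.mono_set ((Ioc_subset_Ioc_right hs.2).trans (hsub ht)))
      fun r hr => hN r (hsub ht ⟨hr.1, hr.2.trans hs.2⟩)
  have htt : t ∈ Ioc c t := ⟨ht.1, le_rfl⟩
  -- Applying I^{δ'} to both sides, the orders add up to δ + δ' = 1 - α on the left and (1 - δ') +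
  -- δ' = 1 on the right.
  rw [← fracInt_one, ← hsum, ← fracInt_fracInt hδ hδ' ht.1 (hwm.mono_set (hsub ht)) (hex hδ)
    (hex (by positivity) t htt), fracInt_congr ht.1 (fun s hs => (h2 s (hsub ht hs)).trans
      (h1 s (hsub ht hs))), fracInt_fracInt hδ'1.le hδ' ht.1 (hDm.mono_set (hsub ht))
      (hexD hδ'1.le) (hexD (by linarith) t htt), sub_add_cancel]

end HilferDerivative

/-! ### From classical to mild solutions. -/

section Solutions

variable {𝕜 : Type*} [RCLike 𝕜] {E : Type*} [NormedAddCommGroup E] [NormedSpace ℝ E]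
  [NormedSpace 𝕜 E] [IsScalarTower ℝ 𝕜 E] [CompleteSpace E] {A : E →ₗ.[𝕜] E} {M ω α β c T : ℝ}

/-- The representation of the solutions of the linear inhomogeneous problem. -/
theorem HasHilferDerivOn.eq_opE_add_integral_opK (hA : IsClassG A M ω) (hα : α ∈ Ioc (0 : ℝ) 1)
    (hβ : β ∈ Icc (0 : ℝ) 1) (hcT : c < T) {u D g : ℝ → E} (hu : ContinuousOn u (Icc c T))
    (hD : HasHilferDerivOn α β c T u D)
    (heq : ∀ t ∈ Ioc c T, ∃ h : u t ∈ A.domain, D t + A ⟨u t, h⟩ = g t) {x : E}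
    (hx : Tendsto (fracInt (1 - gam α β) c u) (𝓝[>] c) (𝓝 x)) (hx0 : gam α β ≠ 1 → x = 0)
    {N : ℝ} (hN : ∀ s ∈ Ioc c T, ‖g s‖ ≤ N) :
    AEStronglyMeasurable g (volume.restrict (Ioc c T)) ∧
    ∀ t ∈ Ioc c T, u t = opE A α (t - c) x + ∫ s in c..t, opK A α (t - s) (g s) := by
  have hgraph : ∀ t ∈ Ioc c T, (u t, g t - D t) ∈ A.graph := by
    intro t ht
    obtain ⟨h, e⟩ := heq t ht
    rw [← e, add_sub_cancel_left]
    exact A.mem_graph ⟨u t, h⟩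
  have hDm := hD.aestronglyMeasurable
  have hgm : AEStronglyMeasurable g (volume.restrict (Ioc c T)) := by
    -- Measurability of `g` cannot be read off from its formula in the application, since the maps
    -- bᵢ are arbitrary. It follows from the equation: D is measurable, and Au is a pointwise limit
    -- of Yosida approximations of the continuous u.
    obtain ⟨B, -, -, hB⟩ := hA.exists_yosida
    have h1 : AEStronglyMeasurable (fun t => -(g t - D t)) (volume.restrict (Ioc c T)) := by
      refine aestronglyMeasurable_of_tendsto_ae atTop (f := fun n t => B n (u t)) (fun n => ?_) ?_
      · exact (((B n).continuous.comp_continuousOn hu).mono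
          Ioc_subset_Icc_self).aestronglyMeasurable measurableSet_Ioc
      · filter_upwards [ae_restrict_mem measurableSet_Ioc] with t ht using hB _ _ (hgraph t ht)
    exact (h1.neg.add hDm).congr (Eventually.of_forall fun t => by simp)
  refine ⟨hgm, ?_⟩
  -- Neither D nor Au has a known bound near `c`, but RD is a combination of Rg, u and Ru and hence
  -- bounded.
  obtain ⟨R, hR, -⟩ := hA.exists_resolvent (lt_add_one ω)
  have hRD : ∀ t ∈ Ioc c T, R (D t) = R (g t) - (u t - (ω + 1) • R (u t)) := by
    intro t ht
    have h := hR.apply_graph _ _ (hgraph t ht)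
    rw [map_add, map_sub, R.map_smul_of_tower] at h
    generalize (ω + 1) • R (u t) = z at h ⊢
    rw [← h]
    abel
  obtain ⟨N', hN'⟩ := isCompact_Icc.exists_bound_of_continuousOn
    (hu.sub ((R.continuous.comp_continuousOn hu).const_smul (ω + 1)))
  have hRDN : ∀ s ∈ Ioc c T, ‖R.restrictScalars ℝ (D s)‖ ≤ ‖R‖ * N + N' := by
    intro s hs
    rw [ContinuousLinearMap.coe_restrictScalars', hRD s hs]
    refine (norm_sub_le _ _).trans (add_le_add ?_ (hN' s (Ioc_subset_Icc_self hs)))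
    exact (R.le_opNorm _).trans (by gcongr; exact hN s hs)
  have key := hD.fracInt_clm_eq hα hβ hcT hu hx hx0 (R.restrictScalars ℝ) hRDN
  refine HilferEvolution.eq_opE_add_integral_opK hA.isSemigroup hα.1 hα.2 hR hcT hu
    ((norm_nonneg _).trans (hN T ⟨hcT, le_rfl⟩)) hgm hN x fun t ht => ?_
  refine (key t ht).trans ?_
  rw [intervalIntegral.integral_of_le ht.1.le, intervalIntegral.integral_of_le ht.1.le]
  exact setIntegral_congr_fun measurableSet_Ioc fun s hs => hRD s ⟨hs.1, hs.2.trans ht.2⟩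

/-- The Lipschitz condition enters only here: comparison with the value of `f` at `(c, 0)` bounds
the right-hand side along a bounded `u`. -/
theorem exists_norm_rhs_le {r : ℕ} {b : Fin r → ℝ → ℝ}
    (hb : ∀ i, MapsTo (b i) (Icc c T) (Icc c T)) {f : ℝ → (Fin (r + 1) → E) → E} {L : ℝ≥0}
    (hf : LipschitzOnWith L (fun q : ℝ × (Fin (r + 1) → E) => f q.1 q.2) (Icc c T ×ˢ univ))
    {u : ℝ → E} (hu : ContinuousOn u (Icc c T)) :
    ∃ N, ∀ s ∈ Ioc c T, ‖rhs f b u s‖ ≤ N := by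
  obtain ⟨N, hN⟩ := isCompact_Icc.exists_bound_of_continuousOn hu
  refine ⟨‖f c 0‖ + L * max (T - c) N, fun s hs => ?_⟩
  have hs' := Ioc_subset_Icc_self hs
  have hc : c ∈ Icc c T := left_mem_Icc.2 (hs.1.le.trans hs.2)
  have h := hf.dist_le_mul (s, Fin.cons (u s) fun i => u (b i s)) ⟨hs', mem_univ _⟩ (c, 0)
    ⟨hc, mem_univ _⟩
  have hN0 : 0 ≤ N := (norm_nonneg _).trans (hN c hc)
  have hd : dist (s, (Fin.cons (u s) fun i => u (b i s) : Fin (r + 1) → E)) (c, 0) ≤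
      max (T - c) N := by
    rw [Prod.dist_eq]
    refine max_le_max ?_ ?_
    · rw [Real.dist_eq, abs_of_nonneg (sub_nonneg.2 hs.1.le)]; linarith [hs.2]
    · rw [dist_zero_right, pi_norm_le_iff_of_nonneg hN0]
      intro i
      refine Fin.cases ?_ (fun j => ?_) i
      · simpa using hN s hs'
      · simpa using hN _ (hb j hs')
  rw [dist_eq_norm] at h
  have h2 : ‖rhs f b u s - f c 0‖ ≤ L * max (T - c) N := h.trans (by gcongr)
  calc ‖rhs f b u s‖ = ‖f c 0 + (rhs f b u s - f c 0)‖ := by rw [add_sub_cancel]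
    _ ≤ _ := (norm_add_le _ _).trans (by gcongr)

/-- Classical solutions of the nonlocal problem are mild solutions. -/
theorem IsClassicalSolution.isMildSolution (hA : IsClassG A M ω) (hα : α ∈ Ioc (0 : ℝ) 1)
    (hβ : β ∈ Icc (0 : ℝ) 1) {t₀ a : ℝ} (ha : 0 < a) {r p : ℕ} {τ : Fin p → ℝ}
    (hτJ : ∀ k, τ k ∈ Ioc t₀ (t₀ + a)) {C : Fin p → 𝕜} {B : E →ₗ[𝕜] E}
    (hB : IsOpB A α β t₀ τ C B) {b : Fin r → ℝ → ℝ}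
    (hb : ∀ i, MapsTo (b i) (Icc t₀ (t₀ + a)) (Icc t₀ (t₀ + a)))
    {f : ℝ → (Fin (r + 1) → E) → E} {L : ℝ≥0}
    (hf : LipschitzOnWith L (fun q : ℝ × (Fin (r + 1) → E) => f q.1 q.2)
      (Icc t₀ (t₀ + a) ×ˢ univ))
    {u₀ : E} {u : ℝ → E} (hu : IsClassicalSolution A α β t₀ a f b τ C u₀ u) :
    IsMildSolution A α β t₀ a f b τ C B u₀ u := by
  have hcT : t₀ < t₀ + a := by linarith
  have huc := hu.continuousOn
  obtain ⟨N, hN⟩ := exists_norm_rhs_le hb hf huc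
  obtain ⟨D, hD, heq⟩ := hu.equation
  obtain ⟨x, hx, hxu⟩ := hu.nonlocal_condition
  have hγ := one_sub_gam α β
  have hα1 : 0 ≤ 1 - α := sub_nonneg.2 hα.2
  have hβ1 : 0 ≤ 1 - β := sub_nonneg.2 hβ.2
  have hγ0 : 0 ≤ 1 - gam α β := hγ ▸ mul_nonneg hβ1 hα1
  have hγ1 : 1 - gam α β ≤ 1 := by
    rw [gam]; nlinarith [mul_nonneg hβ.1 hα1, hα.1]
  -- Uniqueness of limits: for γ < 1 the limit of the fractional integral of the continuous `u` is
  -- 0.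
  have hx0 : gam α β ≠ 1 → x = 0 := fun h => tendsto_nhds_unique hx
    (tendsto_fracInt_zero (lt_of_le_of_ne hγ0 fun h' => h (by linarith)) hγ1 hcT huc)
  obtain ⟨hgm, hrep⟩ := hD.eq_opE_add_integral_opK hA hα hβ hcT huc heq hx hx0 hN
  have hsub : ∀ {t}, t ∈ Ioc t₀ (t₀ + a) → Ioc t₀ t ⊆ Ioc t₀ (t₀ + a) := fun ht =>
    Ioc_subset_Ioc_right ht.2
  obtain ⟨S, -, hS⟩ := exists_opE hA.isSemigroup hα.1 hα.2
  have hrep' : ∀ t ∈ Ioc t₀ (t₀ + a), u t = opE A α (t - t₀) x + conv A α t₀ f b u t := hrep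
  have hum : AEStronglyMeasurable u (volume.restrict (Ioc t₀ (t₀ + a))) :=
    (huc.mono Ioc_subset_Icc_self).aestronglyMeasurable measurableSet_Ioc
  obtain ⟨N', hN'⟩ := isCompact_Icc.exists_bound_of_continuousOn huc
  have hconvu : gam α β ≠ 1 → EqOn u (conv A α t₀ f b u) (Ioc t₀ (t₀ + a)) := fun h t ht => by
    rw [hrep' t ht, hx0 h, ← hS _ (sub_nonneg.2 ht.1.le), map_zero, zero_add]
  -- The limit at t₀ uses 0^0 = 1: this value is u(t₀) for γ = 1 and 0 for γ < 1.
  refine ⟨⟨huc.mono Ioc_subset_Icc_self, (0 : ℝ) ^ (1 - gam α β) • u t₀, ?_, fun h => ?_⟩,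
    fun t ht => ?_, fun k => ?_, fun t ht => ?_⟩
  · have hle : 𝓝[>] t₀ ≤ 𝓝[Icc t₀ (t₀ + a)] t₀ := by
      rw [← nhdsWithin_Ioo_eq_nhdsGT hcT]
      exact nhdsWithin_mono _ Ioo_subset_Icc_self
    refine Tendsto.smul ?_ ((huc t₀ (left_mem_Icc.2 hcT.le)).tendsto.mono_left hle)
    have hc : Continuous fun t : ℝ => (t - t₀) ^ (1 - gam α β) :=
      (Real.continuous_rpow_const hγ0).comp (by fun_prop)
    simpa using (hc.tendsto t₀).mono_left nhdsWithin_le_nhds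
  · rw [h, sub_self, Real.rpow_zero, one_smul]
  · exact intervalIntegrable_opK hA.isSemigroup hα.1 hα.2 ht.1.le (hgm.mono_set (hsub ht))
      fun s hs => hN s (hsub ht hs)
  -- For γ = 1 nothing has to converge; for γ < 1 the convolution coincides with the bounded
  -- function u.
  · by_cases h : gam α β = 1
    · exact fun h' => absurd (by rw [h, sub_self]) h'
    · refine FracIntExists.congr (hτJ k).1 ((hconvu h).mono (hsub (hτJ k))) ?_
      exact fracExists_of_bounded hγ0 (hτJ k).1.le (hum.mono_set (hsub (hτJ k)))
        fun s hs => hN' s (Ioc_subset_Icc_self (hsub (hτJ k) hs))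
  -- For γ = 1 the representation of u at the points τₖ turns the nonlocal condition into Qx + ∑ₖ Cₖ
  -- w(τₖ) = u₀, where Q is `opQ` and w the convolution; applying B gives x = Bu₀ - B∑ₖ Cₖ w(τₖ).
  · by_cases h : gam α β = 1
    · have hδ' : β * (1 - α) = 1 - α := by rw [gam] at h; linarith
      have hSE : ∀ t, 0 < t → ∀ z, opS A α β t z = S t z := fun t ht z => by
        rw [opS, hδ', fracInt_opK hA.isSemigroup hα.1 hα.2 ht, hS t ht.le]
      have hu₀ : opQ A α β t₀ τ C x +
          ∑ k, C k • fracInt (1 - gam α β) t₀ (conv A α t₀ f b u) (τ k) = u₀ := by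
        rw [← hxu, opQ, add_assoc, ← Finset.sum_add_distrib]
        congr 1
        refine Finset.sum_congr rfl fun k _ => ?_
        have hk := sub_pos.2 (hτJ k).1
        simp only [h, sub_self, fracInt, if_true]
        rw [← smul_add, hSE _ hk, hrep' _ (hτJ k), hS _ hk.le]
      have ht' := sub_pos.2 ht.1
      rw [← hu₀, map_add, hB.1, hSE _ ht', hSE _ ht', map_add, hrep' t ht, hS _ ht'.le]
      abel
    -- For γ < 1 the datum x is 0 and u = w, so the nonlocal condition says that the sum is u₀ and
    -- the two terms with B cancel.
    · have hu₀ : ∑ k, C k • fracInt (1 - gam α β) t₀ (conv A α t₀ f b u) (τ k) = u₀ := by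
        rw [← hxu, hx0 h, zero_add]
        refine Finset.sum_congr rfl fun k _ => ?_
        rw [fracInt_congr (hτJ k).1 ((hconvu h).mono (hsub (hτJ k)))]
      rw [hu₀, add_sub_cancel_left]
      exact hconvu h ht

end Solutions

end HilferEvolution

end

theorem theorem4p1 {𝕜 : Type*} [RCLike 𝕜] {E : Type*} [NormedAddCommGroup E] [NormedSpace ℝ E]
    [NormedSpace 𝕜 E] [IsScalarTower ℝ 𝕜 E] [CompleteSpace E]
    (A : E →ₗ.[𝕜] E) (M ω : ℝ) (hA : HilferEvolution.IsClassG A M ω)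
    (α β : ℝ) (hα : α ∈ Ioc (0 : ℝ) 1) (hβ : β ∈ Icc (0 : ℝ) 1)
    (t₀ a : ℝ) (ht₀ : 0 ≤ t₀) (ha : 0 < a)
    (r p : ℕ) (τ : Fin p → ℝ) (hτ : StrictMono τ) (hτJ : ∀ k, τ k ∈ Ioc t₀ (t₀ + a))
    (C : Fin p → 𝕜) (hC : ∀ k, C k ≠ 0)
    (B : E →ₗ[𝕜] E) (hB : HilferEvolution.IsOpB A α β t₀ τ C B)
    (b : Fin r → ℝ → ℝ) (hb : ∀ i, MapsTo (b i) (Icc t₀ (t₀ + a)) (Icc t₀ (t₀ + a)))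
    (f : ℝ → (Fin (r + 1) → E) → E)
    (hf : ∃ L : ℝ≥0, LipschitzOnWith L (fun q : ℝ × (Fin (r + 1) → E) => f q.1 q.2)
      (Icc t₀ (t₀ + a) ×ˢ univ))
    (u₀ : E) (u : ℝ → E)
    (hu : HilferEvolution.IsClassicalSolution A α β t₀ a f b τ C u₀ u) :
    HilferEvolution.IsMildSolution A α β t₀ a f b τ C B u₀ u := by
  obtain ⟨L, hL⟩ := hf
  exact hu.isMildSolution hA hα hβ ha hτJ hB hb hL
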